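/- Let $n\in\mathbb N_0$, $1<p<\infty$, $t>0$. For $s>0$ let $d\mu_s(z)=(\pi s)^{-n}e^{-|z|^2/s}\,dV(z)$ on $\mathbb C^n$, and let $F_t^p$ be the Banach space of entire functions in $L^p(\mathbb C^n,\mu_{2t/p})$. Put $W_zf(w)=e^{w\cdot\bar z/t-|z|^2/(2t)}f(w-z)$ and $Uf(w)=f(-w)$ for $f\in F_t^p$. The group $\mathbb C^n$ acts on functions by $\alpha_z(f)(w)=f(w-z)$ and on $\mathcal L(F_t^p)$ by $\alpha_z(A)=W_zAW_{-z}$. Let $\mathcal C_1$ be the set of $A\in\mathcal L(F_t^p)$ for which $z\mapsto\alpha_z(A)$ is norm continuous. For bounded continuous $f$ let $T_f^t\in\mathcal L(F_t^p)$ be the Toeplitz operator $T_f^tg(z)=\int e^{z\cdot\bar w/t}f(w)g(w)\,d\mu_t(w)$. For a set $S$ of such functions let $\mathcal T^{p,t}_{lin}(S)$ be the norm closed linear span of $\{T_f^t: f\in S\}$. For $A$ in the nuclear operators $\mathcal N(F_t^p)$ and $B\in\mathcal L(F_t^p)$ let $(A\ast B)(z)=\operatorname{Tr}(A\,\alpha_z(UBU))$.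 Call $A\in\mathcal N(F_t^p)$ convolvable if $B\ast(UAU)\in L^1(\mathbb C^n)$ for all $B\in\mathcal N(F_t^p)$ (for $p=2$ every nuclear operator is convolvable). For convolvable $A$ and $f\in\mathrm{BUC}(\mathbb C^n)$, the operator $f\ast A=A\ast f\in\mathcal L(F_t^p)$ is defined by $\operatorname{Tr}((f\ast A)B)=\int f\cdot(B\ast(UAU))\,dV$ for all $B\in\mathcal N(F_t^p)$. Linear subspaces $\mathcal D_0\subseteq\mathrm{BUC}(\mathbb C^n)$ and $\mathcal D_1\subseteq\mathcal L(F_t^p)$ are called corresponding if $A\ast B\in\mathcal D_0$ for all $A\in\mathcal N(F_t^p)$, $B\in\mathcal D_1$, and $A\ast f\in\mathcal D_1$ for all convolvable $A\in\mathcal N(F_t^p)$ and all $f\in\mathcal D_0$. Proposition. Let $\mathcal D_0\subseteq\mathrm{BUC}(\mathbb C^n)$ be a closed $\alpha$-invariant linear subspace. Then $\mathcal D_0\leftrightarrow\mathcal T^{p,t}_{lin}(\mathcal D_0)$. That is, $\mathcal T^{p,t}_{lin}(\mathcal D_0)$ is a closed $\alpha$-invariant subspace of $\mathcal C_1$ corresponding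 to $\mathcal D_0$, it is the only closed $\alpha$-invariant subspace of $\mathcal C_1$ corresponding to $\mathcal D_0$, and $\mathcal D_0$ is the only closed $\alpha$-invariant subspace of $\mathrm{BUC}(\mathbb C^n)$ corresponding to $\mathcal T^{p,t}_{lin}(\mathcal D_0)$. -/

import Mathlib

open MeasureTheory
open scoped ENNReal BoundedContinuousFunction

namespace Fock

/-- `ℂⁿ` with the Euclidean norm and Lebesgue measure. -/
abbrev CSpace (n : ℕ) : Type := EuclideanSpace ℂ (Fin n)

noncomputable section

/-- The density `(πs)⁻ⁿ exp(-|z|²/s)`. -/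
def gaussianDensity (n : ℕ) (s : ℝ) (z : CSpace n) : ℝ :=
  (1 / (Real.pi * s) ^ n) * Real.exp (-‖z‖ ^ 2 / s)

/-- The Gaussian probability measure `μ_s` on `ℂⁿ`. -/
def gaussianMeasure (n : ℕ) (s : ℝ) : Measure (CSpace n) :=
  volume.withDensity (fun z => ENNReal.ofReal (gaussianDensity n s z))

variable {n : ℕ} {p t : ℝ}

theorem gaussianDensity_pos {s : ℝ} (hs : 0 < s) (z : CSpace n) : 0 < gaussianDensity n s z := by
  unfold gaussianDensity; positivity

theorem continuous_gaussianDensity (n : ℕ) (s : ℝ) : Continuous (gaussianDensity n s) := by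
  unfold gaussianDensity; fun_prop

theorem ae_gaussianMeasure {s : ℝ} (hs : 0 < s) {q : CSpace n → Prop} :
    (∀ᵐ z ∂gaussianMeasure n s, q z) ↔ ∀ᵐ z ∂(volume : Measure (CSpace n)), q z := by
  unfold gaussianMeasure
  rw [ae_withDensity_iff (by have := continuous_gaussianDensity n s; fun_prop)]
  simp [gaussianDensity_pos hs]

theorem volume_ac {s : ℝ} (hs : 0 < s) :
    (volume : Measure (CSpace n)) ≪ gaussianMeasure n s := by
  refine Measure.AbsolutelyContinuous.mk fun A _ h => ?_
  have := (ae_gaussianMeasure (n := n) hs (q := fun z => z ∉ A)).1 (by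
    rw [ae_iff]; simpa using h)
  rw [ae_iff] at this; simpa using this

theorem gaussian_ac (n : ℕ) (s : ℝ) :
    gaussianMeasure n s ≪ (volume : Measure (CSpace n)) :=
  withDensity_absolutelyContinuous _ _

/-- The function `z ↦ f(z) exp(-|z|² / (2t))`. -/
def weighted (t : ℝ) (f : CSpace n → ℂ) (z : CSpace n) : ℂ :=
  (Real.exp (-‖z‖ ^ 2 / (2 * t)) : ℂ) * f z

theorem eLpNorm_gaussian (hp : 1 < p) (ht : 0 < t) :
    ∃ c : ℝ≥0∞, c ≠ 0 ∧ c ≠ ∞ ∧ ∀ f : CSpace n → ℂ,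
      eLpNorm f (ENNReal.ofReal p) (gaussianMeasure n (2 * t / p)) =
        c * eLpNorm (weighted t f) (ENNReal.ofReal p) volume := by
  have hp0 : 0 < p := by linarith
  have hne0 : ENNReal.ofReal p ≠ 0 := by simpa using hp0
  have hnet : ENNReal.ofReal p ≠ ∞ := ENNReal.ofReal_ne_top
  have hk : 0 < 1 / (Real.pi * (2 * t / p)) ^ n := by positivity
  refine ⟨(ENNReal.ofReal (1 / (Real.pi * (2 * t / p)) ^ n)) ^ (1 / p), ?_, ?_, ?_⟩
  · simp only [ne_eq, ENNReal.rpow_eq_zero_iff, ENNReal.ofReal_eq_zero,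
      ENNReal.ofReal_ne_top, false_and, or_false, not_and]
    intro h; linarith
  · exact ENNReal.rpow_ne_top_of_nonneg (by positivity) ENNReal.ofReal_ne_top
  intro f
  rw [eLpNorm_eq_lintegral_rpow_enorm_toReal hne0 hnet,
    eLpNorm_eq_lintegral_rpow_enorm_toReal hne0 hnet, ENNReal.toReal_ofReal hp0.le,
    ← ENNReal.mul_rpow_of_nonneg _ _ (by positivity)]
  congr 1
  unfold gaussianMeasure
  rw [lintegral_withDensity_eq_lintegral_mul_non_measurable _
    (by have := continuous_gaussianDensity n (2 * t / p); fun_prop) (by simp),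
    ← lintegral_const_mul' _ _ ENNReal.ofReal_ne_top]
  refine lintegral_congr fun z => ?_
  simp only [weighted, Pi.mul_apply, gaussianDensity]
  rw [enorm_mul, ENNReal.mul_rpow_of_nonneg _ _ hp0.le, ENNReal.ofReal_mul hk.le, mul_assoc]
  congr 2
  rw [← ofReal_norm, Complex.norm_real, Real.norm_of_nonneg (Real.exp_pos _).le,
    ENNReal.ofReal_rpow_of_pos (Real.exp_pos _), ← Real.exp_mul]
  congr 2
  field_simp

theorem continuous_wt (t : ℝ) :
    Continuous fun z : CSpace n => ((Real.exp (-‖z‖ ^ 2 / (2 * t)) : ℝ) : ℂ) := by fun_prop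

theorem memLp_gaussian_iff (hp : 1 < p) (ht : 0 < t) (f : CSpace n → ℂ) :
    MemLp f (ENNReal.ofReal p) (gaussianMeasure n (2 * t / p)) ↔
      MemLp (weighted t f) (ENNReal.ofReal p) volume := by
  obtain ⟨c, hc0, hct, h⟩ := eLpNorm_gaussian (n := n) hp ht
  have hs : 0 < 2 * t / p := by have : 0 < p := by linarith
                                positivity
  unfold MemLp
  rw [h f]
  refine and_congr ⟨fun hf => ?_, fun hf => ?_⟩ ?_
  · exact (continuous_wt t).aestronglyMeasurable.mul (hf.mono_ac (volume_ac hs))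
  · refine AEStronglyMeasurable.mono_ac (gaussian_ac n _) ?_
    have : f = fun z => ((Real.exp (‖z‖ ^ 2 / (2 * t)) : ℝ) : ℂ) * weighted t f z := by
      funext z
      rw [weighted, ← mul_assoc, ← Complex.ofReal_mul, ← Real.exp_add]
      simp [neg_div]
    rw [this]
    refine AEStronglyMeasurable.mul ?_ hf
    exact (by fun_prop : Continuous fun z : CSpace n =>
      ((Real.exp (‖z‖ ^ 2 / (2 * t)) : ℝ) : ℂ)).aestronglyMeasurable
  · constructor
    · intro hlt
      by_contra hcon
      have : eLpNorm (weighted t f) (ENNReal.ofReal p) volume = ∞ := by simpa using hcon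
      rw [this, ENNReal.mul_top hc0] at hlt
      exact lt_irrefl _ hlt
    · intro hlt
      exact ENNReal.mul_lt_top hct.lt_top hlt


/-! ### The reproducing kernel and the Bergman projection -/

/-- The normalized reproducing kernel `k_z(w) = exp(w·z̄/t - |z|²/(2t))`;
`inner ℂ z w` is `w·z̄`. -/
def normalizedKernel (t : ℝ) (z w : CSpace n) : ℂ :=
  Complex.exp (inner ℂ z w / t - ‖z‖ ^ 2 / (2 * t))

theorem norm_kernel_mul (ht : 0 < t) (z w : CSpace n) :
    Real.exp (-‖w‖ ^ 2 / (2 * t)) * ‖normalizedKernel t z w‖ =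
      Real.exp (-‖w - z‖ ^ 2 / (2 * t)) := by
  rw [normalizedKernel, Complex.norm_exp, ← Real.exp_add]
  congr 1
  have h1 : (inner ℂ z w / (t : ℂ) - (‖z‖ : ℂ) ^ 2 / (2 * t)).re =
      (inner ℂ z w).re / t - ‖z‖ ^ 2 / (2 * t) := by
    rw [Complex.sub_re, Complex.div_ofReal_re]
    norm_cast
  have h2 := norm_sub_sq (𝕜 := ℂ) w z
  have h3 : (inner ℂ w z).re = (inner ℂ z w).re := inner_re_symm (𝕜 := ℂ) w z
  rw [h1, h2]
  simp only [RCLike.re_to_complex, h3]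
  field_simp
  ring

theorem norm_weighted_weyl (ht : 0 < t) (z : CSpace n) (f : CSpace n → ℂ) (w : CSpace n) :
    ‖weighted t (fun w => normalizedKernel t z w * f (w - z)) w‖ = ‖weighted t f (w - z)‖ := by
  simp only [weighted, norm_mul, Complex.norm_real, Real.norm_of_nonneg (Real.exp_pos _).le]
  rw [← mul_assoc, norm_kernel_mul ht]

theorem differentiable_kernel (t : ℝ) (z : CSpace n) :
    Differentiable ℂ (normalizedKernel t z) := by
  have : Differentiable ℂ fun w : CSpace n => (inner ℂ z w : ℂ) := (innerSL ℂ z).differentiable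
  unfold normalizedKernel
  fun_prop


/-- `P_t h(z) = ∫ exp(z·w̄/t) h(w) dμ_t(w)`; `inner ℂ w z` is `z·w̄`. -/
def bergmanProjection (t : ℝ) (h : CSpace n → ℂ) (z : CSpace n) : ℂ :=
  ∫ w, Complex.exp (inner ℂ w z / t) * h w ∂gaussianMeasure n t

theorem bergmanProjection_eq (ht : 0 < t) (h : CSpace n → ℂ) (z : CSpace n) :
    bergmanProjection t h z =
      ∫ w, (gaussianDensity n t w : ℂ) * (Complex.exp (inner ℂ w z / t) * h w) := by
  unfold bergmanProjection gaussianMeasure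
  have hm : Measurable fun z : CSpace n => (gaussianDensity n t z).toNNReal :=
    (continuous_gaussianDensity n t).measurable.real_toNNReal
  have := integral_withDensity_eq_integral_smul (μ := (volume : Measure (CSpace n))) hm
    (fun w => Complex.exp (inner ℂ w z / t) * h w)
  refine this.trans (integral_congr_ae (Filter.Eventually.of_forall fun w => ?_))
  simp only [NNReal.smul_def, Complex.real_smul, Real.coe_toNNReal _ (gaussianDensity_pos ht w).le]

theorem memLp_gaussian_exp (ht : 0 < t) (c : ℝ) {q : ℝ} (hq : 1 < q) :
    MemLp (fun w : CSpace n => Real.exp (c * ‖w‖ - ‖w‖ ^ 2 / (2 * t))) (ENNReal.ofReal q)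
      volume := by
  have hq0 : 0 < q := by linarith
  have hcont : Continuous fun w : CSpace n => Real.exp (c * ‖w‖ - ‖w‖ ^ 2 / (2 * t)) := by
    fun_prop
  rw [← integrable_norm_rpow_iff hcont.aestronglyMeasurable (by simpa using hq0)
    ENNReal.ofReal_ne_top, ENNReal.toReal_ofReal hq0.le]
  have hb : 0 < q / (4 * t) := by positivity
  have hi : Integrable (fun w : CSpace n => Real.exp (-(q / (4 * t)) * ‖w‖ ^ 2)) volume := by
    have := (GaussianFourier.integrable_cexp_neg_mul_sq_norm_add (V := CSpace n)
      (b := ((q / (4 * t) : ℝ) : ℂ)) (by rw [Complex.ofReal_re]; exact hb) 0 0).norm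
    refine this.congr (Filter.Eventually.of_forall fun w => ?_)
    simp only [Complex.norm_exp]
    congr 1
    rw [zero_mul, add_zero, ← Complex.ofReal_neg, ← Complex.ofReal_pow, ← Complex.ofReal_mul,
      Complex.ofReal_re]
  refine (hi.const_mul (Real.exp (q * (c ^ 2 * t)))).mono'
    (by fun_prop (disch := positivity) : Measurable _).aestronglyMeasurable
    (Filter.Eventually.of_forall fun w => ?_)
  rw [Real.norm_of_nonneg (Real.exp_pos _).le, Real.norm_of_nonneg (by positivity),
    ← Real.exp_mul, ← Real.exp_add, Real.exp_le_exp]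
  have h1 : c * ‖w‖ ≤ c ^ 2 * t + ‖w‖ ^ 2 / (4 * t) := by
    have : 0 ≤ (2 * t * c - ‖w‖) ^ 2 / (4 * t) := by positivity
    have h2 : (2 * t * c - ‖w‖) ^ 2 / (4 * t) = c ^ 2 * t + ‖w‖ ^ 2 / (4 * t) - c * ‖w‖ := by
      field_simp; ring
    linarith
  have h3 : ‖w‖ ^ 2 / (2 * t) = ‖w‖ ^ 2 / (4 * t) + ‖w‖ ^ 2 / (4 * t) := by
    field_simp; ring
  have h4 : -(q / (4 * t)) * ‖w‖ ^ 2 = q * -(‖w‖ ^ 2 / (4 * t)) := by ring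
  rw [h4, mul_comm, ← mul_add]
  refine mul_le_mul_of_nonneg_left ?_ hq0.le
  linarith

theorem integrable_exp_mul_weighted (hp : 1 < p) (ht : 0 < t) (c : ℝ) {h : CSpace n → ℂ}
    (hh : MemLp (weighted t h) (ENNReal.ofReal p) volume) :
    Integrable (fun w => Real.exp (c * ‖w‖ - ‖w‖ ^ 2 / (2 * t)) * ‖weighted t h w‖) volume := by
  have hpq := Real.HolderConjugate.conjExponent hp
  have hq := hpq.symm.lt
  have : ENNReal.HolderConjugate (ENNReal.ofReal (Real.conjExponent p)) (ENNReal.ofReal p) :=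
    hpq.symm.ennrealOfReal
  exact (memLp_gaussian_exp ht c hq).integrable_mul hh.norm

theorem kernel_norm_le (ht : 0 < t) (h : CSpace n → ℂ) (z w : CSpace n) :
    ‖(gaussianDensity n t w : ℂ) * (Complex.exp (inner ℂ w z / t) * h w)‖ ≤
      (1 / (Real.pi * t) ^ n) *
        (Real.exp (‖z‖ / t * ‖w‖ - ‖w‖ ^ 2 / (2 * t)) * ‖weighted t h w‖) := by
  rw [norm_mul, norm_mul, Complex.norm_real, Real.norm_of_nonneg (gaussianDensity_pos ht w).le,
    weighted, norm_mul, Complex.norm_real, Real.norm_of_nonneg (Real.exp_pos _).le,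
    Complex.norm_exp, gaussianDensity, mul_assoc, Complex.div_ofReal_re]
  refine mul_le_mul_of_nonneg_left ?_ (by have := ht; positivity)
  rw [← mul_assoc, ← mul_assoc, ← Real.exp_add, ← Real.exp_add]
  refine mul_le_mul_of_nonneg_right (Real.exp_le_exp.2 ?_) (norm_nonneg _)
  have h1 : (inner ℂ w z).re ≤ ‖w‖ * ‖z‖ := re_inner_le_norm (𝕜 := ℂ) w z
  have h2 : (inner ℂ w z).re / t ≤ ‖z‖ / t * ‖w‖ := by
    rw [div_mul_eq_mul_div, mul_comm ‖z‖]; gcongr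
  have h3 : -‖w‖ ^ 2 / t = - (‖w‖ ^ 2 / (2 * t)) + -‖w‖ ^ 2 / (2 * t) := by field_simp; ring
  linarith

theorem differentiable_bergmanProjection (hp : 1 < p) (ht : 0 < t) {h : CSpace n → ℂ}
    (hc : Continuous h) (hh : MemLp (weighted t h) (ENNReal.ofReal p) volume) :
    Differentiable ℂ (bergmanProjection t h) := by
  intro z₀
  have hfun : bergmanProjection t h = fun z => ∫ w, (gaussianDensity n t w : ℂ) *
      (Complex.exp (inner ℂ w z / t) * h w) := funext (bergmanProjection_eq ht h)
  rw [hfun]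
  have hg := continuous_gaussianDensity n t
  let F' : CSpace n → CSpace n → (CSpace n →L[ℂ] ℂ) := fun z w =>
    ((gaussianDensity n t w : ℂ) * (Complex.exp (inner ℂ w z / t) * h w) / t) • innerSL ℂ w
  have hin : ∀ z : CSpace n, Continuous fun w : CSpace n => (inner ℂ w z : ℂ) := fun z => by
    fun_prop
  have hcF : ∀ z, Continuous fun w => (gaussianDensity n t w : ℂ) *
      (Complex.exp (inner ℂ w z / t) * h w) := fun z => by
    have := hin z
    fun_prop
  refine (hasFDerivAt_integral_of_dominated_of_fderiv_le (𝕜 := ℂ) (F' := F')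
    (bound := fun w => (1 / (Real.pi * t) ^ n) * (1 / t) *
      (Real.exp (((‖z₀‖ + 1) / t + 1) * ‖w‖ - ‖w‖ ^ 2 / (2 * t)) * ‖weighted t h w‖))
    (Metric.ball_mem_nhds z₀ one_pos) (Filter.Eventually.of_forall fun z =>
      (hcF z).aestronglyMeasurable) ?_ ?_ ?_ ?_ ?_).differentiableAt
  · refine ((integrable_exp_mul_weighted hp ht (‖z₀‖ / t) hh).const_mul
      (1 / (Real.pi * t) ^ n)).mono' (hcF z₀).aestronglyMeasurable
      (Filter.Eventually.of_forall fun w => kernel_norm_le ht h z₀ w)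
  · have hc2 : Continuous fun w : CSpace n => innerSL ℂ w := (innerSL ℂ).continuous
    exact (((hcF z₀).div_const _).smul hc2).aestronglyMeasurable
  · refine Filter.Eventually.of_forall fun w z hz => ?_
    have hz' : ‖z‖ ≤ ‖z₀‖ + 1 := by
      have h1 : ‖z - z₀‖ < 1 := by rwa [← dist_eq_norm]
      have h2 := norm_add_le (z - z₀) z₀
      rw [sub_add_cancel] at h2
      linarith
    simp only [F']
    rw [norm_smul, norm_div, Complex.norm_real, Real.norm_of_nonneg ht.le, innerSL_apply_norm]
    calc _ ≤ (1 / (Real.pi * t) ^ n) * (Real.exp ((‖z₀‖ + 1) / t * ‖w‖ - ‖w‖ ^ 2 / (2 * t)) *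
            ‖weighted t h w‖) / t * Real.exp ‖w‖ := by
          gcongr
          · refine (kernel_norm_le ht h z w).trans ?_
            gcongr
          · linarith [Real.add_one_le_exp ‖w‖]
      _ = _ := by
          have : Real.exp (((‖z₀‖ + 1) / t + 1) * ‖w‖ - ‖w‖ ^ 2 / (2 * t)) =
            Real.exp ((‖z₀‖ + 1) / t * ‖w‖ - ‖w‖ ^ 2 / (2 * t)) * Real.exp ‖w‖ := by
              rw [← Real.exp_add]; congr 1; ring
          rw [this]; ring
  · exact (integrable_exp_mul_weighted hp ht _ hh).const_mul _
  · refine Filter.Eventually.of_forall fun w z _ => ?_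
    have h1 : HasFDerivAt (fun z : CSpace n => (inner ℂ w z : ℂ)) (innerSL ℂ w) z :=
      (innerSL ℂ w).hasFDerivAt
    have h2 := (((h1.mul_const ((t : ℂ)⁻¹)).cexp).mul_const (h w)).const_mul
      (gaussianDensity n t w : ℂ)
    simp only [← div_eq_mul_inv] at h2
    refine h2.congr_fderiv ?_
    ext v
    simp [F']
    ring

/-- Young's inequality `‖G * k‖_p ≤ ‖G‖_1 ‖k‖_p` for non-negative functions. -/
theorem lintegral_young (hp : 1 < p) {G k : CSpace n → ℝ≥0∞} (hG : Measurable G)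
    (hk : Measurable k) :
    (∫⁻ z, (∫⁻ w, G (z - w) * k w) ^ p) ^ (1 / p) ≤ (∫⁻ v, G v) * (∫⁻ w, k w ^ p) ^ (1 / p) := by
  have hp0 : 0 < p := by linarith
  have hpq := Real.HolderConjugate.conjExponent hp
  set q := Real.conjExponent p
  have hq0 : 0 < q := by have := hpq.symm.lt; linarith
  set M := ∫⁻ v, G v
  have hGm : Measurable fun x : CSpace n × CSpace n => G (x.1 - x.2) := by fun_prop
  have hM : ∀ z, ∫⁻ w, G (z - w) = M := fun z => lintegral_sub_left_eq_self G z
  have hM' : ∀ w, ∫⁻ z, G (z - w) = M := fun w => lintegral_sub_right_eq_self G w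
  have key : ∀ z, (∫⁻ w, G (z - w) * k w) ^ p ≤
      M ^ (p / q) * ∫⁻ w, G (z - w) * k w ^ p := by
    intro z
    have h := ENNReal.lintegral_mul_le_Lp_mul_Lq volume hpq
      (f := fun w => G (z - w) ^ (1 / p) * k w) (g := fun w => G (z - w) ^ (1 / q))
      (by fun_prop) (by fun_prop)
    have e1 : ∀ w, ((fun w => G (z - w) ^ (1 / p) * k w) * fun w => G (z - w) ^ (1 / q)) w =
        G (z - w) * k w := by
      intro w
      simp only [Pi.mul_apply]
      rw [mul_right_comm, ← ENNReal.rpow_add_of_nonneg _ _ (by positivity) (by positivity)]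
      rw [one_div, one_div, hpq.inv_add_inv_eq_one, ENNReal.rpow_one]
    have e2 : ∀ w, (G (z - w) ^ (1 / p) * k w) ^ p = G (z - w) * k w ^ p := by
      intro w
      rw [ENNReal.mul_rpow_of_nonneg _ _ hp0.le, ← ENNReal.rpow_mul, one_div_mul_cancel hp0.ne',
        ENNReal.rpow_one]
    have e3 : ∀ w, (G (z - w) ^ (1 / q)) ^ q = G (z - w) := by
      intro w
      rw [← ENNReal.rpow_mul, one_div_mul_cancel hq0.ne', ENNReal.rpow_one]
    simp only [e1, e2, e3, hM z] at h
    calc _ ≤ ((∫⁻ w, G (z - w) * k w ^ p) ^ (1 / p) * M ^ (1 / q)) ^ p := by gcongr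
      _ = _ := by
        rw [ENNReal.mul_rpow_of_nonneg _ _ hp0.le, ← ENNReal.rpow_mul, ← ENNReal.rpow_mul,
          one_div_mul_cancel hp0.ne', ENNReal.rpow_one, mul_comm, one_div_mul_eq_div]
  have hsum : p / q + 1 = p := by
    have := hpq.inv_add_inv_eq_one
    field_simp at this ⊢
    linarith
  calc _ ≤ (∫⁻ z, M ^ (p / q) * ∫⁻ w, G (z - w) * k w ^ p) ^ (1 / p) := by
        gcongr with z; exact key z
    _ = (M ^ p * ∫⁻ w, k w ^ p) ^ (1 / p) := by
        congr 1
        rw [lintegral_const_mul _ (Measurable.lintegral_prod_right' (f := fun x : CSpace n × CSpace n =>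
          G (x.1 - x.2) * k x.2 ^ p) (by fun_prop)),
          lintegral_lintegral_swap (by fun_prop)]
        have : ∀ w, ∫⁻ z, G (z - w) * k w ^ p = M * k w ^ p := by
          intro w
          rw [lintegral_mul_const _ (by fun_prop), hM' w]
        simp only [this]
        rw [lintegral_const_mul _ (by fun_prop), ← mul_assoc]
        congr 1
        conv_rhs => rw [← hsum, ENNReal.rpow_add_of_nonneg _ _ (by positivity) zero_le_one,
          ENNReal.rpow_one]
    _ = _ := by
        rw [ENNReal.mul_rpow_of_nonneg _ _ (by positivity), ← ENNReal.rpow_mul,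
          mul_one_div_cancel hp0.ne', ENNReal.rpow_one]

theorem enorm_weighted_bergman_le (ht : 0 < t) (h : CSpace n → ℂ) (z : CSpace n) :
    ‖weighted t (bergmanProjection t h) z‖ₑ ≤ ENNReal.ofReal (1 / (Real.pi * t) ^ n) *
      ∫⁻ w, ENNReal.ofReal (Real.exp (-‖z - w‖ ^ 2 / (2 * t))) * ‖weighted t h w‖ₑ := by
  rw [weighted, bergmanProjection_eq ht, ← integral_const_mul,
    ← lintegral_const_mul' _ _ ENNReal.ofReal_ne_top]
  refine (enorm_integral_le_lintegral_enorm _).trans_eq (lintegral_congr fun w => ?_)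
  have h1 := norm_kernel_mul ht w z
  rw [normalizedKernel, Complex.norm_exp] at h1
  rw [← ofReal_norm (_ * _), ← ofReal_norm (weighted t h w), ← ENNReal.ofReal_mul (by positivity),
    ← ENNReal.ofReal_mul (by positivity), ← h1]
  congr 1
  rw [norm_mul, norm_mul, norm_mul, Complex.norm_real, Complex.norm_real,
    Real.norm_of_nonneg (gaussianDensity_pos ht w).le, Real.norm_of_nonneg (Real.exp_pos _).le,
    weighted, norm_mul, Complex.norm_real, Real.norm_of_nonneg (Real.exp_pos _).le,
    Complex.norm_exp, gaussianDensity, Complex.sub_re]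
  have h2 : ((‖w‖ : ℂ) ^ 2 / (2 * t)).re = ‖w‖ ^ 2 / (2 * t) := by norm_cast
  have h3 : Real.exp (-‖w‖ ^ 2 / t) =
      Real.exp (-(‖w‖ ^ 2 / (2 * t))) * Real.exp (-‖w‖ ^ 2 / (2 * t)) := by
    rw [← Real.exp_add]; congr 1; field_simp; ring
  rw [h2, sub_eq_add_neg, Real.exp_add, h3]
  ring

theorem exists_bergman_bound (n : ℕ) (hp : 1 < p) (ht : 0 < t) :
    ∃ C : ℝ, 0 ≤ C ∧ ∀ h : CSpace n → ℂ, Continuous h →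
      eLpNorm (weighted t (bergmanProjection t h)) (ENNReal.ofReal p) volume ≤
        ENNReal.ofReal C * eLpNorm (weighted t h) (ENNReal.ofReal p) volume := by
  have hp0 : 0 < p := by linarith
  have hne0 : ENNReal.ofReal p ≠ 0 := by simpa using hp0
  have hM : ∫⁻ v : CSpace n, ENNReal.ofReal (Real.exp (-‖v‖ ^ 2 / (2 * t))) ≠ ∞ := by
    have h1 := (memLp_gaussian_exp (n := n) (t := 2 * t) (by positivity) 0
      (q := 2) (by norm_num)).integrable_norm_rpow (by simp) ENNReal.ofReal_ne_top
    have h2 : Integrable (fun v : CSpace n => Real.exp (-‖v‖ ^ 2 / (2 * t))) volume := by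
      refine h1.congr (Filter.Eventually.of_forall fun v => ?_)
      simp only
      rw [Real.norm_of_nonneg (Real.exp_pos _).le, ← Real.exp_mul,
        ENNReal.toReal_ofReal (by norm_num)]
      congr 1
      field_simp
      ring
    have h3 := h2.lintegral_lt_top
    exact h3.ne
  refine ⟨1 / (Real.pi * t) ^ n *
    (∫⁻ v : CSpace n, ENNReal.ofReal (Real.exp (-‖v‖ ^ 2 / (2 * t)))).toReal,
    by positivity, fun h hc => ?_⟩
  rw [eLpNorm_eq_lintegral_rpow_enorm_toReal hne0 ENNReal.ofReal_ne_top,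
    eLpNorm_eq_lintegral_rpow_enorm_toReal hne0 ENNReal.ofReal_ne_top,
    ENNReal.toReal_ofReal hp0.le, ENNReal.ofReal_mul (by positivity), ENNReal.ofReal_toReal hM]
  have hkm : Measurable fun w => ‖weighted t h w‖ₑ :=
    ((continuous_wt t).mul hc).measurable.enorm
  have hY := lintegral_young (p := p) hp
    (G := fun v : CSpace n => ENNReal.ofReal (Real.exp (-‖v‖ ^ 2 / (2 * t))))
    (k := fun w => ‖weighted t h w‖ₑ) (by fun_prop) hkm
  calc _ ≤ (∫⁻ z : CSpace n, (ENNReal.ofReal (1 / (Real.pi * t) ^ n) *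
      ∫⁻ w, ENNReal.ofReal (Real.exp (-‖z - w‖ ^ 2 / (2 * t))) * ‖weighted t h w‖ₑ) ^ p) ^
        (1 / p) := by
        gcongr with z
        exact enorm_weighted_bergman_le ht h z
    _ = ENNReal.ofReal (1 / (Real.pi * t) ^ n) * (∫⁻ z : CSpace n,
      (∫⁻ w, ENNReal.ofReal (Real.exp (-‖z - w‖ ^ 2 / (2 * t))) * ‖weighted t h w‖ₑ) ^ p) ^
        (1 / p) := by
        simp only [ENNReal.mul_rpow_of_nonneg _ _ hp0.le]
        rw [lintegral_const_mul' _ _ (by finiteness),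
          ENNReal.mul_rpow_of_nonneg _ _ (by positivity), ← ENNReal.rpow_mul,
          mul_one_div_cancel hp0.ne', ENNReal.rpow_one]
    _ ≤ _ := by
        rw [mul_assoc]
        gcongr


/-- Entire functions in `L^p(ℂⁿ, μ_{2t/p})`, as a space of functions. -/
def fockSubmodule (n : ℕ) (p t : ℝ) : Submodule ℂ (CSpace n → ℂ) where
  carrier := {f | Differentiable ℂ f ∧
    MemLp f (ENNReal.ofReal p) (gaussianMeasure n (2 * t / p))}
  add_mem' hf hg := ⟨hf.1.add hg.1, hf.2.add hg.2⟩
  zero_mem' := ⟨differentiable_const 0, MemLp.zero⟩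
  smul_mem' c _ hf := ⟨hf.1.const_smul c, hf.2.const_smul c⟩

/-- The `p`-Fock space `F_t^p`. It is a separate type so that it does not inherit the topology of
pointwise convergence; its norm is the `L^p(μ_{2t/p})`-norm. -/
def FockSpace (n : ℕ) (p t : ℝ) : Type := fockSubmodule n p t

namespace FockSpace

instance : AddCommGroup (FockSpace n p t) := inferInstanceAs (AddCommGroup (fockSubmodule n p t))
instance : Module ℂ (FockSpace n p t) := inferInstanceAs (Module ℂ (fockSubmodule n p t))

instance : CoeFun (FockSpace n p t) (fun _ => CSpace n → ℂ) := ⟨fun f => f.1⟩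

@[ext] theorem ext {f g : FockSpace n p t} (h : ∀ z, f z = g z) : f = g :=
  Subtype.ext (funext h)

theorem differentiable (f : FockSpace n p t) : Differentiable ℂ f := f.2.1

theorem memLp (f : FockSpace n p t) :
    MemLp f (ENNReal.ofReal p) (gaussianMeasure n (2 * t / p)) := f.2.2

theorem add_apply (f g : FockSpace n p t) (z : CSpace n) : (f + g) z = f z + g z := rfl

theorem smul_apply (c : ℂ) (f : FockSpace n p t) (z : CSpace n) : (c • f) z = c * f z := rfl

instance instFactOneLe [hp : Fact (1 < p)] : Fact (1 ≤ ENNReal.ofReal p) :=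
  ⟨by simpa using hp.out.le⟩

/-- The inclusion into the Lebesgue space `L^p(ℂⁿ, μ_{2t/p})`. -/
def toLp (n : ℕ) (p t : ℝ) :
    FockSpace n p t →ₗ[ℂ] Lp ℂ (ENNReal.ofReal p) (gaussianMeasure n (2 * t / p)) where
  toFun f := f.memLp.toLp f
  map_add' f g := MemLp.toLp_add f.memLp g.memLp
  map_smul' c f := MemLp.toLp_const_smul c f.memLp

theorem toLp_injective [hp : Fact (1 < p)] [ht : Fact (0 < t)] :
    Function.Injective (toLp n p t) := by
  intro f g h
  have hs : 0 < 2 * t / p := by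
    have := hp.out; have := ht.out; have : 0 < p := by linarith
    positivity
  have h1 : (f : CSpace n → ℂ) =ᵐ[gaussianMeasure n (2 * t / p)] g :=
    (MemLp.toLp_eq_toLp_iff f.memLp g.memLp).1 h
  have h2 : (f : CSpace n → ℂ) =ᵐ[volume] g := (volume_ac hs).ae_eq h1
  have h3 := (Continuous.ae_eq_iff_eq volume f.differentiable.continuous
    g.differentiable.continuous).1 h2
  exact ext fun z => congrFun h3 z

instance [Fact (1 < p)] [Fact (0 < t)] : NormedAddCommGroup (FockSpace n p t) :=
  NormedAddCommGroup.induced _ _ (toLp n p t) toLp_injective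

instance [Fact (1 < p)] [Fact (0 < t)] : NormedSpace ℂ (FockSpace n p t) :=
  NormedSpace.induced ℂ _ _ (toLp n p t)

variable [hp : Fact (1 < p)] [ht : Fact (0 < t)]

theorem norm_def (f : FockSpace n p t) :
    ‖f‖ = (eLpNorm f (ENNReal.ofReal p) (gaussianMeasure n (2 * t / p))).toReal :=
  Lp.norm_toLp f f.memLp

theorem memLp_weighted (f : FockSpace n p t) :
    MemLp (weighted t f) (ENNReal.ofReal p) volume :=
  (memLp_gaussian_iff hp.out ht.out f).1 f.memLp

theorem norm_le_of_weighted {f g : FockSpace n p t} {C : ℝ} (hC : 0 ≤ C)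
    (h : eLpNorm (weighted t g) (ENNReal.ofReal p) volume ≤
      ENNReal.ofReal C * eLpNorm (weighted t f) (ENNReal.ofReal p) volume) :
    ‖g‖ ≤ C * ‖f‖ := by
  obtain ⟨c, hc0, hct, hc⟩ := eLpNorm_gaussian (n := n) hp.out ht.out
  rw [norm_def, norm_def, hc, hc, ← ENNReal.toReal_ofReal hC, ← ENNReal.toReal_mul]
  refine ENNReal.toReal_mono ?_ ?_
  · exact ENNReal.mul_ne_top ENNReal.ofReal_ne_top
      (ENNReal.mul_ne_top hct f.memLp_weighted.eLpNorm_ne_top)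
  · calc _ ≤ c * (ENNReal.ofReal C * eLpNorm (weighted t f) (ENNReal.ofReal p) volume) := by gcongr
      _ = _ := by ring

end FockSpace

variable [hp : Fact (1 < p)] [ht : Fact (0 < t)]

/-! ### Weyl operators and the parity operator -/

theorem eLpNorm_weighted_weyl (z : CSpace n) (f : FockSpace n p t) :
    eLpNorm (weighted t (fun w => normalizedKernel t z w * f (w - z))) (ENNReal.ofReal p) volume =
      eLpNorm (weighted t f) (ENNReal.ofReal p) volume := by
  rw [eLpNorm_congr_norm_ae (g := weighted t f ∘ fun w => w - z)
    (Filter.Eventually.of_forall (norm_weighted_weyl ht.out z f)),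
    eLpNorm_comp_measurePreserving f.memLp_weighted.1 (measurePreserving_sub_right volume z)]

theorem weyl_mem (z : CSpace n) (f : FockSpace n p t) :
    (fun w => normalizedKernel t z w * f (w - z)) ∈ fockSubmodule n p t := by
  have hd : Differentiable ℂ fun w => normalizedKernel t z w * f (w - z) :=
    (differentiable_kernel t z).mul (f.differentiable.comp (differentiable_id.sub_const z))
  refine ⟨hd, (memLp_gaussian_iff hp.out ht.out _).2 ⟨?_, ?_⟩⟩
  · exact ((continuous_wt t).mul hd.continuous).aestronglyMeasurable
  · rw [eLpNorm_weighted_weyl]; exact f.memLp_weighted.2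

/-- The Weyl operator `(W_z f)(w) = k_z(w) f(w - z)` on `F_t^p`. -/
def weyl (z : CSpace n) : FockSpace n p t →L[ℂ] FockSpace n p t :=
  LinearMap.mkContinuous
    { toFun := fun f => ⟨fun w => normalizedKernel t z w * f (w - z), weyl_mem z f⟩
      map_add' := fun f g => FockSpace.ext fun w => mul_add _ (f (w - z)) (g (w - z))
      map_smul' := fun c f => FockSpace.ext fun w => mul_left_comm _ c (f (w - z)) }
    1 (fun f => FockSpace.norm_le_of_weighted zero_le_one
        (by rw [ENNReal.ofReal_one, one_mul]; exact (eLpNorm_weighted_weyl z f).le))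

theorem weyl_apply (z : CSpace n) (f : FockSpace n p t) (w : CSpace n) :
    weyl z f w = normalizedKernel t z w * f (w - z) := rfl

theorem eLpNorm_weighted_parity (f : FockSpace n p t) :
    eLpNorm (weighted t (fun w => f (-w))) (ENNReal.ofReal p) volume =
      eLpNorm (weighted t f) (ENNReal.ofReal p) volume := by
  rw [← eLpNorm_comp_measurePreserving f.memLp_weighted.1
    (Measure.measurePreserving_neg (volume : Measure (CSpace n)))]
  congr 1
  funext w
  simp [weighted]

theorem parity_mem (f : FockSpace n p t) : (fun w => f (-w)) ∈ fockSubmodule n p t := by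
  have hd : Differentiable ℂ fun w => f (-w) := f.differentiable.comp differentiable_id.neg
  refine ⟨hd, (memLp_gaussian_iff hp.out ht.out _).2 ⟨?_, ?_⟩⟩
  · exact ((continuous_wt t).mul hd.continuous).aestronglyMeasurable
  · rw [eLpNorm_weighted_parity]; exact f.memLp_weighted.2

/-- The parity operator `(U f)(w) = f(-w)` on `F_t^p`. -/
def parity : FockSpace n p t →L[ℂ] FockSpace n p t :=
  LinearMap.mkContinuous
    { toFun := fun f => ⟨fun w => f (-w), parity_mem f⟩
      map_add' := fun _ _ => rfl
      map_smul' := fun _ _ => rfl }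
    1 (fun f => FockSpace.norm_le_of_weighted zero_le_one
        (by rw [ENNReal.ofReal_one, one_mul]; exact (eLpNorm_weighted_parity f).le))

theorem parity_apply (f : FockSpace n p t) (w : CSpace n) : parity f w = f (-w) := rfl

/-! ### Toeplitz operators -/

theorem memLp_weighted_mul (f : CSpace n →ᵇ ℂ) (g : FockSpace n p t) :
    MemLp (weighted t fun w => f w * g w) (ENNReal.ofReal p) volume ∧
      eLpNorm (weighted t fun w => f w * g w) (ENNReal.ofReal p) volume ≤
        ENNReal.ofReal ‖f‖ * eLpNorm (weighted t g) (ENNReal.ofReal p) volume := by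
  have hb : ∀ w, ‖weighted t (fun w => f w * g w) w‖ ≤ ‖f‖ * ‖weighted t g w‖ := by
    intro w
    simp only [weighted, norm_mul]
    rw [mul_left_comm]
    gcongr
    exact f.norm_coe_le_norm w
  have hle := eLpNorm_le_mul_eLpNorm_of_ae_le_mul (μ := (volume : Measure (CSpace n)))
    (Filter.Eventually.of_forall hb) (ENNReal.ofReal p)
  refine ⟨⟨?_, hle.trans_lt (ENNReal.mul_lt_top ENNReal.ofReal_lt_top g.memLp_weighted.2)⟩, hle⟩
  exact ((continuous_wt t).mul (f.continuous.mul g.differentiable.continuous)).aestronglyMeasurable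

theorem toeplitz_mem (f : CSpace n →ᵇ ℂ) (g : FockSpace n p t) :
    bergmanProjection t (fun w => f w * g w) ∈ fockSubmodule n p t := by
  have hc : Continuous fun w => f w * g w := f.continuous.mul g.differentiable.continuous
  have hm := (memLp_weighted_mul f g).1
  have hd := differentiable_bergmanProjection hp.out ht.out hc hm
  obtain ⟨C, _, hC⟩ := exists_bergman_bound n hp.out ht.out
  refine ⟨hd, (memLp_gaussian_iff hp.out ht.out _).2 ⟨?_, ?_⟩⟩
  · exact ((continuous_wt t).mul hd.continuous).aestronglyMeasurable
  · exact (hC _ hc).trans_lt (ENNReal.mul_lt_top ENNReal.ofReal_lt_top hm.2)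

theorem integrable_toeplitz (f : CSpace n →ᵇ ℂ) (g : FockSpace n p t) (z : CSpace n) :
    Integrable (fun w => (gaussianDensity n t w : ℂ) *
      (Complex.exp (inner ℂ w z / t) * (f w * g w))) volume := by
  have hc : Continuous fun w => f w * g w := f.continuous.mul g.differentiable.continuous
  have hg := continuous_gaussianDensity n t
  have hin : Continuous fun w : CSpace n => (inner ℂ w z : ℂ) := by fun_prop
  have hi := (integrable_exp_mul_weighted hp.out ht.out (‖z‖ / t)
    (memLp_weighted_mul f g).1).const_mul (1 / (Real.pi * t) ^ n)
  have hm : Continuous fun w => (gaussianDensity n t w : ℂ) *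
      (Complex.exp (inner ℂ w z / t) * (f w * g w)) :=
    (Complex.continuous_ofReal.comp hg).mul
      ((Complex.continuous_exp.comp (hin.div_const _)).mul hc)
  have hb := fun w => kernel_norm_le ht.out (fun w => f w * g w) z w
  exact hi.mono' hm.aestronglyMeasurable (Filter.Eventually.of_forall hb)

/-- The Toeplitz operator `T_f^t g = P_t(f g)` on `F_t^p`, for a bounded continuous symbol. -/
def toeplitz (p t : ℝ) [Fact (1 < p)] [Fact (0 < t)] (f : CSpace n →ᵇ ℂ) :
    FockSpace n p t →L[ℂ] FockSpace n p t :=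
  LinearMap.mkContinuousOfExistsBound
    { toFun := fun g => ⟨bergmanProjection t (fun w => f w * g w), toeplitz_mem f g⟩
      map_add' := fun g₁ g₂ => FockSpace.ext fun z => by
        have ht : 0 < t := Fact.out
        change bergmanProjection t (fun w => f w * (g₁ + g₂) w) z =
          bergmanProjection t (fun w => f w * g₁ w) z + bergmanProjection t (fun w => f w * g₂ w) z
        rw [bergmanProjection_eq ht, bergmanProjection_eq ht, bergmanProjection_eq ht,
          ← integral_add (integrable_toeplitz f g₁ z) (integrable_toeplitz f g₂ z)]
        simp only [FockSpace.add_apply, mul_add]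
      map_smul' := fun c g => FockSpace.ext fun z => by
        have ht : 0 < t := Fact.out
        change bergmanProjection t (fun w => f w * (c • g) w) z =
          c * bergmanProjection t (fun w => f w * g w) z
        rw [bergmanProjection_eq ht, bergmanProjection_eq ht, ← integral_const_mul]
        refine integral_congr_ae (Filter.Eventually.of_forall fun w => ?_)
        simp only [FockSpace.smul_apply]
        ring }
    (by
      obtain ⟨C, hC0, hC⟩ := exists_bergman_bound (p := p) (t := t) n Fact.out Fact.out
      refine ⟨C * ‖f‖, fun g => FockSpace.norm_le_of_weighted (by positivity) ?_⟩
      refine (hC _ (f.continuous.mul g.differentiable.continuous)).trans ?_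
      rw [ENNReal.ofReal_mul hC0, mul_assoc]
      gcongr
      exact (memLp_weighted_mul f g).2)

theorem toeplitz_apply (f : CSpace n →ᵇ ℂ) (g : FockSpace n p t) (z : CSpace n) :
    toeplitz p t f g z =
      ∫ w, Complex.exp (inner ℂ w z / t) * (f w * g w) ∂gaussianMeasure n t := rfl

/-- The action of `ℂⁿ` on operators, `α_z(A) = W_z A W_{-z}`. -/
def alpha (z : CSpace n) (A : FockSpace n p t →L[ℂ] FockSpace n p t) :
    FockSpace n p t →L[ℂ] FockSpace n p t :=
  weyl z ∘L A ∘L weyl (-z)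

/-- Conjugation with parity, `A ↦ U A U`. -/
def parityConj (A : FockSpace n p t →L[ℂ] FockSpace n p t) :
    FockSpace n p t →L[ℂ] FockSpace n p t :=
  parity ∘L A ∘L parity

/-- The action of `ℂⁿ` on functions, `α_z(f)(w) = f(w - z)`. -/
def translate (z : CSpace n) (f : CSpace n →ᵇ ℂ) : CSpace n →ᵇ ℂ :=
  f.compContinuous ⟨fun w => w - z, by fun_prop⟩

/-! ### Nuclear operators and the nuclear trace -/

/-- `A = ∑ y_j ⊗ x_j` with `∑ ‖y_j‖ ‖x_j‖ < ∞`. -/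
def IsNuclearRep {X : Type*} [NormedAddCommGroup X] [NormedSpace ℂ X] (A : X →L[ℂ] X)
    (r : (ℕ → StrongDual ℂ X) × (ℕ → X)) : Prop :=
  Summable (fun j => ‖r.1 j‖ * ‖r.2 j‖) ∧
    HasSum (fun j => (r.1 j).smulRight (r.2 j)) A

def IsNuclear {X : Type*} [NormedAddCommGroup X] [NormedSpace ℂ X] (A : X →L[ℂ] X) : Prop :=
  ∃ r, IsNuclearRep A r

open Classical in
/-- The nuclear trace `Tr A = ∑ y_j(x_j)`, computed from some nuclear representation of `A` (on
spaces with the approximation property, such as `F_t^p`, all of them give the same value). -/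
def nuclearTrace {X : Type*} [NormedAddCommGroup X] [NormedSpace ℂ X] (A : X →L[ℂ] X) : ℂ :=
  if h : IsNuclear A then ∑' j, h.choose.1 j (h.choose.2 j) else 0

/-! ### Convolutions -/

/-- The convolution of a nuclear operator `A` and a bounded operator `B`: the function
`(A ∗ B)(z) = Tr(A α_z(U B U))`. -/
def opConv (A B : FockSpace n p t →L[ℂ] FockSpace n p t) (z : CSpace n) : ℂ :=
  nuclearTrace (A ∘L alpha z (parityConj B))

/-- The nuclear operator `A` can be convolved with bounded functions: all the functions
`B ∗ (U A U)`, `B` nuclear, which appear in the duality relation that defines `f ∗ A`, belong to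
`L¹(ℂⁿ)`. For `p = 2` every nuclear operator has this property; for `p ≠ 2` some do not. -/
def IsConvolvable (A : FockSpace n p t →L[ℂ] FockSpace n p t) : Prop :=
  ∀ B : FockSpace n p t →L[ℂ] FockSpace n p t, IsNuclear B →
    Integrable (opConv B (parityConj A)) volume

/-- `C = f ∗ A`, by the duality relation `⟨f ∗ A, B⟩_tr = ⟨f, B ∗ (U A U)⟩_tr` for all nuclear `B`,
where `⟨C, B⟩_tr = Tr(C B)` and `⟨f, g⟩_tr = ∫ f g dV`. -/
def IsFunConv (f : CSpace n →ᵇ ℂ) (A C : FockSpace n p t →L[ℂ] FockSpace n p t) : Prop :=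
  ∀ B : FockSpace n p t →L[ℂ] FockSpace n p t, IsNuclear B →
    nuclearTrace (C ∘L B) = ∫ z, f z * opConv B (parityConj A) z

/-! ### Corresponding spaces -/

/-- `BUC(ℂⁿ)`, with the supremum norm. -/
def BUC (n : ℕ) : Submodule ℂ (CSpace n →ᵇ ℂ) where
  carrier := {f | UniformContinuous f}
  add_mem' hf hg := UniformContinuous.add hf hg
  zero_mem' := uniformContinuous_const
  smul_mem' c _ hf := UniformContinuous.const_smul hf c

/-- `𝒞₁`: the operators `A` for which `z ↦ α_z(A)` is continuous in operator norm. -/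
def C1 (n : ℕ) (p t : ℝ) [Fact (1 < p)] [Fact (0 < t)] :
    Set (FockSpace n p t →L[ℂ] FockSpace n p t) :=
  {A | Continuous fun z => alpha z A}

/-- `D₀ ⊕ D₁` is a pair: `N(F_t^p) ∗ D₁ ⊆ D₀` and `N(F_t^p) ∗ D₀ ⊆ D₁`, where the second inclusion
concerns those nuclear operators that can be convolved with bounded functions. -/
def IsPair (D₀ : Submodule ℂ (CSpace n →ᵇ ℂ))
    (D₁ : Submodule ℂ (FockSpace n p t →L[ℂ] FockSpace n p t)) : Prop :=
  (∀ A, IsNuclear A → ∀ B ∈ D₁, ∃ g ∈ D₀, ∀ z, g z = opConv A B z) ∧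
    ∀ A, IsNuclear A → IsConvolvable A → ∀ f ∈ D₀, ∃ C ∈ D₁, IsFunConv f A C

def IsClosedInvariantSymbolSpace (D₀ : Submodule ℂ (CSpace n →ᵇ ℂ)) : Prop :=
  D₀ ≤ BUC n ∧ IsClosed (D₀ : Set (CSpace n →ᵇ ℂ)) ∧ ∀ z, ∀ f ∈ D₀, translate z f ∈ D₀

def IsClosedInvariantOperatorSpace
    (D₁ : Submodule ℂ (FockSpace n p t →L[ℂ] FockSpace n p t)) : Prop :=
  (D₁ : Set (FockSpace n p t →L[ℂ] FockSpace n p t)) ⊆ C1 n p t ∧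
    IsClosed (D₁ : Set (FockSpace n p t →L[ℂ] FockSpace n p t)) ∧
    ∀ z, ∀ A ∈ D₁, alpha z A ∈ D₁

/-- `D₀ ↔ D₁`: both are closed and `α`-invariant, they form a pair, and each of them is the only
closed `α`-invariant subspace (of `𝒞₁`, respectively of `BUC(ℂⁿ)`) that forms a pair with the
other. -/
structure UniquelyCorrespond (D₀ : Submodule ℂ (CSpace n →ᵇ ℂ))
    (D₁ : Submodule ℂ (FockSpace n p t →L[ℂ] FockSpace n p t)) : Prop where
  symbolSpace : IsClosedInvariantSymbolSpace D₀
  operatorSpace : IsClosedInvariantOperatorSpace D₁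
  isPair : IsPair D₀ D₁
  unique_operatorSpace : ∀ E₁ : Submodule ℂ (FockSpace n p t →L[ℂ] FockSpace n p t),
    IsClosedInvariantOperatorSpace E₁ → IsPair D₀ E₁ → E₁ = D₁
  unique_symbolSpace : ∀ E₀ : Submodule ℂ (CSpace n →ᵇ ℂ),
    IsClosedInvariantSymbolSpace E₀ → IsPair E₀ D₁ → E₀ = D₀

/-- `𝒯_lin^{p,t}(S)`: the norm closed linear span of the Toeplitz operators with symbols in `S`. -/
def toeplitzLin (p t : ℝ) [Fact (1 < p)] [Fact (0 < t)] (S : Set (CSpace n →ᵇ ℂ)) :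
    Submodule ℂ (FockSpace n p t →L[ℂ] FockSpace n p t) :=
  (Submodule.span ℂ (toeplitz p t '' S)).topologicalClosure

end

end Fock

namespace Fock

open Filter Topology

noncomputable section

set_option linter.unusedSectionVars false

/-! ### Gaussian integrals, growth estimates and the reproducing formula -/

section

variable {n : ℕ} {p t : ℝ}

/-! ### Gaussian integrals -/

/-! Everything turns on the rank one operator 1 ⊗ δ₀ (`vacuum`) and the Gaussian density γ of μ_t.
Convolving a symbol f with `vacuum` gives (πt)ⁿ T_f, and convolving `vacuum` with an operator C
gives its Berezin transform C~. Since `vacuum` is nuclear and convolvable, every pair (D₀, D₁)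
satisfies T_f ∈ D₁ for f ∈ D₀ (`IsPair.toeplitz_mem`) and C~ ∈ D₀ for C ∈ D₁
(`IsPair.berezinBCF_mem`).

The two round trips are Gaussian averages: (T_f)~ = γ ∗ f (`berezin_toeplitz`) and T_{C~} = γ ∗ C
(`toeplitz_berezin_apply`). They can be undone by a Tauberian argument: if v is a bounded continuous
function with values in a Banach space and all values of its Gaussian average lie in a closed
subspace, then so do all values of v (`mem_of_gaussian_average_mem`). By Hahn–Banach this is a
scalar statement, the injectivity of convolution with γ (`eq_zero_of_gaussian_average`). It applies
to z ↦ α_z f for f in BUC and to z ↦ α_z C for C in 𝒞₁, which is why these are the ambient spaces.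
Both uniqueness claims follow.

That D₀ and the Toeplitz space form a pair has two halves. For nuclear A, A ∗ T_f is a constant
times A~ ∗ f with A~ integrable, and a closed invariant space is stable under such convolutions. For
convolvable A, the identity (γ ∗ h) ∗ A = T_{A~ ∗ h} (`dual_toeplitz_convSymbol`) settles symbols of
the form γ ∗ h; the Tauberian step passes to all f ∈ D₀, because the symbols f with f ∗ A in the
Toeplitz space form a closed subspace (`isClosed_weakConvSpace`, via closed graph and uniform
boundedness).

The analysis underneath is the weak resolution of the identity by coherent states, y(x) = (πt)⁻ⁿ ∫
y(k_w) e^{-|w|²/(2t)} x(w) dw (`dual_eq_integral`). Its absolute convergence is deduced from the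
boundedness of Toeplitz operators, so the dual of F_t^p need not be identified. Summed over a
nuclear representation it gives Tr A = (πt)⁻ⁿ ∫ A~, which makes the trace independent of the
representation. -/

theorem integrable_exp_neg_mul_sq_norm (n : ℕ) {b : ℝ} (hb : 0 < b) :
    Integrable (fun w : CSpace n => Real.exp (-b * ‖w‖ ^ 2)) := by
  have := (GaussianFourier.integrable_cexp_neg_mul_sq_norm_add (V := CSpace n)
    (b := (b : ℂ)) (by rw [Complex.ofReal_re]; exact hb) 0 0).norm
  refine this.congr (Eventually.of_forall fun w => ?_)
  simp only [Complex.norm_exp]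
  congr 1
  rw [zero_mul, add_zero, ← Complex.ofReal_neg, ← Complex.ofReal_pow, ← Complex.ofReal_mul,
    Complex.ofReal_re]

theorem gaussianDensity_eq (n : ℕ) (s : ℝ) (z : CSpace n) :
    gaussianDensity n s z = (1 / (Real.pi * s) ^ n) * Real.exp (-(1 / s) * ‖z‖ ^ 2) := by
  rw [gaussianDensity]; congr 2; ring

theorem integrable_gaussianDensity (n : ℕ) {s : ℝ} (hs : 0 < s) :
    Integrable (gaussianDensity n s) := by
  have := (integrable_exp_neg_mul_sq_norm n (b := 1 / s) (by positivity)).const_mul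
    (1 / (Real.pi * s) ^ n)
  exact this.congr (Eventually.of_forall fun w => (gaussianDensity_eq n s w).symm)

theorem integral_gaussianDensity (n : ℕ) {s : ℝ} (hs : 0 < s) :
    ∫ z, gaussianDensity n s z = 1 := by
  simp only [gaussianDensity_eq, integral_const_mul]
  rw [GaussianFourier.integral_rexp_neg_mul_sq_norm (by positivity)]
  have : (Module.finrank ℝ (CSpace n) : ℝ) / 2 = n := by
    rw [finrank_real_of_complex, finrank_euclideanSpace_fin]
    push_cast; ring
  rw [this, Real.rpow_natCast]
  have : (Real.pi * s) ^ n ≠ 0 := by positivity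
  field_simp

theorem gaussianDensity_neg (s : ℝ) (z : CSpace n) :
    gaussianDensity n s (-z) = gaussianDensity n s z := by
  simp [gaussianDensity]

/-! ### Growth estimates in the Fock space -/

theorem continuous_weighted {f : CSpace n → ℂ} (hf : Continuous f) :
    Continuous (weighted t f) :=
  (continuous_wt t).mul hf

section Growth

variable [hp : Fact (1 < p)] [ht : Fact (0 < t)]

theorem memLp_weighted_exp (c : ℝ) :
    MemLp (weighted t fun w : CSpace n => ((Real.exp (c * ‖w‖) : ℝ) : ℂ)) (ENNReal.ofReal p)
      volume := by
  refine MemLp.congr_norm (memLp_gaussian_exp (n := n) ht.out c hp.out) ?_ ?_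
  · exact (continuous_weighted (by fun_prop)).aestronglyMeasurable
  · refine Eventually.of_forall fun w => ?_
    simp only [weighted, ← Complex.ofReal_mul, ← Real.exp_add, Complex.norm_real]
    congr 2
    ring

theorem memLp_exp (c : ℝ) :
    MemLp (fun w : CSpace n => ((Real.exp (c * ‖w‖) : ℝ) : ℂ)) (ENNReal.ofReal p)
      (gaussianMeasure n (2 * t / p)) :=
  (memLp_gaussian_iff hp.out ht.out _).2 (memLp_weighted_exp c)

/-- The norm of `exp (c |w|)` in `L^p(μ_{2t/p})`. -/
def expNorm (n : ℕ) (p t c : ℝ) : ℝ :=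
  (eLpNorm (fun w : CSpace n => ((Real.exp (c * ‖w‖) : ℝ) : ℂ)) (ENNReal.ofReal p)
      (gaussianMeasure n (2 * t / p))).toReal

theorem eLpNorm_le_of_growth {f : CSpace n → ℂ} {c M : ℝ} (h : ∀ w, ‖f w‖ ≤ M * Real.exp (c * ‖w‖)) :
    eLpNorm f (ENNReal.ofReal p) (gaussianMeasure n (2 * t / p)) ≤
      ENNReal.ofReal M * eLpNorm (fun w : CSpace n => ((Real.exp (c * ‖w‖) : ℝ) : ℂ))
        (ENNReal.ofReal p) (gaussianMeasure n (2 * t / p)) := by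
  refine eLpNorm_le_mul_eLpNorm_of_ae_le_mul (Eventually.of_forall fun w => (h w).trans_eq ?_) _
  rw [Complex.norm_real, Real.norm_of_nonneg (Real.exp_pos _).le]

/-- The explicit elements needed later (constants, kernels, their derivatives and differences) all
have exponential growth of order one, which the Gaussian weight absorbs. Membership and norm bounds
for them come from this comparison alone. -/
theorem mem_fock_of_growth {f : CSpace n → ℂ} {c M : ℝ} (hf : Differentiable ℂ f)
    (h : ∀ w, ‖f w‖ ≤ M * Real.exp (c * ‖w‖)) : f ∈ fockSubmodule n p t :=
  ⟨hf, hf.continuous.aestronglyMeasurable, (eLpNorm_le_of_growth h).trans_lt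
    (ENNReal.mul_lt_top ENNReal.ofReal_lt_top (memLp_exp c).2)⟩

theorem norm_le_of_growth {f : FockSpace n p t} {c M : ℝ} (hM : 0 ≤ M)
    (h : ∀ w, ‖f w‖ ≤ M * Real.exp (c * ‖w‖)) : ‖f‖ ≤ M * expNorm n p t c := by
  rw [FockSpace.norm_def, expNorm, ← ENNReal.toReal_ofReal hM, ← ENNReal.toReal_mul]
  exact ENNReal.toReal_mono (ENNReal.mul_ne_top ENNReal.ofReal_ne_top (memLp_exp c).2.ne)
    (by simpa only [ENNReal.toReal_ofReal hM] using eLpNorm_le_of_growth h)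

/-- The norm of `F_t^p` is a multiple of the `L^p`-norm of `z ↦ f(z) exp(-|z|²/(2t))`. -/
theorem exists_norm_eq_weighted (n : ℕ) (p t : ℝ) [hp : Fact (1 < p)] [ht : Fact (0 < t)] :
    ∃ c : ℝ, 0 < c ∧ ∀ f : FockSpace n p t,
      (eLpNorm (weighted t f) (ENNReal.ofReal p) volume).toReal = c * ‖f‖ := by
  obtain ⟨c, h0, h1, h⟩ := eLpNorm_gaussian (n := n) hp.out ht.out
  refine ⟨c.toReal⁻¹, inv_pos.2 (ENNReal.toReal_pos h0 h1), fun f => ?_⟩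
  rw [FockSpace.norm_def, h, ENNReal.toReal_mul, inv_mul_cancel_left₀]
  exact (ENNReal.toReal_pos h0 h1).ne'

namespace FockSpace

/-- The element of the Fock space given by a function. -/
def of (f : CSpace n → ℂ) (hf : f ∈ fockSubmodule n p t) : FockSpace n p t := ⟨f, hf⟩

theorem sub_apply (f g : FockSpace n p t) (z : CSpace n) : (f - g) z = f z - g z := rfl

theorem zero_apply (z : CSpace n) : (0 : FockSpace n p t) z = 0 := rfl

theorem continuous (f : FockSpace n p t) : Continuous f := f.differentiable.continuous

end FockSpace

/-! ### The reproducing property -/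

theorem integrable_gaussian_mul (x : FockSpace n p t) :
    Integrable (fun w => (gaussianDensity n t w : ℂ) * x w) := by
  have := integrable_toeplitz (BoundedContinuousFunction.const _ (1 : ℂ)) x 0
  simpa using this

/-- The mean value property on the unit circle, for the entire function s ↦ x(s w) of one variable.
-/
theorem integral_circle (x : FockSpace n p t) (w : CSpace n) :
    ∫ θ in (0 : ℝ)..2 * Real.pi, x (Complex.exp (θ * Complex.I) • w) = 2 * Real.pi * x 0 := by
  have hd : Differentiable ℂ fun s : ℂ => x (s • w) :=
    x.differentiable.comp (differentiable_id.smul_const w)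
  have := hd.diffContOnCl (s := Metric.ball 0 |1|).circleAverage
  simp only [Real.circleAverage, circleMap, zero_smul, zero_add, Complex.ofReal_one, one_mul,
    Complex.real_smul] at this
  rw [← this]
  push_cast
  rw [mul_inv_cancel_left₀]
  simp [Real.pi_ne_zero]

/-- Multiplication by a complex number of modulus one. -/
def rotation (n : ℕ) (u : ℂ) (hu : ‖u‖ = 1) : CSpace n ≃ₗᵢ[ℝ] CSpace n where
  toFun w := u • w
  map_add' := smul_add u
  map_smul' := fun c w => smul_comm u c w
  invFun w := u⁻¹ • w
  left_inv w := inv_smul_smul₀ (by rintro rfl; simp at hu) w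
  right_inv w := smul_inv_smul₀ (by rintro rfl; simp at hu) w
  norm_map' w := by
    change ‖u • w‖ = ‖w‖
    rw [norm_smul, hu, one_mul]

theorem norm_circle (θ : ℝ) : ‖Complex.exp (θ * Complex.I)‖ = 1 := Complex.norm_exp_ofReal_mul_I θ

theorem integral_rotation {E : Type*} [NormedAddCommGroup E] [NormedSpace ℝ E] (θ : ℝ)
    (f : CSpace n → E) : ∫ w, f (Complex.exp (θ * Complex.I) • w) = ∫ w, f w :=
  (rotation n _ (norm_circle θ)).measurePreserving.integral_comp
    (rotation n _ (norm_circle θ)).toHomeomorph.measurableEmbedding f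

theorem integrable_rotation {f : CSpace n → ℂ} (hf : Integrable f) (θ : ℝ) :
    Integrable fun w => f (Complex.exp (θ * Complex.I) • w) :=
  ((rotation n _ (norm_circle θ)).measurePreserving.integrable_comp_emb
    (rotation n _ (norm_circle θ)).toHomeomorph.measurableEmbedding).2 hf

theorem gaussianDensity_rotation (θ : ℝ) (w : CSpace n) :
    gaussianDensity n t (Complex.exp (θ * Complex.I) • w) = gaussianDensity n t w := by
  rw [gaussianDensity, norm_smul, norm_circle, one_mul, gaussianDensity]

/-- The Gaussian is invariant under w ↦ e^{iθ} w, so x(w) may be replaced by its mean over the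
circle through w, which is x(0). Fubini on circle × ℂⁿ makes this precise. -/
theorem integral_gaussian_mul (x : FockSpace n p t) :
    ∫ w, (gaussianDensity n t w : ℂ) * x w = x 0 := by
  set I := ∫ w, (gaussianDensity n t w : ℂ) * x w with hI
  have h1 : ∀ θ : ℝ, ∫ w, (gaussianDensity n t w : ℂ) * x (Complex.exp (θ * Complex.I) • w) = I := by
    intro θ
    rw [hI, ← integral_rotation θ fun w => (gaussianDensity n t w : ℂ) * x w]
    simp only [gaussianDensity_rotation]
  have hc : Continuous fun q : ℝ × CSpace n =>
      (gaussianDensity n t q.2 : ℂ) * x (Complex.exp (q.1 * Complex.I) • q.2) := by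
    have := continuous_gaussianDensity n t
    have := x.continuous
    fun_prop
  have hint : Integrable (fun q : ℝ × CSpace n =>
      (gaussianDensity n t q.2 : ℂ) * x (Complex.exp (q.1 * Complex.I) • q.2))
      ((volume.restrict (Set.Ioc 0 (2 * Real.pi))).prod volume) := by
    rw [integrable_prod_iff hc.aestronglyMeasurable]
    refine ⟨Eventually.of_forall fun θ => ?_, ?_⟩
    · have := integrable_rotation (integrable_gaussian_mul x) θ
      simpa only [gaussianDensity_rotation] using this
    · have : ∀ θ : ℝ, ∫ w, ‖(gaussianDensity n t w : ℂ) * x (Complex.exp (θ * Complex.I) • w)‖ =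
          ∫ w, ‖(gaussianDensity n t w : ℂ) * x w‖ := by
        intro θ
        rw [← integral_rotation θ fun w => ‖(gaussianDensity n t w : ℂ) * x w‖]
        simp only [gaussianDensity_rotation]
      simp only [this]
      exact integrable_const _
  have h2 := integral_integral_swap (f := fun (θ : ℝ) (w : CSpace n) =>
    (gaussianDensity n t w : ℂ) * x (Complex.exp (θ * Complex.I) • w)) hint
  simp only [h1] at h2
  have h3 : ∀ w : CSpace n, ∫ θ in Set.Ioc 0 (2 * Real.pi),
      (gaussianDensity n t w : ℂ) * x (Complex.exp (θ * Complex.I) • w) =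
      (gaussianDensity n t w : ℂ) * (2 * Real.pi * x 0) := by
    intro w
    rw [integral_const_mul, ← integral_circle x w, intervalIntegral.integral_of_le (by positivity)]
  simp only [h3] at h2
  rw [integral_mul_const, integral_complex_ofReal, integral_gaussianDensity n ht.out,
    setIntegral_const] at h2
  simp only [measureReal_def, Real.volume_Ioc, sub_zero, Complex.real_smul] at h2
  rw [ENNReal.toReal_ofReal (by positivity)] at h2
  push_cast at h2
  rw [one_mul] at h2
  exact mul_left_cancel₀ (by simp [Real.pi_ne_zero]) h2

/-- The device that transports statements at the origin to an arbitrary point z. -/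
theorem weyl_neg_apply_zero (z : CSpace n) (x : FockSpace n p t) :
    weyl (-z) x 0 = weighted t x z := by
  rw [weyl_apply, weighted, normalizedKernel]
  simp only [inner_zero_right, zero_div, zero_sub, norm_neg, sub_neg_eq_add, zero_add]
  push_cast
  rw [neg_div]

/-- Completing the square: this turns the mean value formula at 0 for W_{-z} x into the reproducing
formula for x at z. -/
theorem kernel_exponent (ht : 0 < t) (z w : CSpace n) :
    (gaussianDensity n t (w - z) : ℂ) * normalizedKernel t (-z) (w - z) =
      Real.exp (-‖z‖ ^ 2 / (2 * t)) * ((gaussianDensity n t w : ℂ) *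
        Complex.exp (inner ℂ w z / t)) := by
  have ht' : (t : ℂ) ≠ 0 := by exact_mod_cast ht.ne'
  have h' : ∀ v : CSpace n, (inner ℂ v v : ℂ) = (‖v‖ : ℂ) ^ 2 :=
    inner_self_eq_norm_sq_to_K (𝕜 := ℂ)
  have h : ((‖w - z‖ : ℂ)) ^ 2 = ‖w‖ ^ 2 - inner ℂ w z - inner ℂ z w + ‖z‖ ^ 2 := by
    rw [← h', ← h', ← h', inner_sub_left, inner_sub_right, inner_sub_right]
    ring
  simp only [gaussianDensity, normalizedKernel]
  push_cast
  rw [mul_assoc, ← Complex.exp_add, mul_left_comm, mul_assoc, ← Complex.exp_add, ← Complex.exp_add,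
    mul_right_inj' (by simp [Real.pi_ne_zero, ht'])]
  congr 1
  rw [h, norm_neg, inner_neg_left, inner_sub_right, h']
  field_simp
  ring

/-- The reproducing property of the Bergman projection. -/
theorem bergmanProjection_self (x : FockSpace n p t) : bergmanProjection t x = x := by
  funext z
  have h := integral_gaussian_mul (weyl (-z) x)
  rw [weyl_neg_apply_zero, ← integral_sub_right_eq_self _ z] at h
  simp only [weyl_apply, sub_neg_eq_add, sub_add_cancel, ← mul_assoc, kernel_exponent ht.out] at h
  simp only [mul_assoc] at h
  rw [integral_const_mul, weighted] at h
  rw [bergmanProjection_eq ht.out]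
  exact mul_left_cancel₀ (by exact_mod_cast (Real.exp_pos _).ne') h

end Growth

end

/-! ### Point evaluations and completeness of the Fock space -/

section

variable {n : ℕ} {p t : ℝ} [hp : Fact (1 < p)] [ht : Fact (0 < t)]

/-! ### Continuity of evaluations -/

theorem integral_norm_mul_le {α : Type*} [MeasurableSpace α] {μ : Measure α} {P Q : ℝ≥0∞}
    [P.HolderConjugate Q] {f g : α → ℂ} (hf : MemLp f P μ) (hg : MemLp g Q μ) :
    ∫ a, ‖f a‖ * ‖g a‖ ∂μ ≤ (eLpNorm f P μ).toReal * (eLpNorm g Q μ).toReal := by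
  have h := eLpNorm_smul_le_mul_eLpNorm (p := P) (q := Q) (r := 1) hg.1 hf.1
  rw [← ENNReal.toReal_mul]
  have h2 : ∫ a, ‖f a‖ * ‖g a‖ ∂μ = (eLpNorm (f • g) 1 μ).toReal := by
    rw [eLpNorm_one_eq_lintegral_enorm, ← integral_norm_eq_lintegral_enorm (hf.1.smul hg.1)]
    simp
  rw [h2]
  exact ENNReal.toReal_mono (ENNReal.mul_ne_top hf.2.ne hg.2.ne) h

theorem integrable_bergman {h : CSpace n → ℂ} (hc : Continuous h)
    (hh : MemLp (weighted t h) (ENNReal.ofReal p) volume) (z : CSpace n) :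
    Integrable fun w => (gaussianDensity n t w : ℂ) * (Complex.exp (inner ℂ w z / t) * h w) := by
  refine ((integrable_exp_mul_weighted hp.out ht.out (‖z‖ / t) hh).const_mul
    (1 / (Real.pi * t) ^ n)).mono' (Continuous.aestronglyMeasurable ?_)
    (Eventually.of_forall (kernel_norm_le ht.out h z))
  have := continuous_gaussianDensity n t
  fun_prop

/-- Hölder's inequality: the kernel times the remaining half of the Gaussian weight lies in L^q for
the conjugate exponent q. -/
theorem exists_norm_bergmanProjection_le (p : ℝ) [hp : Fact (1 < p)] (z : CSpace n) :
    ∃ A : ℝ, 0 ≤ A ∧ ∀ h : CSpace n → ℂ, MemLp (weighted t h) (ENNReal.ofReal p) volume →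
      ‖bergmanProjection t h z‖ ≤ A * (eLpNorm (weighted t h) (ENNReal.ofReal p) volume).toReal := by
  have hpq := Real.HolderConjugate.conjExponent hp.out
  have hq := hpq.symm.lt
  have : ENNReal.HolderConjugate (ENNReal.ofReal (Real.conjExponent p)) (ENNReal.ofReal p) :=
    hpq.symm.ennrealOfReal
  have hm : MemLp (fun w : CSpace n => ((Real.exp (‖z‖ / t * ‖w‖ - ‖w‖ ^ 2 / (2 * t)) : ℝ) : ℂ))
      (ENNReal.ofReal (Real.conjExponent p)) volume :=
    (memLp_gaussian_exp ht.out (‖z‖ / t) hq).ofReal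
  have ht0 := ht.out
  refine ⟨(1 / (Real.pi * t) ^ n) * (eLpNorm (fun w : CSpace n =>
    ((Real.exp (‖z‖ / t * ‖w‖ - ‖w‖ ^ 2 / (2 * t)) : ℝ) : ℂ))
      (ENNReal.ofReal (Real.conjExponent p)) volume).toReal, by positivity, fun h hh => ?_⟩
  rw [bergmanProjection_eq ht.out, mul_assoc]
  have h1 := norm_integral_le_of_norm_le ((integrable_exp_mul_weighted hp.out ht.out
    (‖z‖ / t) hh).const_mul (1 / (Real.pi * t) ^ n)) (Eventually.of_forall (kernel_norm_le ht.out h z))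
  refine h1.trans ?_
  rw [integral_const_mul]
  refine mul_le_mul_of_nonneg_left ?_ (by positivity)
  have h2 := integral_norm_mul_le hm hh
  simpa only [Complex.norm_real, Real.norm_of_nonneg (Real.exp_pos _).le] using h2

theorem weyl_norm_le (z : CSpace n) (x : FockSpace n p t) : ‖weyl z x‖ ≤ ‖x‖ := by
  refine (FockSpace.norm_le_of_weighted (f := x) zero_le_one ?_).trans_eq (one_mul _)
  rw [ENNReal.ofReal_one, one_mul]
  exact (eLpNorm_weighted_weyl z x).le

theorem parity_norm_le (x : FockSpace n p t) : ‖parity x‖ ≤ ‖x‖ := by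
  refine (FockSpace.norm_le_of_weighted (f := x) zero_le_one ?_).trans_eq (one_mul _)
  rw [ENNReal.ofReal_one, one_mul]
  exact (eLpNorm_weighted_parity x).le

/-- The bound at the origin comes from the reproducing formula. Weyl operators are contractions, so
the same constant serves at every z. -/
theorem exists_eval_bound (n : ℕ) (p t : ℝ) [hp : Fact (1 < p)] [ht : Fact (0 < t)] :
    ∃ A : ℝ, 0 ≤ A ∧ ∀ (x : FockSpace n p t) (z : CSpace n), ‖weighted t x z‖ ≤ A * ‖x‖ := by
  obtain ⟨A, hA, h⟩ := exists_norm_bergmanProjection_le (t := t) p (0 : CSpace n)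
  obtain ⟨c, hc, hn⟩ := exists_norm_eq_weighted n p t
  refine ⟨A * c, by positivity, fun x z => ?_⟩
  have := h _ (weyl (-z) x).memLp_weighted
  rw [bergmanProjection_self, weyl_neg_apply_zero, hn, ← mul_assoc] at this
  exact this.trans (by gcongr; exact weyl_norm_le _ _)

theorem norm_apply_eq (f : CSpace n → ℂ) (z : CSpace n) :
    ‖f z‖ = Real.exp (‖z‖ ^ 2 / (2 * t)) * ‖weighted t f z‖ := by
  rw [weighted, norm_mul, Complex.norm_real, Real.norm_of_nonneg (Real.exp_pos _).le, ← mul_assoc,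
    ← Real.exp_add, neg_div, add_neg_cancel, Real.exp_zero, one_mul]

/-- Joint continuity of the evaluation `(x, b) ↦ x(b)`. -/
theorem tendsto_eval {ι : Type*} {l : Filter ι} {y : ι → FockSpace n p t} {y₀ : FockSpace n p t}
    {b : ι → CSpace n} {b₀ : CSpace n} (hy : Tendsto y l (𝓝 y₀)) (hb : Tendsto b l (𝓝 b₀)) :
    Tendsto (fun i => y i (b i)) l (𝓝 (y₀ b₀)) := by
  obtain ⟨A, hA, h⟩ := exists_eval_bound n p t
  have h1 : Tendsto (fun i => y₀ (b i)) l (𝓝 (y₀ b₀)) :=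
    (y₀.continuous.tendsto b₀).comp hb
  have h2 : Tendsto (fun i => (y i - y₀) (b i)) l (𝓝 0) := by
    refine squeeze_zero_norm (a := fun i => Real.exp (‖b i‖ ^ 2 / (2 * t)) * (A * ‖y i - y₀‖))
      (fun i => ?_) ?_
    · rw [norm_apply_eq (t := t)]
      gcongr
      exact h _ _
    · have h3 : Tendsto (fun i => ‖y i - y₀‖) l (𝓝 0) := tendsto_iff_norm_sub_tendsto_zero.1 hy
      have h4 : Tendsto (fun i => Real.exp (‖b i‖ ^ 2 / (2 * t))) l
          (𝓝 (Real.exp (‖b₀‖ ^ 2 / (2 * t)))) :=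
        ((by fun_prop : Continuous fun v : CSpace n => Real.exp (‖v‖ ^ 2 / (2 * t))).tendsto b₀).comp
          hb
      simpa using h4.mul (h3.const_mul A)
  have := h2.add h1
  simpa only [FockSpace.sub_apply, sub_add_cancel, zero_add] using this

/-- Evaluation at a point, as a continuous functional on the Fock space. -/
def evalCLM (z : CSpace n) : StrongDual ℂ (FockSpace n p t) where
  toFun x := x z
  map_add' _ _ := rfl
  map_smul' _ _ := rfl
  cont := continuous_iff_continuousAt.2 fun _ => tendsto_eval tendsto_id tendsto_const_nhds

theorem evalCLM_apply (z : CSpace n) (x : FockSpace n p t) : evalCLM z x = x z := rfl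

/-! ### Completeness -/

theorem tendsto_bergmanProjection {u : ℕ → CSpace n → ℂ} {f : CSpace n → ℂ}
    (hu : ∀ k, Continuous (u k)) (hf : Continuous f)
    (hmu : ∀ k, MemLp (weighted t (u k)) (ENNReal.ofReal p) volume)
    (hmf : MemLp (weighted t f) (ENNReal.ofReal p) volume)
    (h : Tendsto (fun k => eLpNorm (weighted t (u k - f)) (ENNReal.ofReal p) volume) atTop (𝓝 0))
    (z : CSpace n) :
    Tendsto (fun k => bergmanProjection t (u k) z) atTop (𝓝 (bergmanProjection t f z)) := by
  obtain ⟨A, hA, hb⟩ := exists_norm_bergmanProjection_le (t := t) p z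
  have hsub : ∀ k, weighted t (u k - f) = weighted t (u k) - weighted t f := fun k => by
    funext w; simp [weighted, mul_sub]
  refine tendsto_iff_norm_sub_tendsto_zero.2 (squeeze_zero (fun _ => norm_nonneg _) (fun k => ?_)
    (g := fun k => A * (eLpNorm (weighted t (u k - f)) (ENNReal.ofReal p) volume).toReal) ?_)
  · have := hb (u k - f) (by rw [hsub]; exact (hmu k).sub hmf)
    refine le_trans (le_of_eq ?_) this
    congr 1
    rw [bergmanProjection_eq ht.out, bergmanProjection_eq ht.out, bergmanProjection_eq ht.out,
      ← integral_sub (integrable_bergman (hu k) (hmu k) z) (integrable_bergman hf hmf z)]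
    simp only [Pi.sub_apply, mul_sub]
  · have := (ENNReal.tendsto_toReal ENNReal.zero_ne_top).comp h
    simpa using this.const_mul A

theorem FockSpace.isometry_toLp : Isometry (FockSpace.toLp n p t) :=
  AddMonoidHomClass.isometry_of_norm _ fun _ => rfl

/-- An L^p limit of elements of the Fock space is also their locally uniform limit, hence has a
continuous representative. Completeness is what later allows Bochner integrals, the closed graph
theorem and Banach–Steinhaus. -/
instance : CompleteSpace (FockSpace n p t) := by
  refine Metric.complete_of_cauchySeq_tendsto fun u hu => ?_
  obtain ⟨G, hG⟩ := cauchySeq_tendsto_of_complete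
    (FockSpace.isometry_toLp.uniformContinuous.comp_cauchySeq hu)
  have hpt : ∀ z, ∃ c, Tendsto (fun k => u k z) atTop (𝓝 c) := fun z =>
    cauchySeq_tendsto_of_complete
      ((evalCLM (p := p) (t := t) z).uniformContinuous.comp_cauchySeq hu)
  choose f hf using hpt
  obtain ⟨A, hA, hev⟩ := exists_eval_bound n p t
  have hs : 0 < 2 * t / p := by
    have := hp.out; have := ht.out; have : 0 < p := by linarith
    positivity
  have hunif : TendstoLocallyUniformly (fun k => (u k : CSpace n → ℂ)) f atTop := by
    rw [Metric.tendstoLocallyUniformly_iff]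
    intro ε hε z
    refine ⟨Metric.ball z 1, Metric.ball_mem_nhds z one_pos, ?_⟩
    -- The summand 1 only ensures B > 0, since A may vanish.
    set B := Real.exp ((‖z‖ + 1) ^ 2 / (2 * t)) * A + 1
    have hB : 0 < B := by positivity
    obtain ⟨N, hN⟩ := Metric.cauchySeq_iff.1 hu (ε / (2 * B)) (by positivity)
    filter_upwards [eventually_ge_atTop N] with k hk w hw
    have hle : dist (f w) (u k w) ≤ B * (ε / (2 * B)) := by
      refine le_of_tendsto ((hf w).dist tendsto_const_nhds) ?_
      filter_upwards [eventually_ge_atTop N] with m hm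
      have hw' : ‖w‖ ≤ ‖z‖ + 1 := by
        have h1 : ‖w - z‖ < 1 := by rwa [← dist_eq_norm]
        have h2 := norm_add_le (w - z) z
        rw [sub_add_cancel] at h2
        linarith
      rw [dist_eq_norm, ← FockSpace.sub_apply, norm_apply_eq (t := t)]
      have h3 := hev (u m - u k) w
      have h4 : ‖u m - u k‖ ≤ ε / (2 * B) := by rw [← dist_eq_norm]; exact (hN m hm k hk).le
      have ht0 := ht.out
      calc _ ≤ Real.exp ((‖z‖ + 1) ^ 2 / (2 * t)) * (A * (ε / (2 * B))) := by
            gcongr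
            exact h3.trans (by gcongr)
        _ ≤ _ := by
            rw [← mul_assoc]
            gcongr
            simp [B]
    refine hle.trans_lt ?_
    field_simp
    linarith
  have hfc : Continuous f := hunif.continuous (Eventually.of_forall fun k => (u k).continuous).frequently
  have hae : (G : CSpace n → ℂ) =ᵐ[gaussianMeasure n (2 * t / p)] f := by
    obtain ⟨φ, hφ, hφt⟩ := (tendstoInMeasure_of_tendsto_Lp hG).exists_seq_tendsto_ae
    have hcoe : ∀ᵐ z ∂gaussianMeasure n (2 * t / p), ∀ k,
        (FockSpace.toLp n p t (u k)) z = u k z :=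
      ae_all_iff.2 fun k => (u k).memLp.coeFn_toLp
    filter_upwards [hφt, hcoe] with z h1 h2
    simp only [Function.comp_apply, h2] at h1
    exact tendsto_nhds_unique h1 ((hf z).comp hφ.tendsto_atTop)
  have hfm : MemLp f (ENNReal.ofReal p) (gaussianMeasure n (2 * t / p)) :=
    (memLp_congr_ae hae).1 (Lp.memLp G)
  have hGf : hfm.toLp f = G := by
    rw [Lp.ext_iff]
    exact hfm.coeFn_toLp.trans hae.symm
  have hlim : Tendsto (fun k => eLpNorm (weighted t ((u k : CSpace n → ℂ) - f))
      (ENNReal.ofReal p) volume) atTop (𝓝 0) := by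
    obtain ⟨c, h0, h1, hc⟩ := eLpNorm_gaussian (n := n) hp.out ht.out
    have h2 : Tendsto (fun k => eLpNorm ((u k : CSpace n → ℂ) - f) (ENNReal.ofReal p)
        (gaussianMeasure n (2 * t / p))) atTop (𝓝 0) := by
      rw [← hGf] at hG
      exact (Lp.tendsto_Lp_iff_tendsto_eLpNorm'' _ (fun k => (u k).memLp) f hfm).1 hG
    simp only [hc] at h2
    have h3 := ENNReal.Tendsto.const_mul (a := c⁻¹) h2 (Or.inr (ENNReal.inv_ne_top.2 h0))
    simpa only [← mul_assoc, ENNReal.inv_mul_cancel h0 h1, one_mul, mul_zero] using h3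
  have hmf := (memLp_gaussian_iff hp.out ht.out f).1 hfm
  -- The limit inherits the reproducing formula, and Bergman projections are entire; this replaces
  -- an appeal to Weierstrass' theorem.
  have hrep : bergmanProjection t f = f := by
    funext z
    have h1 := tendsto_bergmanProjection (fun k => (u k).continuous) hfc
      (fun k => (u k).memLp_weighted) hmf hlim z
    simp only [bergmanProjection_self] at h1
    exact tendsto_nhds_unique h1 (hf z)
  have hd : Differentiable ℂ f := hrep ▸ differentiable_bergmanProjection hp.out ht.out hfc hmf
  refine ⟨FockSpace.of f ⟨hd, hfm⟩, FockSpace.isometry_toLp.isEmbedding.tendsto_nhds_iff.2 ?_⟩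
  rw [← hGf] at hG
  exact hG

end

/-! ### Weyl relations, reproducing kernels and coherent states -/

section

variable {n : ℕ} {p t : ℝ} [hp : Fact (1 < p)] [ht : Fact (0 < t)]

/-! ### Composition of Weyl operators -/

theorem normalizedKernel_mul (ht : 0 < t) (z w v : CSpace n) :
    normalizedKernel t z v * normalizedKernel t w (v - z) =
      Complex.exp ((inner ℂ z w - inner ℂ w z) / (2 * t)) * normalizedKernel t (z + w) v := by
  have ht' : (t : ℂ) ≠ 0 := by exact_mod_cast ht.ne'
  have h' : ∀ v : CSpace n, (‖v‖ : ℂ) ^ 2 = (inner ℂ v v : ℂ) := fun v =>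
    (inner_self_eq_norm_sq_to_K (𝕜 := ℂ) v).symm
  simp only [normalizedKernel]
  rw [← Complex.exp_add, ← Complex.exp_add, h', h', h']
  congr 1
  simp only [inner_add_left, inner_add_right, inner_sub_right]
  field_simp
  ring

/-- The Weyl relations: z ↦ W_z is a projective representation. The exponent is purely imaginary, so
the cocycle is unimodular. -/
theorem weyl_weyl (z w : CSpace n) (x : FockSpace n p t) :
    weyl z (weyl w x) =
      Complex.exp ((inner ℂ z w - inner ℂ w z) / (2 * t)) • weyl (z + w) x := by
  ext v
  rw [FockSpace.smul_apply, weyl_apply, weyl_apply, weyl_apply, ← mul_assoc, ← mul_assoc,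
    normalizedKernel_mul ht.out, sub_sub]

theorem weyl_zero (x : FockSpace n p t) : weyl 0 x = x := by
  ext v
  simp [weyl_apply, normalizedKernel]

theorem alpha_apply (z : CSpace n) (A : FockSpace n p t →L[ℂ] FockSpace n p t)
    (x : FockSpace n p t) : alpha z A x = weyl z (A (weyl (-z) x)) := rfl

/-- The cocycles of (z, w) and (-w, -z) are inverse to each other, so conjugation is a genuine
action. -/
theorem alpha_alpha (z w : CSpace n) (A : FockSpace n p t →L[ℂ] FockSpace n p t) :
    alpha z (alpha w A) = alpha (z + w) A := by
  ext1 x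
  simp only [alpha_apply]
  rw [weyl_weyl z w, weyl_weyl (-w) (-z), map_smul, map_smul, smul_smul, ← Complex.exp_add, neg_add_rev]
  simp only [inner_neg_neg]
  rw [← add_div, sub_add_sub_cancel, sub_self, zero_div, Complex.exp_zero, one_smul]

theorem alpha_zero (A : FockSpace n p t →L[ℂ] FockSpace n p t) : alpha 0 A = A := by
  ext1 x
  simp only [alpha_apply, neg_zero, weyl_zero]

theorem alpha_apply_norm_le (z : CSpace n) (A : FockSpace n p t →L[ℂ] FockSpace n p t)
    (x : FockSpace n p t) : ‖alpha z A x‖ ≤ ‖A‖ * ‖x‖ := by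
  rw [alpha_apply]
  calc _ ≤ ‖A (weyl (-z) x)‖ := weyl_norm_le _ _
    _ ≤ ‖A‖ * ‖weyl (-z) x‖ := A.le_opNorm _
    _ ≤ _ := by gcongr; exact weyl_norm_le _ _

theorem norm_alpha_le (z : CSpace n) (A : FockSpace n p t →L[ℂ] FockSpace n p t) :
    ‖alpha z A‖ ≤ ‖A‖ :=
  ContinuousLinearMap.opNorm_le_bound _ (norm_nonneg _) (alpha_apply_norm_le z A)

/-- The action `α_z`, as a bounded linear operator. -/
def alphaCLM (z : CSpace n) : (FockSpace n p t →L[ℂ] FockSpace n p t) →L[ℂ]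
    (FockSpace n p t →L[ℂ] FockSpace n p t) :=
  LinearMap.mkContinuous
    { toFun := alpha z
      map_add' := fun A B => by ext1 x; simp [alpha_apply]
      map_smul' := fun c A => by ext1 x; simp [alpha_apply] }
    1 fun A => by rw [one_mul]; exact norm_alpha_le z A

theorem alphaCLM_apply (z : CSpace n) (A : FockSpace n p t →L[ℂ] FockSpace n p t) :
    alphaCLM z A = alpha z A := rfl

theorem parity_parity (x : FockSpace n p t) : parity (parity x) = x := by
  ext z
  simp [parity_apply]

theorem parityConj_apply (A : FockSpace n p t →L[ℂ] FockSpace n p t) (x : FockSpace n p t) :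
    parityConj A x = parity (A (parity x)) := rfl

theorem parityConj_parityConj (A : FockSpace n p t →L[ℂ] FockSpace n p t) :
    parityConj (parityConj A) = A := by
  ext1 x
  simp only [parityConj_apply, parity_parity]

theorem norm_parityConj_le (A : FockSpace n p t →L[ℂ] FockSpace n p t) : ‖parityConj A‖ ≤ ‖A‖ := by
  refine ContinuousLinearMap.opNorm_le_bound _ (norm_nonneg _) fun x => ?_
  calc _ ≤ ‖A (parity x)‖ := parity_norm_le _
    _ ≤ ‖A‖ * ‖parity x‖ := A.le_opNorm _
    _ ≤ _ := by gcongr; exact parity_norm_le _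

/-! ### Kernel functions -/

theorem norm_exp_inner_le (ht : 0 < t) (a w : CSpace n) :
    ‖Complex.exp (inner ℂ a w / t)‖ ≤ Real.exp (‖a‖ / t * ‖w‖) := by
  rw [Complex.norm_exp, Complex.div_ofReal_re, div_mul_eq_mul_div]
  gcongr
  exact re_inner_le_norm (𝕜 := ℂ) a w

theorem differentiable_exp_inner (a : CSpace n) :
    Differentiable ℂ fun w : CSpace n => Complex.exp (inner ℂ a w / t) := by
  have : Differentiable ℂ fun w : CSpace n => (inner ℂ a w : ℂ) := (innerSL ℂ a).differentiable
  fun_prop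

/-- The reproducing kernel `K_a(w) = exp(w·ā/t)`. -/
def expKernel (a : CSpace n) : FockSpace n p t :=
  .of (fun w => Complex.exp (inner ℂ a w / t)) (mem_fock_of_growth (c := ‖a‖ / t) (M := 1)
    (differentiable_exp_inner a) fun w => by rw [one_mul]; exact norm_exp_inner_le ht.out a w)

theorem expKernel_apply (a w : CSpace n) :
    (expKernel a : FockSpace n p t) w = Complex.exp (inner ℂ a w / t) := rfl

theorem norm_inner_mul_exp_le (ht : 0 < t) (a d w : CSpace n) :
    ‖inner ℂ d w / t * Complex.exp (inner ℂ a w / t)‖ ≤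
      ‖d‖ / t * Real.exp ((‖a‖ / t + 1) * ‖w‖) := by
  rw [norm_mul, norm_div, Complex.norm_real, Real.norm_of_nonneg ht.le]
  have h1 : ‖(inner ℂ d w : ℂ)‖ ≤ ‖d‖ * Real.exp ‖w‖ :=
    (norm_inner_le_norm d w).trans (by gcongr; linarith [Real.add_one_le_exp ‖w‖])
  calc _ ≤ ‖d‖ * Real.exp ‖w‖ / t * Real.exp (‖a‖ / t * ‖w‖) := by
        gcongr
        exact norm_exp_inner_le ht a w
    _ = _ := by rw [add_mul, Real.exp_add, one_mul]; ring

/-- The derivative of the reproducing kernel in the (antiholomorphic) direction `d`. -/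
def expKernelDeriv (a d : CSpace n) : FockSpace n p t :=
  .of (fun w => inner ℂ d w / t * Complex.exp (inner ℂ a w / t))
    (mem_fock_of_growth (by
      have h1 : Differentiable ℂ fun w : CSpace n => (inner ℂ d w : ℂ) := (innerSL ℂ d).differentiable
      have h2 := differentiable_exp_inner (t := t) a
      fun_prop) (norm_inner_mul_exp_le ht.out a d))

theorem expKernelDeriv_apply (a d w : CSpace n) : (expKernelDeriv a d : FockSpace n p t) w =
    inner ℂ d w / t * Complex.exp (inner ℂ a w / t) := rfl

/-- Uses |e^u - 1| ≤ |u| e^{|u|} with u = d̄·w/t. In the growth rate, 1/t comes from e^{|u|} and ‖d‖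
≤ 1, and the last 1 from |w| ≤ e^{|w|}. -/
theorem norm_expKernel_sub_le (a d : CSpace n) (hd : ‖d‖ ≤ 1) :
    ‖(expKernel (a + d) - expKernel a : FockSpace n p t)‖ ≤
      ‖d‖ / t * expNorm n p t (‖a‖ / t + 1 / t + 1) := by
  have ht0 := ht.out
  refine norm_le_of_growth (by positivity) fun w => ?_
  rw [FockSpace.sub_apply, expKernel_apply, expKernel_apply, inner_add_left, add_div, Complex.exp_add,
    ← mul_sub_one, norm_mul]
  have h1 := Complex.norm_exp_sub_sum_le_norm_mul_exp (inner ℂ d w / t) 1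
  simp only [Finset.sum_range_one, pow_zero, Nat.factorial_zero, Nat.cast_one, div_one, pow_one]
    at h1
  have h2 : ‖(inner ℂ d w / t : ℂ)‖ ≤ ‖d‖ / t * ‖w‖ := by
    rw [norm_div, Complex.norm_real, Real.norm_of_nonneg ht0.le, div_mul_eq_mul_div]
    gcongr
    exact norm_inner_le_norm d w
  calc _ ≤ Real.exp (‖a‖ / t * ‖w‖) * ((‖d‖ / t * Real.exp ‖w‖) * Real.exp (1 / t * ‖w‖)) := by
        gcongr
        · exact norm_exp_inner_le ht0 a w
        · refine h1.trans ?_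
          gcongr
          · exact h2.trans (by gcongr; linarith [Real.add_one_le_exp ‖w‖])
          · exact h2.trans (by gcongr)
    _ = _ := by rw [add_mul, add_mul, Real.exp_add, Real.exp_add, one_mul]; ring

theorem continuous_expKernel : Continuous (expKernel : CSpace n → FockSpace n p t) := by
  refine continuous_iff_continuousAt.2 fun a => tendsto_iff_norm_sub_tendsto_zero.2 ?_
  refine squeeze_zero' (Eventually.of_forall fun _ => norm_nonneg _)
    (g := fun b => ‖b - a‖ / t * expNorm n p t (‖a‖ / t + 1 / t + 1)) ?_ ?_
  · filter_upwards [Metric.ball_mem_nhds a one_pos] with b hb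
    have := norm_expKernel_sub_le (p := p) (t := t) a (b - a)
      (by rw [← dist_eq_norm]; exact (Metric.mem_ball.1 hb).le)
    rwa [add_sub_cancel] at this
  · have : Continuous fun b => ‖b - a‖ / t * expNorm n p t (‖a‖ / t + 1 / t + 1) := by fun_prop
    simpa using this.tendsto a

/-- The second order version, |e^u - 1 - u| ≤ |u|² e^{|u|}; the 2 in the growth rate absorbs |w|² ≤
e^{2|w|}. -/
theorem norm_expKernel_sub_deriv_le (a d : CSpace n) (s : ℂ) (hs : ‖s‖ ≤ 1) :
    ‖(expKernel (a + star s • d) - expKernel a - s • expKernelDeriv a d : FockSpace n p t)‖ ≤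
      ‖s‖ ^ 2 * ((‖d‖ / t) ^ 2 * expNorm n p t (‖a‖ / t + ‖d‖ / t + 2)) := by
  have ht0 := ht.out
  rw [← mul_assoc]
  refine norm_le_of_growth (by positivity) fun w => ?_
  rw [FockSpace.sub_apply, FockSpace.sub_apply, FockSpace.smul_apply, expKernel_apply, expKernel_apply,
    expKernelDeriv_apply, inner_add_left, inner_smul_left, add_div, Complex.exp_add]
  set c : ℂ := inner ℂ d w / t with hc
  have h0 : (starRingEnd ℂ) (star s) * inner ℂ d w / t = s * c := by
    rw [hc, mul_div_assoc]; simp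
  rw [h0]
  have h3 : Complex.exp (inner ℂ a w / t) * Complex.exp (s * c) - Complex.exp (inner ℂ a w / t) -
      s * (c * Complex.exp (inner ℂ a w / t)) =
      Complex.exp (inner ℂ a w / t) * (Complex.exp (s * c) - (1 + s * c)) := by ring
  rw [h3, norm_mul]
  have h1 := Complex.norm_exp_sub_sum_le_norm_mul_exp (s * c) 2
  simp only [Finset.sum_range_succ, Finset.sum_range_zero, pow_zero, Nat.factorial_zero,
    Nat.cast_one, div_one, pow_one, Nat.factorial_one, zero_add] at h1
  have h2 : ‖c‖ ≤ ‖d‖ / t * ‖w‖ := by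
    rw [hc, norm_div, Complex.norm_real, Real.norm_of_nonneg ht0.le, div_mul_eq_mul_div]
    gcongr
    exact norm_inner_le_norm d w
  have h4 : ‖s * c‖ ≤ 1 * (‖d‖ / t * ‖w‖) := by rw [norm_mul]; gcongr
  rw [one_mul] at h4
  calc _ ≤ Real.exp (‖a‖ / t * ‖w‖) * ((‖s‖ * (‖d‖ / t * Real.exp ‖w‖)) ^ 2 *
        Real.exp (‖d‖ / t * ‖w‖)) := by
        gcongr
        · exact norm_exp_inner_le ht0 a w
        · refine h1.trans ?_
          gcongr
          rw [norm_mul]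
          gcongr
          exact h2.trans (by gcongr; linarith [Real.add_one_le_exp ‖w‖])
    _ = _ := by
        have : Real.exp (2 * ‖w‖) = Real.exp ‖w‖ ^ 2 := by rw [← Real.exp_nat_mul]; norm_num
        rw [add_mul, add_mul, Real.exp_add, Real.exp_add, this]; ring

/-- `s ↦ K_{m + s̄ d}` is holomorphic, with values in the Fock space. -/
theorem hasDerivAt_expKernel (m d : CSpace n) (s₀ : ℂ) :
    HasDerivAt (fun s : ℂ => (expKernel (m + star s • d) : FockSpace n p t))
      (expKernelDeriv (m + star s₀ • d) d) s₀ := by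
  rw [hasDerivAt_iff_isLittleO]
  set M := (‖d‖ / t) ^ 2 * expNorm n p t (‖m + star s₀ • d‖ / t + ‖d‖ / t + 2)
  refine (Asymptotics.IsBigO.of_bound (g := fun s => (s - s₀) ^ 2) M ?_).trans_isLittleO ?_
  · filter_upwards [Metric.ball_mem_nhds s₀ one_pos] with s hs
    have h := norm_expKernel_sub_deriv_le (p := p) (t := t) (m + star s₀ • d) d (s - s₀)
      (by rw [← dist_eq_norm]; exact (Metric.mem_ball.1 hs).le)
    have h1 : m + star s₀ • d + star (s - s₀) • d = m + star s • d := by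
      rw [add_assoc, ← add_smul, star_sub, add_sub_cancel]
    rw [h1] at h
    rw [norm_pow, mul_comm]
    exact h
  · have := (Asymptotics.isLittleO_pow_id (𝕜 := ℂ) one_lt_two).comp_tendsto
      (tendsto_sub_nhds_zero_iff.2 (tendsto_id (x := 𝓝 s₀)))
    exact this

/-! ### Coherent states -/

/-- The constant function `1`. -/
def constOne : FockSpace n p t :=
  .of (fun _ => 1) (mem_fock_of_growth (c := 0) (M := 1) (differentiable_const _) fun w => by simp)

theorem constOne_apply (w : CSpace n) : (constOne : FockSpace n p t) w = 1 := rfl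

/-- The coherent state `k_z = W_z 1`. -/
def coherent (z : CSpace n) : FockSpace n p t := weyl z constOne

theorem coherent_apply (z w : CSpace n) :
    (coherent z : FockSpace n p t) w = normalizedKernel t z w := by
  rw [coherent, weyl_apply, constOne_apply, mul_one]

theorem norm_coherent_le (z : CSpace n) :
    ‖(coherent z : FockSpace n p t)‖ ≤ ‖(constOne : FockSpace n p t)‖ := weyl_norm_le _ _

theorem coherent_eq_smul (z : CSpace n) : (coherent z : FockSpace n p t) =
    ((Real.exp (-‖z‖ ^ 2 / (2 * t)) : ℝ) : ℂ) • expKernel z := by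
  ext w
  rw [coherent_apply, FockSpace.smul_apply, expKernel_apply, normalizedKernel, Complex.ofReal_exp,
    ← Complex.exp_add]
  congr 1
  push_cast
  ring

theorem expKernel_eq_smul (z : CSpace n) : (expKernel z : FockSpace n p t) =
    ((Real.exp (‖z‖ ^ 2 / (2 * t)) : ℝ) : ℂ) • coherent z := by
  rw [coherent_eq_smul, smul_smul, ← Complex.ofReal_mul, ← Real.exp_add, neg_div, add_neg_cancel,
    Real.exp_zero, Complex.ofReal_one, one_smul]

theorem continuous_coherent : Continuous (coherent : CSpace n → FockSpace n p t) := by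
  have h : (coherent : CSpace n → FockSpace n p t) = fun z =>
      ((Real.exp (-‖z‖ ^ 2 / (2 * t)) : ℝ) : ℂ) • expKernel z := funext coherent_eq_smul
  rw [h]
  exact (continuous_wt t).smul continuous_expKernel

theorem weyl_coherent (z w : CSpace n) : weyl z (coherent w : FockSpace n p t) =
    Complex.exp ((inner ℂ z w - inner ℂ w z) / (2 * t)) • coherent (z + w) :=
  weyl_weyl z w _

end

/-! ### Toeplitz operators and the resolution of the identity -/

section

variable {n : ℕ} {p t : ℝ} [hp : Fact (1 < p)] [ht : Fact (0 < t)]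

/-! ### Cutoff functions and a test for integrability -/

/-- A continuous cutoff function, `1` on the ball of radius `k` and `0` off the ball of radius
`k + 1`. -/
def cutoffFun (k : ℕ) (w : CSpace n) : ℝ := max 0 (min 1 (k + 1 - ‖w‖))

theorem continuous_cutoffFun (k : ℕ) : Continuous (cutoffFun k : CSpace n → ℝ) := by
  unfold cutoffFun; fun_prop

theorem cutoffFun_nonneg (k : ℕ) (w : CSpace n) : 0 ≤ cutoffFun k w := le_max_left _ _

theorem cutoffFun_le_one (k : ℕ) (w : CSpace n) : cutoffFun k w ≤ 1 :=
  max_le zero_le_one (min_le_left _ _)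

theorem cutoffFun_eq_one {k : ℕ} {w : CSpace n} (h : ‖w‖ ≤ k) : cutoffFun k w = 1 := by
  rw [cutoffFun, min_eq_left (by linarith), max_eq_right zero_le_one]

theorem tendsto_cutoffFun (w : CSpace n) : Tendsto (fun k => cutoffFun k w) atTop (𝓝 1) := by
  refine tendsto_const_nhds.congr' ?_
  obtain ⟨N, hN⟩ := exists_nat_ge ‖w‖
  filter_upwards [eventually_ge_atTop N] with k hk
  exact (cutoffFun_eq_one (hN.trans (by exact_mod_cast hk))).symm

theorem hasCompactSupport_cutoffFun (k : ℕ) : HasCompactSupport (cutoffFun k : CSpace n → ℝ) := by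
  refine HasCompactSupport.intro (isCompact_closedBall 0 (k + 1 : ℝ)) fun w hw => ?_
  have : (k : ℝ) + 1 < ‖w‖ := by simpa using hw
  rw [cutoffFun, max_eq_left]
  exact (min_le_right _ _).trans (by linarith)

/-- The cutoff function as a symbol. -/
def cutoff (k : ℕ) : CSpace n →ᵇ ℂ :=
  .ofNormedAddCommGroup (fun w => (cutoffFun k w : ℂ))
    (Complex.continuous_ofReal.comp (continuous_cutoffFun k)) 1 fun w => by
      rw [Complex.norm_real, Real.norm_of_nonneg (cutoffFun_nonneg k w)]
      exact cutoffFun_le_one k w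

theorem cutoff_apply (k : ℕ) (w : CSpace n) : cutoff k w = (cutoffFun k w : ℂ) := rfl

theorem hasCompactSupport_mul_cutoff (f : CSpace n →ᵇ ℂ) (k : ℕ) :
    HasCompactSupport (f * cutoff k : CSpace n →ᵇ ℂ) := by
  have : HasCompactSupport (fun w : CSpace n => f w * (cutoffFun k w : ℂ)) :=
    ((hasCompactSupport_cutoffFun k).comp_left Complex.ofReal_zero).mul_left
  exact this

/-- A continuous function whose integrals against test functions of norm at most `1` are bounded
by `B` is integrable, and its `L¹`-norm is at most `B`. -/
theorem integrable_of_forall_test {m : CSpace n → ℂ} (hm : Continuous m) {B : ℝ}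
    (h : ∀ θ : CSpace n →ᵇ ℂ, HasCompactSupport θ → ‖θ‖ ≤ 1 → ‖∫ w, θ w * m w‖ ≤ B) :
    Integrable m ∧ ∫ w, ‖m w‖ ≤ B := by
  have hB : 0 ≤ B := (norm_nonneg _).trans (h 0 HasCompactSupport.zero (by simp))
  let ε : ℕ → ℝ := fun k => 1 / ((k : ℝ) + 1)
  have hε : ∀ k, 0 < ε k := fun k => by positivity
  -- The ideal test function is the phase of the conjugate of m, which is discontinuous at zeros of
  -- m. Its regularization m̄/(|m| + ε), cut off to compact support, pairs with m to give φ, and φ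
  -- tends to |m|.
  let φ : ℕ → CSpace n → ℝ := fun k w => cutoffFun k w * (‖m w‖ ^ 2 / (‖m w‖ + ε k))
  have hden : ∀ k w, ‖m w‖ + ε k ≠ 0 := fun k w => by have := hε k; positivity
  have hφc : ∀ k, Continuous (φ k) := fun k =>
    (continuous_cutoffFun k).mul ((hm.norm.pow 2).div (hm.norm.add continuous_const) (hden k))
  have hφ0 : ∀ k w, 0 ≤ φ k w := fun k w => by
    have := hε k; have := cutoffFun_nonneg k w; positivity
  have hφint : ∀ k, Integrable (φ k) := fun k =>
    (hφc k).integrable_of_hasCompactSupport (hasCompactSupport_cutoffFun k).mul_right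
  have hφB : ∀ k, ∫ w, φ k w ≤ B := by
    intro k
    let θ₀ : CSpace n →ᵇ ℂ := .ofNormedAddCommGroup
      (fun w => star (m w) / ((‖m w‖ + ε k : ℝ) : ℂ))
      ((hm.star).div (Complex.continuous_ofReal.comp (hm.norm.add continuous_const))
        fun w => by exact_mod_cast hden k w) 1 fun w => by
        have := hε k
        rw [norm_div, norm_star, Complex.norm_real, Real.norm_of_nonneg (by positivity),
          div_le_one (by positivity)]
        linarith
    have h1 := h (θ₀ * cutoff k) (hasCompactSupport_mul_cutoff _ _) ?_
    · have h2 : ∀ w, (θ₀ * cutoff k : CSpace n →ᵇ ℂ) w * m w = (φ k w : ℂ) := by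
        intro w
        change star (m w) / ((‖m w‖ + ε k : ℝ) : ℂ) * (cutoffFun k w : ℂ) * m w = _
        have h3 : star (m w) * m w = ((‖m w‖ ^ 2 : ℝ) : ℂ) := by
          rw [mul_comm]; push_cast; exact Complex.mul_conj' (m w)
        simp only [φ]
        rw [Complex.ofReal_mul, Complex.ofReal_div, ← h3]
        ring
      simp only [h2] at h1
      rw [integral_complex_ofReal, Complex.norm_real] at h1
      exact (Real.le_norm_self _).trans h1
    · refine (BoundedContinuousFunction.norm_le zero_le_one).2 fun w => ?_
      change ‖θ₀ w * cutoff k w‖ ≤ 1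
      rw [norm_mul]
      refine mul_le_one₀ ?_ (norm_nonneg _) ?_
      · refine (θ₀.norm_coe_le_norm w).trans ?_
        exact BoundedContinuousFunction.norm_ofNormedAddCommGroup_le _ zero_le_one _
      · rw [cutoff_apply, Complex.norm_real, Real.norm_of_nonneg (cutoffFun_nonneg k w)]
        exact cutoffFun_le_one k w
  have hlim : ∀ w, Tendsto (fun k => φ k w) atTop (𝓝 ‖m w‖) := by
    intro w
    by_cases h0 : m w = 0
    · simp [φ, h0]
    · have h1 : Tendsto (fun k => ‖m w‖ ^ 2 / (‖m w‖ + ε k)) atTop (𝓝 (‖m w‖ ^ 2 / (‖m w‖ + 0))) :=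
        tendsto_const_nhds.div (tendsto_const_nhds.add tendsto_one_div_add_atTop_nhds_zero_nat)
          (by simpa using h0)
      have h2 := (tendsto_cutoffFun w).mul h1
      have h3 : ‖m w‖ ≠ 0 := by simpa using h0
      have h4 : 1 * (‖m w‖ ^ 2 / (‖m w‖ + 0)) = ‖m w‖ := by rw [add_zero]; field_simp
      rwa [h4] at h2
  -- Fatou's lemma, as integrability of |m| is not yet known.
  have hle : ∫⁻ w, ‖m w‖ₑ ≤ ENNReal.ofReal B := by
    calc ∫⁻ w, ‖m w‖ₑ = ∫⁻ w, liminf (fun k => ENNReal.ofReal (φ k w)) atTop := by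
          refine lintegral_congr fun w => ?_
          rw [← ofReal_norm]
          exact ((ENNReal.continuous_ofReal.tendsto _).comp (hlim w)).liminf_eq.symm
      _ ≤ liminf (fun k => ∫⁻ w, ENNReal.ofReal (φ k w)) atTop :=
          lintegral_liminf_le fun k => (hφc k).measurable.ennreal_ofReal
      _ ≤ ENNReal.ofReal B := by
          refine (liminf_le_liminf (v := fun _ => ENNReal.ofReal B)
            (Eventually.of_forall fun k => ?_)).trans_eq (liminf_const _)
          rw [← ofReal_integral_eq_lintegral_ofReal (hφint k) (Eventually.of_forall (hφ0 k))]
          exact ENNReal.ofReal_le_ofReal (hφB k)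
  have hint : Integrable m := ⟨hm.aestronglyMeasurable, hle.trans_lt ENNReal.ofReal_lt_top⟩
  refine ⟨hint, ?_⟩
  rw [integral_norm_eq_lintegral_enorm hint.1]
  exact ENNReal.toReal_le_of_le_ofReal hB hle

/-! ### Toeplitz operators -/

theorem exists_toeplitz_bound (n : ℕ) (p t : ℝ) [hp : Fact (1 < p)] [ht : Fact (0 < t)] :
    ∃ C : ℝ, 0 ≤ C ∧ ∀ (f : CSpace n →ᵇ ℂ) (x : FockSpace n p t), ‖toeplitz p t f x‖ ≤
      C * (eLpNorm (weighted t fun w => f w * x w) (ENNReal.ofReal p) volume).toReal := by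
  obtain ⟨C, hC0, hC⟩ := exists_bergman_bound n hp.out ht.out
  obtain ⟨c, hc, hn⟩ := exists_norm_eq_weighted n p t
  refine ⟨c⁻¹ * C, by positivity, fun f x => ?_⟩
  rw [mul_assoc, ← div_eq_inv_mul, le_div_iff₀' hc, ← hn]
  have h := hC _ (f.continuous.mul x.continuous)
  rw [← ENNReal.toReal_ofReal hC0, ← ENNReal.toReal_mul]
  exact ENNReal.toReal_mono (ENNReal.mul_ne_top ENNReal.ofReal_ne_top
    (memLp_weighted_mul f x).1.2.ne) h

theorem toeplitz_apply_eq (f : CSpace n →ᵇ ℂ) (x : FockSpace n p t) (z : CSpace n) :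
    toeplitz p t f x z = ∫ w, (gaussianDensity n t w : ℂ) *
      (Complex.exp (inner ℂ w z / t) * (f w * x w)) :=
  bergmanProjection_eq ht.out _ z

theorem toeplitz_add (f g : CSpace n →ᵇ ℂ) :
    toeplitz p t (f + g) = toeplitz p t f + toeplitz p t g := by
  ext x z
  rw [_root_.add_apply, FockSpace.add_apply, toeplitz_apply_eq, toeplitz_apply_eq,
    toeplitz_apply_eq, ← integral_add (integrable_toeplitz f x z) (integrable_toeplitz g x z)]
  simp only [BoundedContinuousFunction.add_apply, add_mul, mul_add]

theorem toeplitz_smul (c : ℂ) (f : CSpace n →ᵇ ℂ) :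
    toeplitz p t (c • f) = c • toeplitz p t f := by
  ext x z
  rw [_root_.smul_apply, FockSpace.smul_apply, toeplitz_apply_eq, toeplitz_apply_eq,
    ← integral_const_mul]
  refine integral_congr_ae (Eventually.of_forall fun w => ?_)
  simp only [BoundedContinuousFunction.smul_apply, smul_eq_mul]
  ring

theorem exists_norm_toeplitz_le (n : ℕ) (p t : ℝ) [hp : Fact (1 < p)] [ht : Fact (0 < t)] :
    ∃ C : ℝ, 0 ≤ C ∧ ∀ (f : CSpace n →ᵇ ℂ), ‖toeplitz p t f‖ ≤ C * ‖f‖ := by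
  obtain ⟨C, hC0, hC⟩ := exists_toeplitz_bound n p t
  obtain ⟨c, hc, hn⟩ := exists_norm_eq_weighted n p t
  refine ⟨C * c, by positivity, fun f => ?_⟩
  refine ContinuousLinearMap.opNorm_le_bound _ (by positivity) fun x => (hC f x).trans ?_
  have h := ENNReal.toReal_mono (ENNReal.mul_ne_top ENNReal.ofReal_ne_top
    x.memLp_weighted.2.ne) (memLp_weighted_mul f x).2
  rw [ENNReal.toReal_mul, ENNReal.toReal_ofReal (norm_nonneg _), hn] at h
  calc _ ≤ C * (‖f‖ * (c * ‖x‖)) := by gcongr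
    _ = _ := by ring

/-- The map `f ↦ T_f` as a bounded linear map. -/
def toeplitzCLM (n : ℕ) (p t : ℝ) [Fact (1 < p)] [Fact (0 < t)] :
    (CSpace n →ᵇ ℂ) →L[ℂ] (FockSpace n p t →L[ℂ] FockSpace n p t) :=
  LinearMap.mkContinuousOfExistsBound
    { toFun := toeplitz p t
      map_add' := toeplitz_add
      map_smul' := toeplitz_smul }
    (let ⟨C, h⟩ := exists_norm_toeplitz_le n p t; ⟨C, h.2⟩)

theorem toeplitzCLM_apply (f : CSpace n →ᵇ ℂ) : toeplitzCLM n p t f = toeplitz p t f := rfl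

/-- The reproducing property as an operator identity; it turns formulas for Toeplitz operators into
resolutions of the identity. -/
theorem toeplitz_one : toeplitz p t (1 : CSpace n →ᵇ ℂ) = ContinuousLinearMap.id ℂ _ := by
  ext x z
  have h := congrFun (bergmanProjection_self x) z
  rw [bergmanProjection_eq ht.out] at h
  rw [toeplitz_apply_eq]
  simpa using h

/-- Dominated convergence in L^p for fixed x. Strong convergence is enough to reduce weak formulas
to compactly supported symbols. -/
theorem tendsto_toeplitz_cutoff (f : CSpace n →ᵇ ℂ) (x : FockSpace n p t) :
    Tendsto (fun k => toeplitz p t (f * cutoff k) x) atTop (𝓝 (toeplitz p t f x)) := by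
  obtain ⟨C, hC0, hC⟩ := exists_toeplitz_bound n p t
  have hp0 : 0 < p := by linarith [hp.out]
  have hne0 : ENNReal.ofReal p ≠ 0 := by simpa using hp0
  rw [tendsto_iff_norm_sub_tendsto_zero]
  have hsub : ∀ k, toeplitz p t (f * cutoff k) x - toeplitz p t f x =
      toeplitz p t (f * cutoff k - f) x := fun k => by
    simp only [← toeplitzCLM_apply, map_sub, _root_.sub_apply]
  have hmem := fun k => (memLp_weighted_mul (f * cutoff k - f) x).1
  have hlim : Tendsto (fun k => ∫ w, ‖weighted t (fun w => (f * cutoff k - f : CSpace n →ᵇ ℂ) w * x w) w‖ ^ p) atTop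
      (𝓝 (∫ _ : CSpace n, (0 : ℝ))) := by
    refine tendsto_integral_of_dominated_convergence
      (fun w => (‖f‖ * ‖weighted t x w‖) ^ p) (fun k => ?_) ?_ (fun k => Eventually.of_forall fun w => ?_)
      (Eventually.of_forall fun w => ?_)
    · exact ((hmem k).1.norm.aemeasurable.pow_const p).aestronglyMeasurable
    · have := (x.memLp_weighted.const_mul (‖f‖ : ℂ)).integrable_norm_rpow hne0 ENNReal.ofReal_ne_top
      simpa [ENNReal.toReal_ofReal hp0.le] using this
    · rw [Real.norm_of_nonneg (by positivity)]
      refine Real.rpow_le_rpow (norm_nonneg _) ?_ hp0.le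
      have h1 : (f * cutoff k - f : CSpace n →ᵇ ℂ) w = f w * ((cutoffFun k w - 1 : ℝ) : ℂ) := by
        push_cast
        rw [mul_sub_one]; rfl
      rw [weighted, h1, weighted, norm_mul, norm_mul, norm_mul, norm_mul, mul_left_comm]
      have h2 : ‖((cutoffFun k w - 1 : ℝ) : ℂ)‖ ≤ 1 := by
        rw [Complex.norm_real, Real.norm_eq_abs, abs_le]
        constructor <;> linarith [cutoffFun_nonneg k w, cutoffFun_le_one k w]
      calc _ = ‖f w‖ * ‖((cutoffFun k w - 1 : ℝ) : ℂ)‖ *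
            (‖((Real.exp (-‖w‖ ^ 2 / (2 * t)) : ℝ) : ℂ)‖ * ‖x w‖) := by ring
        _ ≤ ‖f‖ * 1 * (‖((Real.exp (-‖w‖ ^ 2 / (2 * t)) : ℝ) : ℂ)‖ * ‖x w‖) := by
            gcongr
            exact f.norm_coe_le_norm w
        _ = _ := by rw [mul_one]
    · refine tendsto_const_nhds.congr' ?_
      obtain ⟨N, hN⟩ := exists_nat_ge ‖w‖
      filter_upwards [eventually_ge_atTop N] with k hk
      have h1 : (f * cutoff k - f : CSpace n →ᵇ ℂ) w = f w * ((cutoffFun k w - 1 : ℝ) : ℂ) := by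
        push_cast
        rw [mul_sub_one]; rfl
      rw [weighted, h1, cutoffFun_eq_one (hN.trans (by exact_mod_cast hk))]
      simp [Real.zero_rpow hp0.ne']
  rw [integral_zero] at hlim
  refine squeeze_zero (fun _ => norm_nonneg _) (fun k => (congrArg norm (hsub k)).trans_le (hC _ x)) ?_
  have hpi : 0 ≤ p⁻¹ := by positivity
  have h3 := ((hlim.rpow_const (p := p⁻¹) (Or.inr hpi))).const_mul C
  rw [Real.zero_rpow (by positivity), mul_zero] at h3
  refine h3.congr fun k => ?_
  rw [(hmem k).eLpNorm_eq_integral_rpow_norm hne0 ENNReal.ofReal_ne_top,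
    ENNReal.toReal_ofReal hp0.le, ENNReal.toReal_ofReal (by positivity)]

/-! ### Coherent state expansions -/

/-- The normalizing constant `(πt)⁻ⁿ`. -/
def normConst (n : ℕ) (t : ℝ) : ℂ := ((1 / (Real.pi * t) ^ n : ℝ) : ℂ)

theorem normConst_ne_zero (n : ℕ) (t : ℝ) [ht : Fact (0 < t)] : normConst n t ≠ 0 := by
  have := ht.out
  rw [normConst, Complex.ofReal_ne_zero]
  positivity

/-- `w ↦ y(k_w) e^{-|w|²/(2t)} x(w)`, the matrix coefficient `⟨α_w(1 ⊗ δ_0) x, y⟩`. -/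
def coherentCoeff (y : StrongDual ℂ (FockSpace n p t)) (x : FockSpace n p t) (w : CSpace n) : ℂ :=
  y (coherent w) * weighted t x w

theorem continuous_coherentCoeff (y : StrongDual ℂ (FockSpace n p t)) (x : FockSpace n p t) :
    Continuous (coherentCoeff y x) :=
  (y.continuous.comp continuous_coherent).mul (continuous_weighted x.continuous)

/-- Compact support makes the integrand Bochner integrable in F_t^p itself; the identity is then
checked by evaluating at points. A general functional can be moved inside the integral afterwards.
-/
theorem toeplitz_of_hasCompactSupport (θ : CSpace n →ᵇ ℂ) (hθ : HasCompactSupport θ)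
    (x : FockSpace n p t) :
    Integrable (fun w => (θ w * weighted t x w) • (coherent w : FockSpace n p t)) ∧
    toeplitz p t θ x = normConst n t • ∫ w, (θ w * weighted t x w) • coherent w := by
  have hi : Integrable (fun w => (θ w * weighted t x w) • (coherent w : FockSpace n p t)) :=
    ((θ.continuous.mul (continuous_weighted x.continuous)).smul
      continuous_coherent).integrable_of_hasCompactSupport (hθ.mul_right.smul_right)
  refine ⟨hi, ?_⟩
  ext z
  rw [FockSpace.smul_apply, ← evalCLM_apply z (∫ _, _), ← (evalCLM z).integral_comp_comm hi,
    ← integral_const_mul, toeplitz_apply_eq]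
  refine integral_congr_ae (Eventually.of_forall fun w => ?_)
  simp only [evalCLM_apply, FockSpace.smul_apply, coherent_apply, normalizedKernel, weighted, normConst,
    gaussianDensity, Complex.ofReal_mul, Complex.ofReal_exp]
  rw [sub_eq_add_neg (_ / _), Complex.exp_add]
  have h3 : Complex.exp ((-‖w‖ ^ 2 / t : ℝ) : ℂ) = Complex.exp ((-‖w‖ ^ 2 / (2 * t) : ℝ) : ℂ) *
      Complex.exp (-((‖w‖ : ℂ) ^ 2 / (2 * t))) := by
    have ht' : (t : ℂ) ≠ 0 := by exact_mod_cast ht.out.ne'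
    rw [← Complex.exp_add]
    congr 1
    push_cast
    field_simp
    ring
  rw [h3]
  ring

theorem dual_toeplitz_of_hasCompactSupport (θ : CSpace n →ᵇ ℂ) (hθ : HasCompactSupport θ)
    (x : FockSpace n p t) (y : StrongDual ℂ (FockSpace n p t)) :
    y (toeplitz p t θ x) = normConst n t * ∫ w, θ w * coherentCoeff y x w := by
  obtain ⟨hi, h⟩ := toeplitz_of_hasCompactSupport θ hθ x
  rw [h, map_smul, smul_eq_mul, ← y.integral_comp_comm hi]
  congr 1
  refine integral_congr_ae (Eventually.of_forall fun w => ?_)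
  simp only [map_smul, smul_eq_mul, coherentCoeff]
  ring

/-- The functions `w ↦ y(k_w) e^{-|w|²/(2t)} x(w)` are integrable, with `L¹`-norm at most
`C ‖y‖ ‖x‖`. -/
theorem exists_coherentCoeff_bound (n : ℕ) (p t : ℝ) [hp : Fact (1 < p)] [ht : Fact (0 < t)] :
    ∃ C : ℝ, 0 ≤ C ∧ ∀ (y : StrongDual ℂ (FockSpace n p t)) (x : FockSpace n p t),
      Integrable (coherentCoeff y x) ∧ ∫ w, ‖coherentCoeff y x w‖ ≤ C * (‖y‖ * ‖x‖) := by
  obtain ⟨C, hC0, hC⟩ := exists_norm_toeplitz_le n p t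
  have hc := norm_pos_iff.2 (normConst_ne_zero n t)
  refine ⟨‖normConst n t‖⁻¹ * C, by positivity, fun y x =>
    integrable_of_forall_test (continuous_coherentCoeff y x) fun θ hθ hθ1 => ?_⟩
  -- Tested against θ, the coefficient gives y(T_θ x) up to the constant, and this is bounded
  -- uniformly in ‖θ‖ ≤ 1 because ‖T_θ‖ ≤ C ‖θ‖.
  have h := dual_toeplitz_of_hasCompactSupport θ hθ x y
  rw [mul_assoc, ← div_eq_inv_mul, le_div_iff₀' hc, ← norm_mul, ← h]
  calc _ ≤ ‖y‖ * (‖toeplitz p t θ‖ * ‖x‖) :=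
        (y.le_opNorm _).trans (by gcongr; exact ContinuousLinearMap.le_opNorm _ _)
    _ ≤ ‖y‖ * (C * 1 * ‖x‖) := by
        gcongr
        exact (hC θ).trans (by gcongr)
    _ = _ := by ring

theorem integrable_coherentCoeff (y : StrongDual ℂ (FockSpace n p t)) (x : FockSpace n p t) :
    Integrable (coherentCoeff y x) :=
  ((exists_coherentCoeff_bound n p t).choose_spec.2 y x).1

theorem integrable_bcf_mul {m : CSpace n → ℂ} (hm : Integrable m) (f : CSpace n →ᵇ ℂ) :
    Integrable fun w => f w * m w :=
  hm.bdd_mul f.continuous.aestronglyMeasurable (Eventually.of_forall f.norm_coe_le_norm)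

/-- Cut off the symbol and pass to the limit: strong convergence on the left, dominated convergence
on the right, where the L¹ bound on the coefficient is essential. -/
theorem dual_toeplitz (f : CSpace n →ᵇ ℂ) (x : FockSpace n p t)
    (y : StrongDual ℂ (FockSpace n p t)) :
    y (toeplitz p t f x) = normConst n t * ∫ w, f w * coherentCoeff y x w := by
  have h1 := (y.continuous.tendsto _).comp (tendsto_toeplitz_cutoff f x)
  refine tendsto_nhds_unique h1 ?_
  have h2 : ∀ k, y (toeplitz p t (f * cutoff k) x) = normConst n t *
      ∫ w, (f * cutoff k : CSpace n →ᵇ ℂ) w * coherentCoeff y x w := fun k =>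
    dual_toeplitz_of_hasCompactSupport _ (hasCompactSupport_mul_cutoff f k) x y
  simp only [Function.comp_def, h2]
  refine Tendsto.const_mul _ (tendsto_integral_of_dominated_convergence
    (fun w => ‖f w * coherentCoeff y x w‖) (fun k => ?_)
    (integrable_bcf_mul (integrable_coherentCoeff y x) f).norm
    (fun k => Eventually.of_forall fun w => ?_) (Eventually.of_forall fun w => ?_))
  · exact ((f * cutoff k).continuous.mul (continuous_coherentCoeff y x)).aestronglyMeasurable
  · change ‖f w * (cutoffFun k w : ℂ) * _‖ ≤ _
    rw [norm_mul, norm_mul, norm_mul, Complex.norm_real, Real.norm_of_nonneg (cutoffFun_nonneg k w)]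
    gcongr
    exact mul_le_of_le_one_right (norm_nonneg _) (cutoffFun_le_one k w)
  · have h3 : Tendsto (fun k => f w * (cutoffFun k w : ℂ) * coherentCoeff y x w) atTop
        (𝓝 (f w * ((1 : ℝ) : ℂ) * coherentCoeff y x w)) :=
      (tendsto_const_nhds.mul ((Complex.continuous_ofReal.tendsto _).comp
        (tendsto_cutoffFun w))).mul tendsto_const_nhds
    simpa [cutoff_apply] using h3

/-- The case f = 1. It yields the density of coherent states and the trace formula. -/
theorem dual_eq_integral (x : FockSpace n p t) (y : StrongDual ℂ (FockSpace n p t)) :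
    y x = normConst n t * ∫ w, coherentCoeff y x w := by
  have := dual_toeplitz 1 x y
  rw [toeplitz_one] at this
  simpa using this

/-- The coherent states span a dense subspace. -/
theorem eq_zero_of_coherent {F : Type*} [NormedAddCommGroup F] [NormedSpace ℂ F]
    (C : FockSpace n p t →L[ℂ] F) (h : ∀ w, C (coherent w) = 0) : C = 0 := by
  ext x
  refine SeparatingDual.eq_zero_of_forall_dual_eq_zero (R := ℂ) fun g => ?_
  rw [← ContinuousLinearMap.comp_apply, dual_eq_integral x (g.comp C)]
  simp [coherentCoeff, h]

/-- Hahn–Banach in the quotient E/S, whose seminorm is a norm because S is closed. -/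
theorem mem_of_forall_dual {E : Type*} [NormedAddCommGroup E] [NormedSpace ℂ E]
    {S : Submodule ℂ E} (hS : IsClosed (S : Set E)) {x : E}
    (h : ∀ g : StrongDual ℂ E, (∀ a ∈ S, g a = 0) → g x = 0) : x ∈ S := by
  have := hS
  have h1 : S.mkQL x = 0 := SeparatingDual.eq_zero_of_forall_dual_eq_zero (R := ℂ) fun g =>
    h (g.comp S.mkQL) fun a ha => by
      have h2 : S.mkQL a = 0 := by simpa using ha
      rw [ContinuousLinearMap.comp_apply, h2, map_zero]
  simpa using h1

/-- Strong continuity of the Weyl operators. -/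
theorem continuous_weyl (x : FockSpace n p t) : Continuous fun z => weyl z x := by
  let S : Submodule ℂ (FockSpace n p t) :=
    { carrier := {x | Continuous fun z => weyl z x}
      add_mem' := fun ha hb => by
        simp only [Set.mem_ofPred_eq, map_add]
        exact Continuous.add ha hb
      zero_mem' := by
        simp only [Set.mem_ofPred_eq, map_zero]
        exact continuous_const
      smul_mem' := fun c _ ha => by
        simp only [Set.mem_ofPred_eq, map_smul]
        exact Continuous.const_smul ha c }
  have hS : IsClosed (S : Set (FockSpace n p t)) := by
    refine isClosed_of_closure_subset fun x hx => ?_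
    refine continuous_of_uniform_approx_of_continuous fun u hu => ?_
    obtain ⟨ε, hε, hεu⟩ := Metric.mem_uniformity_dist.1 hu
    obtain ⟨a, ha, hxa⟩ := Metric.mem_closure_iff.1 hx ε hε
    refine ⟨fun z => weyl z a, ha, fun z => hεu ?_⟩
    rw [dist_eq_norm] at hxa ⊢
    rw [← map_sub]
    exact (weyl_norm_le _ _).trans_lt hxa
  -- On coherent states W_z acts by an explicit continuous formula. Since S is closed and they span
  -- a dense subspace, S is everything.
  have hcoh : ∀ w, coherent w ∈ S := fun w => by
    change Continuous fun z => weyl z (coherent w)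
    simp only [weyl_coherent]
    have h1 : Continuous fun z : CSpace n => z + w := by fun_prop
    have h2 : Continuous fun z : CSpace n =>
        Complex.exp ((inner ℂ z w - inner ℂ w z) / (2 * t)) := by fun_prop
    exact h2.smul (continuous_coherent.comp h1)
  exact mem_of_forall_dual hS (x := x) fun g hg => by
    rw [eq_zero_of_coherent g fun w => hg _ (hcoh w), _root_.zero_apply]

/-- Strong continuity of the orbit holds for every bounded A, as the W_z are contractions; 𝒞₁ asks
for norm continuity. -/
theorem continuous_alpha_apply (A : FockSpace n p t →L[ℂ] FockSpace n p t) (x : FockSpace n p t) :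
    Continuous fun z => alpha z A x := by
  refine continuous_iff_continuousAt.2 fun z₀ => tendsto_iff_norm_sub_tendsto_zero.2 ?_
  refine squeeze_zero (fun _ => norm_nonneg _) (g := fun z => ‖A‖ * ‖weyl (-z) x - weyl (-z₀) x‖ +
    ‖weyl z (A (weyl (-z₀) x)) - weyl z₀ (A (weyl (-z₀) x))‖) (fun z => ?_) ?_
  · simp only [alpha_apply]
    rw [← sub_add_sub_cancel _ (weyl z (A (weyl (-z₀) x)))]
    refine (norm_add_le _ _).trans (add_le_add ?_ le_rfl)
    rw [← map_sub, ← map_sub]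
    exact (weyl_norm_le _ _).trans (A.le_opNorm _)
  · have h1 : Continuous fun z => ‖A‖ * ‖weyl (-z) x - weyl (-z₀) x‖ +
        ‖weyl z (A (weyl (-z₀) x)) - weyl z₀ (A (weyl (-z₀) x))‖ := by
      have := (continuous_weyl x).comp continuous_neg
      have := continuous_weyl (A (weyl (-z₀) x))
      fun_prop
    simpa using h1.tendsto z₀

end

/-! ### Berezin transform, nuclear trace and the vacuum projection -/

section

variable {n : ℕ} {p t : ℝ} [hp : Fact (1 < p)] [ht : Fact (0 < t)]

/-! ### The Berezin transform -/

/-- The functional `x ↦ e^{-|z|²/(2t)} x(z)`. -/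
def weightedEvalCLM (z : CSpace n) : StrongDual ℂ (FockSpace n p t) :=
  ((Real.exp (-‖z‖ ^ 2 / (2 * t)) : ℝ) : ℂ) • evalCLM z

theorem weightedEvalCLM_apply (z : CSpace n) (x : FockSpace n p t) :
    weightedEvalCLM z x = weighted t x z := rfl

/-- The Berezin transform of an operator. -/
def berezin (C : FockSpace n p t →L[ℂ] FockSpace n p t) (z : CSpace n) : ℂ :=
  weighted t (C (coherent z)) z

theorem continuous_berezin (C : FockSpace n p t →L[ℂ] FockSpace n p t) :
    Continuous (berezin C) :=
  (continuous_wt t).mul (continuous_iff_continuousAt.2 fun z =>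
    tendsto_eval ((C.continuous.comp continuous_coherent).tendsto z) tendsto_id)

theorem exists_berezin_bound (n : ℕ) (p t : ℝ) [hp : Fact (1 < p)] [ht : Fact (0 < t)] :
    ∃ A : ℝ, 0 ≤ A ∧ ∀ (C : FockSpace n p t →L[ℂ] FockSpace n p t) (z : CSpace n),
      ‖berezin C z‖ ≤ A * ‖C‖ := by
  obtain ⟨A, hA, h⟩ := exists_eval_bound n p t
  refine ⟨A * ‖(constOne : FockSpace n p t)‖, by positivity, fun C z => (h _ z).trans ?_⟩
  calc _ ≤ A * (‖C‖ * ‖(coherent z : FockSpace n p t)‖) := by gcongr; exact C.le_opNorm _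
    _ ≤ A * (‖C‖ * ‖(constOne : FockSpace n p t)‖) := by gcongr; exact norm_coherent_le z
    _ = _ := by ring

/-- The Berezin transform as a bounded continuous function. -/
def berezinBCF (C : FockSpace n p t →L[ℂ] FockSpace n p t) : CSpace n →ᵇ ℂ :=
  .ofNormedAddCommGroup (berezin C) (continuous_berezin C)
    ((exists_berezin_bound n p t).choose * ‖C‖) ((exists_berezin_bound n p t).choose_spec.2 C)

theorem berezinBCF_apply (C : FockSpace n p t →L[ℂ] FockSpace n p t) (z : CSpace n) :
    berezinBCF C z = berezin C z := rfl

theorem weighted_weyl (w z : CSpace n) (x : FockSpace n p t) : weighted t (weyl w x) z =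
    Complex.exp ((inner ℂ w z - inner ℂ z w) / (2 * t)) * weighted t x (z - w) := by
  rw [← weyl_neg_apply_zero, weyl_weyl, FockSpace.smul_apply, ← weyl_neg_apply_zero, neg_sub,
    neg_add_eq_sub, inner_neg_left, inner_neg_right, sub_neg_eq_add, neg_add_eq_sub]

/-- The phase from moving the coherent state cancels the phase from moving the evaluation point. -/
theorem berezin_alpha (w z : CSpace n) (C : FockSpace n p t →L[ℂ] FockSpace n p t) :
    berezin (alpha w C) z = berezin C (z - w) := by
  rw [berezin, alpha_apply, weighted_weyl, weyl_coherent, map_smul, berezin, neg_add_eq_sub]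
  have : ∀ (c : ℂ) (x : FockSpace n p t) (v : CSpace n),
      weighted t (c • x : FockSpace n p t) v = c * weighted t x v := fun c x v => by
    simp only [weighted, FockSpace.smul_apply]; ring
  rw [this, ← mul_assoc, ← Complex.exp_add, inner_neg_left, inner_neg_right, sub_neg_eq_add,
    ← add_div, neg_add_eq_sub, sub_add_sub_cancel, sub_self, zero_div, Complex.exp_zero, one_mul]

/-- The Berezin transform is injective. -/
theorem eq_zero_of_berezin (C : FockSpace n p t →L[ℂ] FockSpace n p t)
    (h : ∀ z, berezin C z = 0) : C = 0 := by
  have hker : ∀ a : CSpace n, C (expKernel a) a = 0 := fun a => by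
    have h1 : C (coherent a) a = 0 := by
      have := h a
      rw [berezin, weighted, mul_eq_zero] at this
      exact this.resolve_left (by exact_mod_cast (Real.exp_pos _).ne')
    rw [expKernel_eq_smul, map_smul, FockSpace.smul_apply, h1, mul_zero]
  -- Polarization: (C K_a)(b) is antiholomorphic in a and holomorphic in b, so this function of s is
  -- entire. For real s it is evaluated on the diagonal, where it vanishes.
  have hline : ∀ m d : CSpace n, ∀ s : ℂ, C (expKernel (m + star s • d)) (m + s • d) = 0 := by
    intro m d
    set g : ℂ → ℂ := fun s => C (expKernel (m + star s • d)) (m + s • d) with hg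
    have hdiff : Differentiable ℂ g := by
      intro s₀
      have h1 : HasDerivAt (fun s : ℂ => C (expKernel (m + star s • d)))
          (C (expKernelDeriv (m + star s₀ • d) d)) s₀ :=
        C.hasFDerivAt.comp_hasDerivAt s₀ (hasDerivAt_expKernel m d s₀)
      have h2 : DifferentiableAt ℂ (fun s : ℂ => C (expKernel (m + star s₀ • d)) (m + s • d)) s₀ :=
        ((C (expKernel (m + star s₀ • d))).differentiable _).comp s₀ (by fun_prop)
      -- The difference quotient splits into the change of the kernel, evaluated at a moving point,
      -- and the change of the point with the kernel fixed; joint continuity of evaluation handles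
      -- the first.
      have h3 := hasDerivAt_iff_tendsto_slope.1 h1
      have hline : Continuous fun s : ℂ => m + s • d := by fun_prop
      have h4 := tendsto_eval h3 ((hline.tendsto s₀).mono_left nhdsWithin_le_nhds)
      have h5 := hasDerivAt_iff_tendsto_slope.1 h2.hasDerivAt
      refine (hasDerivAt_iff_tendsto_slope.2 ((h4.add h5).congr fun s => ?_)).differentiableAt
      simp only [slope_def_field, slope_def_module, FockSpace.smul_apply, FockSpace.sub_apply, hg]
      rw [div_eq_inv_mul, div_eq_inv_mul, ← mul_add, sub_add_sub_cancel]
    have hreal : ∀ r : ℝ, g r = 0 := fun r => by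
      have : star (r : ℂ) = r := Complex.conj_ofReal r
      rw [hg]
      simp only [this]
      exact hker _
    have hfreq : ∃ᶠ s in 𝓝[≠] (0 : ℂ), g s = 0 := by
      have h6 : Tendsto (fun r : ℝ => (r : ℂ)) (𝓝[≠] 0) (𝓝[≠] 0) := by
        refine tendsto_nhdsWithin_iff.2 ⟨?_, ?_⟩
        · exact (by simpa using Complex.continuous_ofReal.tendsto 0 :
            Tendsto (fun r : ℝ => (r : ℂ)) (𝓝 0) (𝓝 0)).mono_left nhdsWithin_le_nhds
        · filter_upwards [self_mem_nhdsWithin] with r hr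
          simpa using hr
      exact h6.frequently (Eventually.of_forall hreal).frequently
    intro s
    have h7 := (Complex.analyticOnNhd_univ_iff_differentiable.2 hdiff).eqOn_zero_of_preconnected_of_frequently_eq_zero
      isPreconnected_univ (Set.mem_univ 0) hfreq
    exact h7 (Set.mem_univ s)
  refine eq_zero_of_coherent C fun a => ?_
  rw [coherent_eq_smul, map_smul]
  suffices C (expKernel a) = 0 by rw [this, smul_zero]
  ext b
  -- With m = (a+b)/2, d = (b-a)/(2i) and s = i, the two arguments become a and b, which are
  -- arbitrary.
  have h1 := hline ((1 / 2 : ℂ) • (a + b)) ((1 / (2 * Complex.I)) • (b - a)) Complex.I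
  have h2 : (1 / 2 : ℂ) • (a + b) + star Complex.I • (1 / (2 * Complex.I)) • (b - a) = a := by
    have : star Complex.I * (1 / (2 * Complex.I)) = -(1 / 2) := by
      rw [Complex.star_def, Complex.conj_I]; field_simp
    rw [smul_smul, this]
    module
  have h3 : (1 / 2 : ℂ) • (a + b) + Complex.I • (1 / (2 * Complex.I)) • (b - a) = b := by
    have : Complex.I * (1 / (2 * Complex.I)) = 1 / 2 := by field_simp
    rw [smul_smul, this]
    module
  rw [h2, h3] at h1
  rw [h1, FockSpace.zero_apply]

theorem ext_berezin {C D : FockSpace n p t →L[ℂ] FockSpace n p t}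
    (h : ∀ z, berezin C z = berezin D z) : C = D := by
  refine sub_eq_zero.1 (eq_zero_of_berezin _ fun z => ?_)
  have : berezin (C - D) z = berezin C z - berezin D z := by
    simp only [berezin, ← weightedEvalCLM_apply, _root_.sub_apply, map_sub]
  rw [this, h, sub_self]

theorem weighted_coherent_mul (a w : CSpace n) :
    weighted t (coherent w : FockSpace n p t) a * weighted t (coherent a : FockSpace n p t) w =
      Real.exp (-‖w - a‖ ^ 2 / t) := by
  have ht' : (t : ℂ) ≠ 0 := by exact_mod_cast ht.out.ne'
  have h' : ∀ v : CSpace n, (‖v‖ : ℂ) ^ 2 = (inner ℂ v v : ℂ) := fun v =>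
    (inner_self_eq_norm_sq_to_K (𝕜 := ℂ) v).symm
  simp only [weighted, coherent_apply, normalizedKernel]
  push_cast
  rw [← Complex.exp_add, ← Complex.exp_add, ← Complex.exp_add]
  congr 1
  simp only [h', inner_sub_left, inner_sub_right]
  field_simp
  ring

/-- The Berezin transform of a Toeplitz operator is the convolution of its symbol with the
Gaussian density. -/
theorem berezin_toeplitz (f : CSpace n →ᵇ ℂ) (z : CSpace n) :
    berezin (toeplitz p t f) z = ∫ w, (gaussianDensity n t w : ℂ) * f (z + w) := by
  rw [berezin, ← weightedEvalCLM_apply, dual_toeplitz, ← integral_const_mul,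
    ← integral_add_left_eq_self _ z]
  refine integral_congr_ae (Eventually.of_forall fun w => ?_)
  simp only [coherentCoeff, weightedEvalCLM_apply, weighted_coherent_mul, gaussianDensity, normConst]
  rw [add_sub_cancel_left]
  push_cast
  ring

/-! ### Gaussian averages -/

theorem integrable_gaussian_smul {E : Type*} [NormedAddCommGroup E] [NormedSpace ℂ E]
    {v : CSpace n → E} (hv : Continuous v) {B : ℝ} (hB : ∀ z, ‖v z‖ ≤ B) :
    Integrable fun w => (gaussianDensity n t w : ℂ) • v w :=
  (integrable_gaussianDensity n ht.out).ofReal.smul_bdd B hv.aestronglyMeasurable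
    (Eventually.of_forall hB)

/-- `T_{C~} = γ ∗ C`, where `C~` is the Berezin transform of `C`, and `γ` is the Gaussian density. -/
theorem toeplitz_berezin_apply (C : FockSpace n p t →L[ℂ] FockSpace n p t) (x : FockSpace n p t) :
    toeplitz p t (berezinBCF C) x = ∫ w, (gaussianDensity n t w : ℂ) • alpha w C x := by
  have hi : ∀ x, Integrable fun w => (gaussianDensity n t w : ℂ) • alpha w C x := fun x =>
    integrable_gaussian_smul (continuous_alpha_apply C x) fun w => alpha_apply_norm_le w C x
  -- The average is formed vector by vector, because w ↦ α_w(C) need not be norm continuous here.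
  let S : FockSpace n p t →L[ℂ] FockSpace n p t := LinearMap.mkContinuous
    { toFun := fun x => ∫ w, (gaussianDensity n t w : ℂ) • alpha w C x
      map_add' := fun x y => by
        rw [← integral_add (hi x) (hi y)]
        simp only [map_add, smul_add]
      map_smul' := fun c x => by
        rw [RingHom.id_apply, ← integral_smul]
        simp only [map_smul, smul_comm c] } ‖C‖ fun x => by
    have h1 := norm_integral_le_of_norm_le (μ := (volume : Measure (CSpace n)))
      ((integrable_gaussianDensity n ht.out).mul_const (‖C‖ * ‖x‖))
      (f := fun w => (gaussianDensity n t w : ℂ) • alpha w C x) (Eventually.of_forall fun w => by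
        rw [norm_smul, Complex.norm_real, Real.norm_of_nonneg (gaussianDensity_pos ht.out w).le]
        exact mul_le_mul_of_nonneg_left (alpha_apply_norm_le w C x)
          (gaussianDensity_pos ht.out w).le)
    rw [integral_mul_const, integral_gaussianDensity n ht.out, one_mul] at h1
    exact h1
  -- Both operators have Berezin transform γ ∗ C~, and the Berezin transform is injective.
  have hS : toeplitz p t (berezinBCF C) = S := by
    refine ext_berezin fun z => ?_
    rw [berezin_toeplitz, berezin, ← weightedEvalCLM_apply]
    change _ = weightedEvalCLM z (∫ w, (gaussianDensity n t w : ℂ) • alpha w C (coherent z))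
    rw [← (weightedEvalCLM z).integral_comp_comm (hi _), ← integral_neg_eq_self]
    refine integral_congr_ae (Eventually.of_forall fun w => ?_)
    simp only [map_smul, smul_eq_mul, weightedEvalCLM_apply, gaussianDensity_neg, berezinBCF_apply]
    rw [← sub_eq_add_neg, ← berezin_alpha]
    rfl
  rw [hS]
  rfl

/-! ### The nuclear trace -/

theorem hasSum_of_eq {E : Type*} [AddCommMonoid E] [TopologicalSpace E] {f g : ℕ → E} {a : E}
    (h : HasSum g a) (e : ∀ j, f j = g j) : HasSum f a :=
  funext e ▸ h

/-- Termwise integration under summable L¹ norms. It carries formulas for rank one operators to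
nuclear operators. -/
theorem hasSum_integral_of_hasSum {α : Type*} [MeasurableSpace α] {μ : Measure α}
    {F : ℕ → α → ℂ} {G : α → ℂ} (hF : ∀ j, Integrable (F j) μ)
    (hs : Summable fun j => ∫ a, ‖F j a‖ ∂μ) (hG : ∀ a, HasSum (fun j => F j a) (G a)) :
    Integrable G μ ∧ HasSum (fun j => ∫ a, F j a ∂μ) (∫ a, G a ∂μ) := by
  have hG' : ∀ a, ∑' j, F j a = G a := fun a => (hG a).tsum_eq
  have h := hasSum_integral_of_summable_integral_norm hF hs
  simp only [hG'] at h
  refine ⟨⟨?_, ?_⟩, h⟩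
  · refine aestronglyMeasurable_of_tendsto_ae atTop (f := fun N a => ∑ j ∈ Finset.range N, F j a)
      (fun N => ?_) (Eventually.of_forall fun a => (hG a).tendsto_sum_nat)
    exact Finset.aestronglyMeasurable_fun_sum _ fun j _ => (hF j).1
  · have h1 : ∫⁻ a, ‖G a‖ₑ ∂μ ≤ ∑' j, ∫⁻ a, ‖F j a‖ₑ ∂μ := by
      rw [← lintegral_tsum fun j => (hF j).1.enorm]
      refine lintegral_mono fun a => ?_
      rw [← hG' a]
      exact enorm_tsum_le_tsum_enorm
    refine h1.trans_lt ?_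
    have h2 : ∀ j, ∫⁻ a, ‖F j a‖ₑ ∂μ = ENNReal.ofReal (∫ a, ‖F j a‖ ∂μ) := fun j => by
      rw [ofReal_integral_norm_eq_lintegral_enorm (hF j)]
    simp only [h2]
    rw [← ENNReal.ofReal_tsum_of_nonneg (fun j => integral_nonneg fun _ => norm_nonneg _) hs]
    exact ENNReal.ofReal_lt_top

section Nuclear

variable {X : Type*} [NormedAddCommGroup X] [NormedSpace ℂ X]

theorem isNuclearRep_smulRight (y : StrongDual ℂ X) (x : X) :
    IsNuclearRep (y.smulRight x) (fun j => if j = 0 then y else 0, fun _ => x) := by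
  constructor
  · refine summable_of_ne_finset_zero (s := {0}) fun j hj => ?_
    simp only [Finset.mem_singleton] at hj
    simp [hj]
  · convert hasSum_single (f := fun j : ℕ => (if j = 0 then y else 0 : StrongDual ℂ X).smulRight x)
      0 ?_ using 1
    · simp
    · intro j hj
      ext
      simp [hj]

theorem IsNuclearRep.comp_left {B : X →L[ℂ] X} {r} (h : IsNuclearRep B r) (C : X →L[ℂ] X) :
    IsNuclearRep (C ∘L B) (r.1, fun j => C (r.2 j)) := by
  constructor
  · refine Summable.of_nonneg_of_le (fun _ => by positivity) (fun j => ?_) (h.1.mul_left ‖C‖)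
    calc _ ≤ ‖r.1 j‖ * (‖C‖ * ‖r.2 j‖) := by gcongr; exact C.le_opNorm _
      _ = _ := by ring
  · have := h.2.mapL (ContinuousLinearMap.compL ℂ X X X C)
    exact hasSum_of_eq this fun j => by ext x; simp

theorem IsNuclearRep.comp_right {B : X →L[ℂ] X} {r} (h : IsNuclearRep B r) (C : X →L[ℂ] X) :
    IsNuclearRep (B ∘L C) (fun j => (r.1 j).comp C, r.2) := by
  constructor
  · refine Summable.of_nonneg_of_le (fun _ => by positivity) (fun j => ?_) (h.1.mul_left ‖C‖)
    calc _ ≤ ‖r.1 j‖ * ‖C‖ * ‖r.2 j‖ := by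
          gcongr; exact ContinuousLinearMap.opNorm_comp_le _ _
      _ = _ := by ring
  · have := h.2.mapL ((ContinuousLinearMap.compL ℂ X X X).flip C)
    exact hasSum_of_eq this fun j => by ext x; simp

theorem IsNuclearRep.summable_apply {B : X →L[ℂ] X} {r} (h : IsNuclearRep B r) (C : X →L[ℂ] X) :
    Summable fun j => ‖r.1 j (C (r.2 j))‖ := by
  refine Summable.of_nonneg_of_le (fun _ => norm_nonneg _) (fun j => ?_) (h.1.mul_left ‖C‖)
  calc _ ≤ ‖r.1 j‖ * (‖C‖ * ‖r.2 j‖) :=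
        ((r.1 j).le_opNorm _).trans (by gcongr; exact C.le_opNorm _)
    _ = _ := by ring

/-- The functional `C ↦ ∑ y_j(C x_j)` given by a nuclear representation. -/
def IsNuclearRep.pairing {B : X →L[ℂ] X} {r} (h : IsNuclearRep B r) : StrongDual ℂ (X →L[ℂ] X) :=
  LinearMap.mkContinuous
    { toFun := fun C => ∑' j, r.1 j (C (r.2 j))
      map_add' := fun C D => by
        rw [← (h.summable_apply C).of_norm.tsum_add (h.summable_apply D).of_norm]
        simp
      map_smul' := fun c C => by
        rw [RingHom.id_apply, smul_eq_mul, ← tsum_mul_left]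
        simp } (∑' j, ‖r.1 j‖ * ‖r.2 j‖) fun C => by
    refine (norm_tsum_le_tsum_norm (h.summable_apply C)).trans ?_
    rw [mul_comm, ← tsum_mul_left]
    refine (h.summable_apply C).tsum_le_tsum (fun j => ?_) (h.1.mul_left ‖C‖)
    calc _ ≤ ‖r.1 j‖ * (‖C‖ * ‖r.2 j‖) :=
          ((r.1 j).le_opNorm _).trans (by gcongr; exact C.le_opNorm _)
      _ = _ := by ring

theorem IsNuclearRep.hasSum_pairing {B : X →L[ℂ] X} {r} (h : IsNuclearRep B r) (C : X →L[ℂ] X) :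
    HasSum (fun j => r.1 j (C (r.2 j))) (h.pairing C) :=
  (h.summable_apply C).of_norm.hasSum

end Nuclear

theorem summable_integral_norm_coherentCoeff {A : FockSpace n p t →L[ℂ] FockSpace n p t} {r}
    (h : IsNuclearRep A r) : Summable fun j => ∫ w, ‖coherentCoeff (r.1 j) (r.2 j) w‖ := by
  obtain ⟨C, hC0, hC⟩ := exists_coherentCoeff_bound n p t
  exact Summable.of_nonneg_of_le (fun _ => integral_nonneg fun _ => norm_nonneg _)
    (fun j => (hC _ _).2) (h.1.mul_left C)

theorem hasSum_coherentCoeff {A : FockSpace n p t →L[ℂ] FockSpace n p t} {r}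
    (h : IsNuclearRep A r) (w : CSpace n) :
    HasSum (fun j => coherentCoeff (r.1 j) (r.2 j) w) (berezin A w) := by
  have h1 := (h.2.mapL (ContinuousLinearMap.apply ℂ _ (coherent w))).mapL (weightedEvalCLM w)
  refine hasSum_of_eq h1 fun j => ?_
  rw [ContinuousLinearMap.apply_apply, ContinuousLinearMap.smulRight_apply, map_smul]
  rfl

theorem IsNuclear.integrable_berezin {A : FockSpace n p t →L[ℂ] FockSpace n p t}
    (h : IsNuclear A) : Integrable (berezin A) := by
  obtain ⟨r, hr⟩ := h
  exact (hasSum_integral_of_hasSum (fun j => integrable_coherentCoeff _ _)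
    (summable_integral_norm_coherentCoeff hr) (hasSum_coherentCoeff hr)).1

/-- Sum the resolution of the identity over the representation. The value depends on A only, through
its Berezin transform, so no approximation property has to be invoked. -/
theorem IsNuclearRep.hasSum_trace {A : FockSpace n p t →L[ℂ] FockSpace n p t} {r}
    (h : IsNuclearRep A r) :
    HasSum (fun j => r.1 j (r.2 j)) (normConst n t * ∫ w, berezin A w) := by
  have := (hasSum_integral_of_hasSum (fun j => integrable_coherentCoeff _ _)
    (summable_integral_norm_coherentCoeff h) (hasSum_coherentCoeff h)).2.mul_left (normConst n t)
  simpa only [← dual_eq_integral] using this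

/-- The nuclear trace can be computed from every nuclear representation. -/
theorem nuclearTrace_eq {A : FockSpace n p t →L[ℂ] FockSpace n p t} {r}
    (h : IsNuclearRep A r) : nuclearTrace A = ∑' j, r.1 j (r.2 j) := by
  have hA : IsNuclear A := ⟨r, h⟩
  rw [nuclearTrace, dif_pos hA, h.hasSum_trace.tsum_eq]
  exact (IsNuclearRep.hasSum_trace hA.choose_spec).tsum_eq

theorem IsNuclearRep.nuclearTrace_comp_left {B : FockSpace n p t →L[ℂ] FockSpace n p t} {r}
    (h : IsNuclearRep B r) (C : FockSpace n p t →L[ℂ] FockSpace n p t) :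
    nuclearTrace (C ∘L B) = h.pairing C := by
  rw [nuclearTrace_eq (h.comp_left C)]
  rfl

theorem IsNuclearRep.nuclearTrace_comp_right {B : FockSpace n p t →L[ℂ] FockSpace n p t} {r}
    (h : IsNuclearRep B r) (C : FockSpace n p t →L[ℂ] FockSpace n p t) :
    nuclearTrace (B ∘L C) = h.pairing C := by
  rw [nuclearTrace_eq (h.comp_right C)]
  rfl

theorem IsNuclearRep.opConv_eq {A : FockSpace n p t →L[ℂ] FockSpace n p t} {r}
    (h : IsNuclearRep A r) (B : FockSpace n p t →L[ℂ] FockSpace n p t) (z : CSpace n) :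
    opConv A B z = h.pairing (alpha z (parityConj B)) :=
  h.nuclearTrace_comp_right _

theorem IsNuclearRep.opConv_parityConj {B : FockSpace n p t →L[ℂ] FockSpace n p t} {r}
    (h : IsNuclearRep B r) (A : FockSpace n p t →L[ℂ] FockSpace n p t) (z : CSpace n) :
    opConv B (parityConj A) z = h.pairing (alpha z A) := by
  rw [h.opConv_eq, parityConj_parityConj]

theorem pairing_smulRight (y : StrongDual ℂ (FockSpace n p t)) (x : FockSpace n p t)
    (C : FockSpace n p t →L[ℂ] FockSpace n p t) :
    (isNuclearRep_smulRight y x).pairing C = y (C x) := by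
  refine ((isNuclearRep_smulRight y x).hasSum_pairing C).unique ?_
  exact hasSum_single (f := fun j : ℕ => (if j = 0 then y else 0 : StrongDual ℂ _) (C x)) 0
    fun j hj => by simp [hj]

/-! ### The vacuum projection -/

/-- The rank one operator `1 ⊗ δ₀`. -/
def vacuum (n : ℕ) (p t : ℝ) [Fact (1 < p)] [Fact (0 < t)] :
    FockSpace n p t →L[ℂ] FockSpace n p t :=
  (evalCLM 0).smulRight constOne

theorem isNuclear_vacuum : IsNuclear (vacuum n p t) := ⟨_, isNuclearRep_smulRight _ _⟩

theorem alpha_vacuum (z : CSpace n) (x : FockSpace n p t) :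
    alpha z (vacuum n p t) x = weighted t x z • coherent z := by
  rw [alpha_apply, vacuum, ContinuousLinearMap.smulRight_apply, evalCLM_apply, weyl_neg_apply_zero,
    map_smul]
  rfl

theorem parity_coherent_neg (z : CSpace n) :
    parity (coherent (-z) : FockSpace n p t) = coherent z := by
  ext w
  rw [parity_apply, coherent_apply, coherent_apply, normalizedKernel, inner_neg_neg, norm_neg,
    normalizedKernel]

/-- The trace against 1 ⊗ δ₀ is evaluation at 0 of the operator applied to 1; unwinding α_z and the
parity moves both to the point z. -/
theorem opConv_vacuum (C : FockSpace n p t →L[ℂ] FockSpace n p t) (z : CSpace n) :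
    opConv (vacuum n p t) C z = berezin C z := by
  have h := (isNuclearRep_smulRight (evalCLM 0) (constOne : FockSpace n p t)).opConv_eq C z
  rw [pairing_smulRight] at h
  refine h.trans ?_
  rw [evalCLM_apply, alpha_apply, parityConj_apply]
  change weyl z (parity (C (parity (coherent (-z))))) 0 = _
  rw [parity_coherent_neg]
  have h1 := weyl_neg_apply_zero (-z) (parity (C (coherent z)))
  rw [neg_neg] at h1
  rw [h1, weighted, parity_apply, neg_neg, norm_neg, berezin, weighted]

theorem IsNuclear.opConv_parityConj_vacuum {B : FockSpace n p t →L[ℂ] FockSpace n p t}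
    (hB : IsNuclear B) (z : CSpace n) : opConv B (parityConj (vacuum n p t)) z = berezin B z := by
  obtain ⟨r, h⟩ := hB
  rw [h.opConv_parityConj]
  refine (h.hasSum_pairing _).unique ?_
  refine hasSum_of_eq (hasSum_coherentCoeff h z) fun j => ?_
  rw [alpha_vacuum, map_smul, smul_eq_mul, mul_comm]
  rfl

/-- The functions in question are Berezin transforms of nuclear operators, which are integrable.
Thus `vacuum` is an admissible test operator for every p. -/
theorem isConvolvable_vacuum : IsConvolvable (vacuum n p t) := fun _ hB =>
  hB.integrable_berezin.congr (Eventually.of_forall fun z => (hB.opConv_parityConj_vacuum z).symm)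

end

/-! ### The Tauberian theorem for Gaussian averages -/

section

variable {n : ℕ} {p t : ℝ} [ht : Fact (0 < t)]

/-! ### Injectivity of Gaussian averages -/

theorem integrable_exp_linear_gaussian (n : ℕ) (t c : ℝ) [ht : Fact (0 < t)] :
    Integrable fun w : CSpace n => Real.exp (c * ‖w‖ - ‖w‖ ^ 2 / t) := by
  have h := (memLp_gaussian_exp (n := n) ht.out (c / 2) (q := 2) (by norm_num))
  rw [show ENNReal.ofReal 2 = 2 by norm_num] at h
  refine h.integrable_sq.congr (Eventually.of_forall fun w => ?_)
  simp only
  rw [← Real.exp_nat_mul]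
  congr 1
  have := ht.out
  field_simp
  push_cast
  ring

/-- The two-sided Laplace transform of a function with Gaussian decay. -/
theorem differentiable_laplace {u : CSpace n → ℂ} (hu : Continuous u) {B : ℝ}
    (hB : ∀ w, ‖u w‖ ≤ B) (L : CSpace n →L[ℝ] ℝ) :
    Differentiable ℂ fun s : ℂ => ∫ w, Complex.exp (s * L w) *
      (((Real.exp (-‖w‖ ^ 2 / t) : ℝ) : ℂ) * u w) := by
  intro s₀
  have hB0 : 0 ≤ B := (norm_nonneg _).trans (hB 0)
  have hL := L.continuous
  have hexp : ∀ (s : ℂ) (w : CSpace n), ‖Complex.exp (s * L w) *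
      (((Real.exp (-‖w‖ ^ 2 / t) : ℝ) : ℂ) * u w)‖ ≤
      B * Real.exp (‖s‖ * ‖L‖ * ‖w‖ - ‖w‖ ^ 2 / t) := by
    intro s w
    rw [norm_mul, norm_mul, Complex.norm_exp, Complex.norm_real, Real.norm_of_nonneg (Real.exp_pos _).le,
      ← mul_assoc, ← Real.exp_add, mul_comm]
    refine mul_le_mul (hB w) (Real.exp_le_exp.2 ?_) (Real.exp_pos _).le hB0
    have h1 : (s * L w).re ≤ ‖s‖ * ‖L‖ * ‖w‖ := by
      refine (Complex.re_le_norm _).trans ?_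
      rw [norm_mul, Complex.norm_real, mul_assoc]
      gcongr
      exact L.le_opNorm w
    have h2 : -‖w‖ ^ 2 / t = - (‖w‖ ^ 2 / t) := by ring
    linarith
  refine (hasDerivAt_integral_of_dominated_loc_of_deriv_le (𝕜 := ℂ)
    (F' := fun s w => (L w : ℂ) * (Complex.exp (s * L w) *
      (((Real.exp (-‖w‖ ^ 2 / t) : ℝ) : ℂ) * u w)))
    (bound := fun w => ‖L‖ * (B * Real.exp (((‖s₀‖ + 1) * ‖L‖ + 1) * ‖w‖ - ‖w‖ ^ 2 / t)))
    (Metric.ball_mem_nhds s₀ one_pos) ?_ ?_ ?_ ?_ ?_ ?_).2.differentiableAt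
  · exact Eventually.of_forall fun s => Continuous.aestronglyMeasurable (by fun_prop)
  · exact ((integrable_exp_linear_gaussian n t _).const_mul B).mono'
      (Continuous.aestronglyMeasurable (by fun_prop)) (Eventually.of_forall (hexp s₀))
  · exact Continuous.aestronglyMeasurable (by fun_prop)
  · refine Eventually.of_forall fun w s hs => ?_
    have hs' : ‖s‖ ≤ ‖s₀‖ + 1 := by
      have h1 : ‖s - s₀‖ < 1 := by rwa [← dist_eq_norm]
      have h2 := norm_add_le (s - s₀) s₀
      rw [sub_add_cancel] at h2
      linarith
    rw [norm_mul, Complex.norm_real]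
    calc _ ≤ (‖L‖ * Real.exp ‖w‖) * (B * Real.exp ((‖s₀‖ + 1) * ‖L‖ * ‖w‖ - ‖w‖ ^ 2 / t)) := by
          refine mul_le_mul ((L.le_opNorm w).trans ?_) ((hexp s w).trans ?_) (norm_nonneg _)
            (by positivity)
          · gcongr
            linarith [Real.add_one_le_exp ‖w‖]
          · gcongr
      _ = _ := by
          have : ((‖s₀‖ + 1) * ‖L‖ + 1) * ‖w‖ - ‖w‖ ^ 2 / t =
              ‖w‖ + ((‖s₀‖ + 1) * ‖L‖ * ‖w‖ - ‖w‖ ^ 2 / t) := by ring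
          rw [this, Real.exp_add]
          ring
  · exact ((integrable_exp_linear_gaussian n t _).const_mul B).const_mul _
  · refine Eventually.of_forall fun w s _ => ?_
    have h1 := (((hasDerivAt_id s).mul_const (L w : ℂ)).cexp).mul_const
      (((Real.exp (-‖w‖ ^ 2 / t) : ℝ) : ℂ) * u w)
    refine h1.congr_deriv ?_
    simp only [id, one_mul]
    ring

/-- Up to a nonzero factor, a Gaussian convolution at z is thus the two-sided Laplace transform, at
2z/t, of the function damped by e^{-|w|²/t}. -/
theorem gaussianDensity_sub (t : ℝ) (w z : CSpace n) : (gaussianDensity n t (w - z) : ℂ) =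
    ((1 / (Real.pi * t) ^ n * Real.exp (-‖z‖ ^ 2 / t) : ℝ) : ℂ) *
      (Complex.exp (((2 / t) * inner ℝ z w : ℝ)) * ((Real.exp (-‖w‖ ^ 2 / t) : ℝ) : ℂ)) := by
  rw [gaussianDensity, ← Complex.ofReal_exp, ← Complex.ofReal_mul, ← Complex.ofReal_mul,
    Complex.ofReal_inj, mul_assoc, ← Real.exp_add, ← Real.exp_add, norm_sub_sq_real, real_inner_comm]
  congr 2
  ring

/-- A bounded continuous function whose convolution with the Gaussian density vanishes is zero. -/
theorem eq_zero_of_gaussian_average {u : CSpace n → ℂ} (hu : Continuous u) {B : ℝ}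
    (hB : ∀ w, ‖u w‖ ≤ B) (h : ∀ z, ∫ w, (gaussianDensity n t w : ℂ) * u (z + w) = 0) : u = 0 := by
  have ht0 := ht.out
  set v : CSpace n → ℂ := fun w => ((Real.exp (-‖w‖ ^ 2 / t) : ℝ) : ℂ) * u w with hv
  have hvc : Continuous v := by fun_prop
  have hreal : ∀ z : CSpace n, ∫ w, Complex.exp (((2 / t) * inner ℝ z w : ℝ)) * v w = 0 := by
    intro z
    have h1 := h z
    rw [← integral_sub_right_eq_self _ z] at h1
    simp only [add_sub_cancel, gaussianDensity_sub, mul_assoc] at h1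
    rw [integral_const_mul, mul_eq_zero] at h1
    refine h1.resolve_left ?_
    rw [← ne_eq, Complex.ofReal_ne_zero]
    positivity
  -- On each line the Laplace transform is entire in s and vanishes for real s, hence also at s = i,
  -- where it is a Fourier transform.
  have himag : ∀ z : CSpace n,
      ∫ w, Complex.exp (Complex.I * ((2 / t) * inner ℝ z w : ℝ)) * v w = 0 := by
    intro z
    have hd := differentiable_laplace (t := t) hu hB ((2 / t) • innerSL ℝ z)
    have h7 := (Complex.analyticOnNhd_univ_iff_differentiable.2
      hd).eqOn_zero_of_preconnected_of_frequently_eq_zero isPreconnected_univ (Set.mem_univ 0) ?_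
    · exact h7 (Set.mem_univ Complex.I)
    · have h6 : Tendsto (fun r : ℝ => (r : ℂ)) (𝓝[≠] 0) (𝓝[≠] 0) := by
        refine tendsto_nhdsWithin_iff.2 ⟨?_, ?_⟩
        · exact (by simpa using Complex.continuous_ofReal.tendsto 0 :
            Tendsto (fun r : ℝ => (r : ℂ)) (𝓝 0) (𝓝 0)).mono_left nhdsWithin_le_nhds
        · filter_upwards [self_mem_nhdsWithin] with r hr
          simpa using hr
      refine h6.frequently (Eventually.of_forall fun r => ?_).frequently
      rw [← hreal (r • z)]
      refine integral_congr_ae (Eventually.of_forall fun w => ?_)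
      simp only [_root_.smul_apply, innerSL_apply_apply, smul_eq_mul, inner_smul_left, conj_trivial]
      rw [← Complex.ofReal_mul, mul_left_comm r]
  have hint : Integrable v := by
    refine ((integrable_exp_linear_gaussian n t 0).const_mul B).mono' hvc.aestronglyMeasurable
      (Eventually.of_forall fun w => ?_)
    rw [hv, norm_mul, Complex.norm_real, Real.norm_of_nonneg (Real.exp_pos _).le, mul_comm, zero_mul,
      zero_sub, neg_div]
    exact mul_le_mul_of_nonneg_right (hB w) (Real.exp_pos _).le
  have hF : FourierTransform.fourier v = 0 := by
    funext ξ
    rw [Real.fourier_eq']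
    -- The scaling z = -πt ξ turns e^{(2i/t)⟨z,w⟩} into e^{-2πi⟨w,ξ⟩}.
    rw [Pi.zero_apply, ← himag ((-(Real.pi * t)) • ξ)]
    refine integral_congr_ae (Eventually.of_forall fun w => ?_)
    simp only [smul_eq_mul, inner_smul_left, conj_trivial]
    rw [real_inner_comm, mul_comm Complex.I]
    congr 4
    field_simp
  have hv0 := hvc.fourierInv_fourier_eq hint (by rw [hF]; exact integrable_zero _ _ _)
  have hv1 : v = 0 := by
    rw [← hv0, hF]
    funext w
    rw [Real.fourierInv_eq]
    simp
  funext w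
  have := congrFun hv1 w
  rw [hv, Pi.zero_apply, mul_eq_zero] at this
  exact this.resolve_left (by exact_mod_cast (Real.exp_pos _).ne')

/-- If all Gaussian averages of a bounded continuous function lie in a closed subspace, then so do
its values. -/
theorem mem_of_gaussian_average_mem {E : Type*} [NormedAddCommGroup E] [NormedSpace ℂ E]
    [CompleteSpace E] {Q : Submodule ℂ E} (hQ : IsClosed (Q : Set E)) {v : CSpace n → E}
    (hv : Continuous v) {B : ℝ} (hB : ∀ z, ‖v z‖ ≤ B)
    (h : ∀ z, ∫ w, (gaussianDensity n t w : ℂ) • v (z + w) ∈ Q) (z : CSpace n) : v z ∈ Q := by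
  -- A functional g that kills Q reduces the claim to the scalar function g ∘ v, whose Gaussian
  -- average is zero.
  refine mem_of_forall_dual hQ fun g hg => ?_
  have hgB : ∀ z, ‖g (v z)‖ ≤ ‖g‖ * B := fun z =>
    (g.le_opNorm _).trans (by gcongr; exact hB z)
  refine congrFun (eq_zero_of_gaussian_average (t := t) (g.continuous.comp hv) hgB fun z => ?_) z
  have h1 := hg _ (h z)
  have hi : Integrable fun w => (gaussianDensity n t w : ℂ) • v (z + w) :=
    integrable_gaussian_smul (hv.comp (continuous_const_add z)) fun w => hB (z + w)
  rw [← g.integral_comp_comm hi] at h1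
  simpa only [map_smul, smul_eq_mul, Function.comp_apply] using h1

theorem integral_mem_of_isClosed {α E : Type*} [MeasurableSpace α] {μ : Measure α}
    [NormedAddCommGroup E] [NormedSpace ℂ E] [CompleteSpace E] {Q : Submodule ℂ E}
    (hQ : IsClosed (Q : Set E)) {v : α → E} (hi : Integrable v μ) (hv : ∀ a, v a ∈ Q) :
    ∫ a, v a ∂μ ∈ Q := by
  refine mem_of_forall_dual hQ fun g hg => ?_
  rw [← g.integral_comp_comm hi]
  simp [hg _ (hv _)]

end

/-! ### Correspondence between symbol spaces and operator spaces -/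

section

variable {n : ℕ} {p t : ℝ} [hp : Fact (1 < p)] [ht : Fact (0 < t)]

/-! ### Translations of symbols -/

theorem translate_apply (z : CSpace n) (f : CSpace n →ᵇ ℂ) (w : CSpace n) :
    translate z f w = f (w - z) := rfl

theorem translate_zero (f : CSpace n →ᵇ ℂ) : translate 0 f = f := by
  ext w
  rw [translate_apply, sub_zero]

theorem norm_translate_le (z : CSpace n) (f : CSpace n →ᵇ ℂ) : ‖translate z f‖ ≤ ‖f‖ :=
  (BoundedContinuousFunction.norm_le (norm_nonneg _)).2 fun w => f.norm_coe_le_norm (w - z)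

theorem continuous_translate {f : CSpace n →ᵇ ℂ} (hf : f ∈ BUC n) :
    Continuous fun z => translate z f := by
  have hu : UniformContinuous f := hf
  refine Metric.continuous_iff.2 fun z ε hε => ?_
  obtain ⟨δ, hδ, h⟩ := Metric.uniformContinuous_iff.1 hu (ε / 2) (half_pos hε)
  refine ⟨δ, hδ, fun a ha => ?_⟩
  refine lt_of_le_of_lt ((BoundedContinuousFunction.dist_le (half_pos hε).le).2 fun w => ?_)
    (half_lt_self hε)
  refine (h (a := w - a) (b := w - z) ?_).le
  rwa [dist_sub_left]

theorem berezin_toeplitz_sub (f : CSpace n →ᵇ ℂ) (z : CSpace n) :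
    berezin (toeplitz p t f) z = ∫ w, (gaussianDensity n t w : ℂ) * f (z - w) := by
  rw [berezin_toeplitz, ← integral_neg_eq_self]
  simp only [gaussianDensity_neg, sub_eq_add_neg]

/-- Covariance, read off from Berezin transforms: both sides give the translate of γ ∗ f. -/
theorem alpha_toeplitz (z : CSpace n) (f : CSpace n →ᵇ ℂ) :
    alpha z (toeplitz p t f) = toeplitz p t (translate z f) := by
  refine ext_berezin fun w => ?_
  rw [berezin_alpha, berezin_toeplitz, berezin_toeplitz]
  simp only [translate_apply, sub_add_eq_add_sub]

theorem translate_berezin_toeplitz (z : CSpace n) (f : CSpace n →ᵇ ℂ) :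
    translate z (berezinBCF (toeplitz p t f)) = berezinBCF (toeplitz p t (translate z f)) := by
  ext w
  rw [translate_apply, berezinBCF_apply, berezinBCF_apply, ← alpha_toeplitz, berezin_alpha]

theorem berezin_parityConj (C : FockSpace n p t →L[ℂ] FockSpace n p t) (z : CSpace n) :
    berezin (parityConj C) z = berezin C (-z) := by
  rw [berezin, parityConj_apply, ← parity_coherent_neg, parity_parity, weighted, parity_apply, berezin,
    weighted, norm_neg]

/-- The reflected symbol `w ↦ f(-w)`. -/
def reflect (f : CSpace n →ᵇ ℂ) : CSpace n →ᵇ ℂ := f.compContinuous ⟨fun w => -w, continuous_neg⟩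

theorem reflect_apply (f : CSpace n →ᵇ ℂ) (w : CSpace n) : reflect f w = f (-w) := rfl

theorem parityConj_toeplitz (f : CSpace n →ᵇ ℂ) :
    parityConj (toeplitz p t f) = toeplitz p t (reflect f) := by
  refine ext_berezin fun w => ?_
  rw [berezin_parityConj, berezin_toeplitz, berezin_toeplitz_sub]
  simp only [reflect_apply, neg_sub, neg_add_eq_sub]

/-! ### The Tauberian step for symbols and for operators -/

/-- Uniform continuity of f makes the orbit norm continuous, so γ ∗ f is a Bochner integral in the
space of symbols and not merely a pointwise one. -/
theorem integral_gaussian_translate {f : CSpace n →ᵇ ℂ} (hf : f ∈ BUC n) (z : CSpace n) :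
    ∫ w, (gaussianDensity n t w : ℂ) • translate (z + w) f =
      translate z (berezinBCF (toeplitz p t f)) := by
  ext x
  have hi : Integrable fun w => (gaussianDensity n t w : ℂ) • translate (z + w) f :=
    integrable_gaussian_smul ((continuous_translate hf).comp (continuous_const_add z))
      fun w => norm_translate_le (z + w) f
  rw [← BoundedContinuousFunction.evalCLM_apply ℂ x (∫ _, _),
    ← (BoundedContinuousFunction.evalCLM ℂ x).integral_comp_comm hi, translate_apply,
    berezinBCF_apply, berezin_toeplitz_sub]
  simp only [map_smul, BoundedContinuousFunction.evalCLM_apply, translate_apply, smul_eq_mul, sub_sub]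

theorem mem_of_translate_berezin_mem {Q : Submodule ℂ (CSpace n →ᵇ ℂ)}
    (hQ : IsClosed (Q : Set (CSpace n →ᵇ ℂ))) {f : CSpace n →ᵇ ℂ} (hf : f ∈ BUC n)
    (h : ∀ z, translate z (berezinBCF (toeplitz p t f)) ∈ Q) : f ∈ Q := by
  have := mem_of_gaussian_average_mem (t := t) hQ (continuous_translate hf)
    (fun z => norm_translate_le z f)
    (fun z => by rw [integral_gaussian_translate (p := p) hf]; exact h z) 0
  rwa [translate_zero] at this

/-- For C in 𝒞₁ the strong identity T_{C~} = γ ∗ C becomes an identity of norm convergent integrals.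
-/
theorem integral_gaussian_alpha {C : FockSpace n p t →L[ℂ] FockSpace n p t} (hC : C ∈ C1 n p t)
    (z : CSpace n) : ∫ w, (gaussianDensity n t w : ℂ) • alpha (z + w) C =
      alpha z (toeplitz p t (berezinBCF C)) := by
  have hi : Integrable fun w => (gaussianDensity n t w : ℂ) • alpha w C :=
    integrable_gaussian_smul hC fun w => norm_alpha_le w C
  have h0 : ∫ w, (gaussianDensity n t w : ℂ) • alpha w C = toeplitz p t (berezinBCF C) := by
    ext1 x
    rw [toeplitz_berezin_apply, ContinuousLinearMap.integral_apply hi]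
    simp only [_root_.smul_apply]
  rw [← h0, ← alphaCLM_apply, ← (alphaCLM z).integral_comp_comm hi]
  simp only [map_smul, alphaCLM_apply, alpha_alpha]

theorem mem_of_alpha_toeplitz_berezin_mem
    {Q : Submodule ℂ (FockSpace n p t →L[ℂ] FockSpace n p t)}
    (hQ : IsClosed (Q : Set (FockSpace n p t →L[ℂ] FockSpace n p t)))
    {C : FockSpace n p t →L[ℂ] FockSpace n p t} (hC : C ∈ C1 n p t)
    (h : ∀ z, alpha z (toeplitz p t (berezinBCF C)) ∈ Q) : C ∈ Q := by
  have := mem_of_gaussian_average_mem (t := t) hQ hC (fun z => norm_alpha_le z C)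
    (fun z => by rw [integral_gaussian_alpha hC]; exact h z) 0
  rwa [alpha_zero] at this

/-! ### Convolution of a nuclear operator with an operator -/

theorem IsNuclearRep.continuous_pairing_alpha {A : FockSpace n p t →L[ℂ] FockSpace n p t} {r}
    (h : IsNuclearRep A r) (B : FockSpace n p t →L[ℂ] FockSpace n p t) :
    Continuous fun z => h.pairing (alpha z B) := by
  refine continuous_tsum (u := fun j => ‖B‖ * (‖r.1 j‖ * ‖r.2 j‖))
    (fun j => (r.1 j).continuous.comp (continuous_alpha_apply B (r.2 j))) (h.1.mul_left ‖B‖)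
    fun j z => ?_
  calc _ ≤ ‖r.1 j‖ * (‖B‖ * ‖r.2 j‖) :=
        ((r.1 j).le_opNorm _).trans (by gcongr; exact alpha_apply_norm_le z B _)
    _ = _ := by ring

/-- The convolution with a nuclear operator, as a bounded linear map from operators to functions. -/
def IsNuclearRep.opConvCLM {A : FockSpace n p t →L[ℂ] FockSpace n p t} {r}
    (h : IsNuclearRep A r) : (FockSpace n p t →L[ℂ] FockSpace n p t) →L[ℂ] (CSpace n →ᵇ ℂ) :=
  have hb : ∀ (B : FockSpace n p t →L[ℂ] FockSpace n p t) (z : CSpace n),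
      ‖h.pairing (alpha z (parityConj B))‖ ≤ ‖h.pairing‖ * ‖B‖ := fun B z =>
    (h.pairing.le_opNorm _).trans (by
      gcongr
      exact (norm_alpha_le _ _).trans (norm_parityConj_le B))
  LinearMap.mkContinuous
    { toFun := fun B => .ofNormedAddCommGroup (fun z => h.pairing (alpha z (parityConj B)))
        (h.continuous_pairing_alpha _) _ (hb B)
      map_add' := fun B D => by
        ext z
        have : parityConj (B + D) = parityConj B + parityConj D := by
          ext1 x; simp [parityConj_apply]
        simp [this, ← alphaCLM_apply]
      map_smul' := fun c B => by
        ext z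
        have : parityConj (c • B) = c • parityConj B := by
          ext1 x; simp [parityConj_apply]
        simp [this, ← alphaCLM_apply] } ‖h.pairing‖ fun B =>
    BoundedContinuousFunction.norm_ofNormedAddCommGroup_le _ (by positivity) (hb B)

theorem IsNuclearRep.opConvCLM_apply {A : FockSpace n p t →L[ℂ] FockSpace n p t} {r}
    (h : IsNuclearRep A r) (B : FockSpace n p t →L[ℂ] FockSpace n p t) (z : CSpace n) :
    h.opConvCLM B z = opConv A B z :=
  (h.opConv_eq B z).symm

/-- The trace duality between Toeplitz quantization and the Berezin transform, summed from the rank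
one case. -/
theorem IsNuclearRep.pairing_toeplitz {A : FockSpace n p t →L[ℂ] FockSpace n p t} {r}
    (h : IsNuclearRep A r) (g : CSpace n →ᵇ ℂ) :
    h.pairing (toeplitz p t g) = normConst n t * ∫ w, g w * berezin A w := by
  have h1 := hasSum_integral_of_hasSum (F := fun j w => g w * coherentCoeff (r.1 j) (r.2 j) w)
    (G := fun w => g w * berezin A w)
    (fun j => integrable_bcf_mul (integrable_coherentCoeff _ _) g) ?_
    (fun w => (hasSum_coherentCoeff h w).mul_left (g w))
  · refine (h.hasSum_pairing _).unique (hasSum_of_eq (h1.2.mul_left (normConst n t)) fun j => ?_)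
    exact dual_toeplitz g _ _
  · refine Summable.of_nonneg_of_le (fun _ => integral_nonneg fun _ => norm_nonneg _) (fun j => ?_)
      ((summable_integral_norm_coherentCoeff h).mul_left ‖g‖)
    rw [← integral_const_mul]
    refine integral_mono (integrable_bcf_mul (integrable_coherentCoeff _ _) g).norm
      ((integrable_coherentCoeff _ _).norm.const_mul _) fun w => ?_
    simp only [norm_mul]
    gcongr
    exact g.norm_coe_le_norm w

/-- The convolution `a ∗ f` of an integrable function and a uniformly continuous symbol. -/
def convSymbol (a : CSpace n → ℂ) (f : CSpace n →ᵇ ℂ) : CSpace n →ᵇ ℂ := ∫ w, a w • translate w f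

theorem integrable_smul_translate {a : CSpace n → ℂ} (ha : Integrable a) {f : CSpace n →ᵇ ℂ}
    (hf : f ∈ BUC n) : Integrable fun w => a w • translate w f :=
  ha.smul_bdd ‖f‖ (continuous_translate hf).aestronglyMeasurable
    (Eventually.of_forall fun w => norm_translate_le w f)

theorem convSymbol_apply {a : CSpace n → ℂ} (ha : Integrable a) {f : CSpace n →ᵇ ℂ}
    (hf : f ∈ BUC n) (z : CSpace n) : convSymbol a f z = ∫ w, a w * f (z - w) := by
  rw [convSymbol, ← BoundedContinuousFunction.evalCLM_apply ℂ z (∫ _, _),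
    ← (BoundedContinuousFunction.evalCLM ℂ z).integral_comp_comm (integrable_smul_translate ha hf)]
  rfl

theorem IsClosedInvariantSymbolSpace.convSymbol_mem {D₀ : Submodule ℂ (CSpace n →ᵇ ℂ)}
    (hD : IsClosedInvariantSymbolSpace D₀) {a : CSpace n → ℂ} (ha : Integrable a)
    {f : CSpace n →ᵇ ℂ} (hf : f ∈ D₀) : convSymbol a f ∈ D₀ :=
  integral_mem_of_isClosed hD.2.1 (integrable_smul_translate ha (hD.1 hf)) fun w =>
    D₀.smul_mem _ (hD.2.2 w f hf)

theorem IsNuclearRep.opConvCLM_toeplitz {A : FockSpace n p t →L[ℂ] FockSpace n p t} {r}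
    (h : IsNuclearRep A r) {f : CSpace n →ᵇ ℂ} (hf : f ∈ BUC n) :
    h.opConvCLM (toeplitz p t f) = normConst n t • convSymbol (berezin A) f := by
  ext z
  rw [h.opConvCLM_apply, h.opConv_eq, parityConj_toeplitz, alpha_toeplitz, h.pairing_toeplitz,
    BoundedContinuousFunction.smul_apply, convSymbol_apply (IsNuclear.integrable_berezin ⟨r, h⟩) hf,
    smul_eq_mul]
  simp only [translate_apply, reflect_apply, neg_sub, mul_comm (berezin A _)]

/-! ### The space of Toeplitz operators -/

theorem toeplitz_mem_toeplitzLin {S : Set (CSpace n →ᵇ ℂ)} {f : CSpace n →ᵇ ℂ} (hf : f ∈ S) :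
    toeplitz p t f ∈ toeplitzLin p t S :=
  Submodule.le_topologicalClosure _ (Submodule.subset_span ⟨f, hf, rfl⟩)

theorem isClosed_toeplitzLin (S : Set (CSpace n →ᵇ ℂ)) :
    IsClosed (toeplitzLin p t S : Set (FockSpace n p t →L[ℂ] FockSpace n p t)) :=
  Submodule.isClosed_topologicalClosure _

theorem toeplitzLin_le {S : Set (CSpace n →ᵇ ℂ)}
    {Q : Submodule ℂ (FockSpace n p t →L[ℂ] FockSpace n p t)}
    (hQ : IsClosed (Q : Set (FockSpace n p t →L[ℂ] FockSpace n p t)))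
    (h : ∀ f ∈ S, toeplitz p t f ∈ Q) : toeplitzLin p t S ≤ Q :=
  Submodule.topologicalClosure_minimal _
    (Submodule.span_le.2 (by rintro _ ⟨f, hf, rfl⟩; exact h f hf)) hQ

/-- `𝒞₁` as a subspace. -/
def C1Submodule (n : ℕ) (p t : ℝ) [Fact (1 < p)] [Fact (0 < t)] :
    Submodule ℂ (FockSpace n p t →L[ℂ] FockSpace n p t) where
  carrier := C1 n p t
  add_mem' {A B} ha hb := by
    have h : (fun z => alpha z (A + B)) = fun z => alpha z A + alpha z B := by
      simp only [← alphaCLM_apply, map_add]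
    change Continuous fun z => alpha z (A + B)
    rw [h]
    exact Continuous.add ha hb
  zero_mem' := by
    change Continuous fun z => alpha z 0
    simp only [← alphaCLM_apply, map_zero]
    exact continuous_const
  smul_mem' c A ha := by
    have h : (fun z => alpha z (c • A)) = fun z => c • alpha z A := by
      simp only [← alphaCLM_apply, map_smul]
    change Continuous fun z => alpha z (c • A)
    rw [h]
    exact Continuous.const_smul ha c

theorem isClosed_C1 : IsClosed (C1 n p t) := by
  refine isClosed_of_closure_subset fun A hA => ?_
  refine continuous_of_uniform_approx_of_continuous fun u hu => ?_
  obtain ⟨ε, hε, hεu⟩ := Metric.mem_uniformity_dist.1 hu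
  obtain ⟨B, hB, hAB⟩ := Metric.mem_closure_iff.1 hA ε hε
  refine ⟨fun z => alpha z B, hB, fun z => hεu ?_⟩
  change dist (alphaCLM z A) (alphaCLM z B) < ε
  rw [dist_eq_norm] at hAB ⊢
  rw [← map_sub]
  exact (norm_alpha_le _ _).trans_lt hAB

theorem toeplitz_mem_C1 {f : CSpace n →ᵇ ℂ} (hf : f ∈ BUC n) : toeplitz p t f ∈ C1 n p t := by
  change Continuous fun z => alpha z (toeplitz p t f)
  simp only [alpha_toeplitz]
  exact (toeplitzCLM n p t).continuous.comp (continuous_translate hf)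

theorem isClosedInvariantOperatorSpace_toeplitzLin {D₀ : Submodule ℂ (CSpace n →ᵇ ℂ)}
    (hD : IsClosedInvariantSymbolSpace D₀) :
    IsClosedInvariantOperatorSpace (toeplitzLin p t (D₀ : Set (CSpace n →ᵇ ℂ))) := by
  refine ⟨?_, isClosed_toeplitzLin _, fun z A hA => ?_⟩
  · exact toeplitzLin_le (Q := C1Submodule n p t) isClosed_C1 fun f hf => toeplitz_mem_C1 (hD.1 hf)
  · have h : toeplitzLin p t (D₀ : Set (CSpace n →ᵇ ℂ)) ≤
        (toeplitzLin p t (D₀ : Set (CSpace n →ᵇ ℂ))).comap (alphaCLM z).toLinearMap :=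
      toeplitzLin_le ((isClosed_toeplitzLin _).preimage (alphaCLM z).continuous) fun f hf => by
        rw [Submodule.mem_comap]
        change alpha z (toeplitz p t f) ∈ toeplitzLin p t (D₀ : Set (CSpace n →ᵇ ℂ))
        rw [alpha_toeplitz]
        exact toeplitz_mem_toeplitzLin (hD.2.2 z f hf)
    exact h hA

/-- By linearity and continuity only T_f with f ∈ D₀ matters. There the result is a multiple of A~ ∗
f, an integral of translates of f. -/
theorem IsNuclearRep.opConvCLM_mem {D₀ : Submodule ℂ (CSpace n →ᵇ ℂ)}
    (hD : IsClosedInvariantSymbolSpace D₀) {A : FockSpace n p t →L[ℂ] FockSpace n p t} {r}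
    (h : IsNuclearRep A r) {B : FockSpace n p t →L[ℂ] FockSpace n p t}
    (hB : B ∈ toeplitzLin p t (D₀ : Set (CSpace n →ᵇ ℂ))) : h.opConvCLM B ∈ D₀ := by
  have h1 : toeplitzLin p t (D₀ : Set (CSpace n →ᵇ ℂ)) ≤ D₀.comap h.opConvCLM.toLinearMap :=
    toeplitzLin_le (hD.2.1.preimage h.opConvCLM.continuous) fun f hf => by
      change h.opConvCLM (toeplitz p t f) ∈ D₀
      rw [h.opConvCLM_toeplitz (hD.1 hf)]
      exact D₀.smul_mem _ (hD.convSymbol_mem (IsNuclear.integrable_berezin ⟨r, h⟩) hf)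
  exact h1 hB

theorem berezinBCF_toeplitz_mem {D₀ : Submodule ℂ (CSpace n →ᵇ ℂ)}
    (hD : IsClosedInvariantSymbolSpace D₀) {f : CSpace n →ᵇ ℂ} (hf : f ∈ D₀) :
    berezinBCF (toeplitz p t f) ∈ D₀ := by
  have h := (isNuclearRep_smulRight (evalCLM 0) (constOne : FockSpace n p t)).opConvCLM_mem hD
    (toeplitz_mem_toeplitzLin (p := p) (t := t) hf)
  convert h using 1
  ext z
  rw [IsNuclearRep.opConvCLM_apply]
  exact (opConv_vacuum _ z).symm

/-! ### Convolution of a function with a convolvable operator -/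

section ClosedGraph

variable {E : Type*} [NormedAddCommGroup E] [NormedSpace ℂ E] [CompleteSpace E]

/-- A weakly integrable family of functionals gives a bounded operator into `L¹`. -/
theorem exists_clm_of_weakly_integrable {m : CSpace n → StrongDual ℂ E}
    (hm : ∀ e, Integrable fun z => m z e) :
    ∃ T : E →L[ℂ] Lp ℂ 1 (volume : Measure (CSpace n)), ∀ e, ‖T e‖ = ∫ z, ‖m z e‖ := by
  let T : E →ₗ[ℂ] Lp ℂ 1 (volume : Measure (CSpace n)) :=
    { toFun := fun e => (hm e).toL1 _
      map_add' := fun e f => by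
        rw [← Integrable.toL1_add]
        congr 1
        funext z
        simp
      map_smul' := fun c e => by
        rw [RingHom.id_apply, ← Integrable.toL1_smul]
        congr 1
        funext z
        simp }
  have hT : Continuous T := by
    -- Closed graph: an L¹ limit is an almost everywhere limit along a subsequence, while the
    -- functionals converge at every z.
    refine T.continuous_of_seq_closed_graph fun u x y hu hy => ?_
    obtain ⟨φ, hφ, hφt⟩ := (tendstoInMeasure_of_tendsto_Lp hy).exists_seq_tendsto_ae
    have hcoe : ∀ᵐ z : CSpace n, ∀ k, T (u k) z = m z (u k) :=
      ae_all_iff.2 fun k => (hm (u k)).coeFn_toL1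
    rw [Lp.ext_iff]
    filter_upwards [hφt, hcoe, (hm x).coeFn_toL1] with z h1 h2 h3
    simp only [Function.comp_apply, h2] at h1
    rw [show T x z = m z x from h3]
    exact tendsto_nhds_unique h1 (((m z).continuous.tendsto x).comp (hu.comp hφ.tendsto_atTop))
  refine ⟨⟨T, hT⟩, fun e => ?_⟩
  exact L1.norm_of_fun_eq_integral_norm (hm e)

end ClosedGraph

theorem integrable_of_isConvolvable {A : FockSpace n p t →L[ℂ] FockSpace n p t}
    (hA : IsConvolvable A) (y : StrongDual ℂ (FockSpace n p t)) (x : FockSpace n p t) :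
    Integrable fun z => y (alpha z A x) := by
  refine (hA _ ⟨_, isNuclearRep_smulRight y x⟩).congr (Eventually.of_forall fun z => ?_)
  simp only
  rw [(isNuclearRep_smulRight y x).opConv_parityConj, pairing_smulRight]

/-- Convolvability is only qualitative. The closed graph theorem in x and in y separately, then
Banach–Steinhaus over the unit ball of functionals y, make it a joint bound. -/
theorem exists_isConvolvable_bound {A : FockSpace n p t →L[ℂ] FockSpace n p t}
    (hA : IsConvolvable A) : ∃ M : ℝ, 0 ≤ M ∧ ∀ (y : StrongDual ℂ (FockSpace n p t))
      (x : FockSpace n p t), ∫ z, ‖y (alpha z A x)‖ ≤ M * (‖y‖ * ‖x‖) := by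
  have h1 : ∀ y : StrongDual ℂ (FockSpace n p t), ∃ T : FockSpace n p t →L[ℂ] Lp ℂ 1 volume,
      ∀ x, ‖T x‖ = ∫ z, ‖y (alpha z A x)‖ := fun y =>
    exists_clm_of_weakly_integrable (m := fun z => y.comp (alpha z A))
      (integrable_of_isConvolvable hA y)
  have h2 : ∀ x : FockSpace n p t,
      ∃ T : StrongDual ℂ (FockSpace n p t) →L[ℂ] Lp ℂ 1 (volume : Measure (CSpace n)),
      ∀ y, ‖T y‖ = ∫ z, ‖y (alpha z A x)‖ := fun x =>
    exists_clm_of_weakly_integrable (m := fun z => ContinuousLinearMap.apply ℂ ℂ (alpha z A x))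
      fun y => integrable_of_isConvolvable hA y x
  choose T hT using h1
  choose S hS using h2
  obtain ⟨M, hM⟩ := banach_steinhaus
    (g := fun y : Metric.closedBall (0 : StrongDual ℂ (FockSpace n p t)) 1 => T y) fun x => by
      refine ⟨‖S x‖ * 1, fun y => ?_⟩
      rw [hT, ← hS]
      exact (S x).le_opNorm_of_le (mem_closedBall_zero_iff.1 y.2)
  have hM0 : 0 ≤ M := (norm_nonneg _).trans (hM ⟨0, by simp⟩)
  refine ⟨M, hM0, fun y x => ?_⟩
  rcases eq_or_ne y 0 with rfl | hy
  · simp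
  have hy' : ‖y‖ ≠ 0 := norm_ne_zero_iff.2 hy
  have h3 : ‖((‖y‖⁻¹ : ℝ) : ℂ) • y‖ ≤ 1 := by
    rw [norm_smul, Complex.norm_real, norm_inv, norm_norm, inv_mul_cancel₀ hy']
  have h4 := (T (((‖y‖⁻¹ : ℝ) : ℂ) • y)).le_of_opNorm_le
    (hM ⟨((‖y‖⁻¹ : ℝ) : ℂ) • y, mem_closedBall_zero_iff.2 h3⟩) x
  rw [hT] at h4
  simp only [_root_.smul_apply, norm_smul, Complex.norm_real, norm_inv, norm_norm] at h4
  rw [integral_const_mul, inv_mul_le_iff₀ (by positivity)] at h4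
  linarith

/-- Fubini: convolution with a is transposed to convolution with the reflected function. -/
theorem integral_mul_convolution_swap {a b : CSpace n → ℂ} (ha : Integrable a) (hb : Integrable b)
    (h : CSpace n →ᵇ ℂ) :
    ∫ w, h w * ∫ z, a (w - z) * b z = ∫ z, (∫ w, a (w - z) * h w) * b z := by
  have h1 : Integrable (fun q : CSpace n × CSpace n => b q.2 * a (q.1 - q.2))
      ((volume : Measure (CSpace n)).prod volume) :=
    hb.convolution_integrand (ContinuousLinearMap.mul ℂ ℂ) ha
  have h2 : Integrable (fun q : CSpace n × CSpace n => h q.1 * (b q.2 * a (q.1 - q.2)))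
      ((volume : Measure (CSpace n)).prod volume) :=
    h1.bdd_mul (h.continuous.comp continuous_fst).aestronglyMeasurable
      (Eventually.of_forall fun q => h.norm_coe_le_norm q.1)
  have h3 := integral_integral_swap (f := fun w z : CSpace n => h w * (b z * a (w - z))) h2
  simp only [← integral_const_mul, ← integral_mul_const]
  calc _ = ∫ w, ∫ z, h w * (b z * a (w - z)) := by simp only [mul_comm (b _)]
    _ = _ := h3
    _ = _ := by
      refine integral_congr_ae (Eventually.of_forall fun z =>
        integral_congr_ae (Eventually.of_forall fun w => ?_))
      simp only
      ring

/-- `(γ ∗ h) ∗ A` is the Toeplitz operator with symbol `h ∗ A~`, in the weak sense. -/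
theorem dual_toeplitz_convSymbol {A : FockSpace n p t →L[ℂ] FockSpace n p t}
    (hA : IsNuclear A) (hA' : IsConvolvable A) {h : CSpace n →ᵇ ℂ} (hh : h ∈ BUC n)
    (y : StrongDual ℂ (FockSpace n p t)) (x : FockSpace n p t) :
    y (toeplitz p t (convSymbol (berezin A) h) x) =
      ∫ z, berezinBCF (toeplitz p t h) z * y (alpha z A x) := by
  have hb := hA.integrable_berezin
  have hm := integrable_of_isConvolvable hA' y x
  have hγ : Integrable fun w => (gaussianDensity n t w : ℂ) :=
    (integrable_gaussianDensity n ht.out).ofReal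
  -- Two computations of y(α_w(T_{A~}) x): from T_{A~} = γ ∗ A, and from the coherent state formula
  -- for the translated symbol.
  have hgauss : ∀ w, ∫ z, (gaussianDensity n t (w - z) : ℂ) * y (alpha z A x) =
      normConst n t * ∫ u, berezin A (u - w) * coherentCoeff y x u := by
    intro w
    have hi : Integrable fun v => (gaussianDensity n t v : ℂ) • alpha v A (weyl (-w) x) :=
      integrable_gaussian_smul (continuous_alpha_apply A _) fun v => alpha_apply_norm_le v A _
    have h1 : y (alpha w (toeplitz p t (berezinBCF A)) x) =
        ∫ v, (gaussianDensity n t v : ℂ) * y (alpha (w + v) A x) := by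
      rw [alpha_apply, toeplitz_berezin_apply, ← ContinuousLinearMap.comp_apply,
        ← (y.comp (weyl w)).integral_comp_comm hi]
      refine integral_congr_ae (Eventually.of_forall fun v => ?_)
      simp only [map_smul, smul_eq_mul, ← alpha_alpha, alpha_apply w]
      rfl
    rw [alpha_toeplitz, dual_toeplitz] at h1
    simp only [translate_apply, berezinBCF_apply] at h1
    rw [h1, ← integral_add_left_eq_self _ w]
    simp only [sub_add_cancel_left, gaussianDensity_neg]
  have hconv : ∀ z, ∫ w, (gaussianDensity n t (w - z) : ℂ) * h w = berezinBCF (toeplitz p t h) z := by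
    intro z
    rw [berezinBCF_apply, berezin_toeplitz, ← integral_add_left_eq_self _ z]
    simp only [add_sub_cancel_left]
  have hsym : ∀ u, ∫ w, berezin A (u - w) * h w = convSymbol (berezin A) h u := by
    intro u
    rw [convSymbol_apply hb hh, ← integral_sub_left_eq_self _ volume u]
    simp only [sub_sub_cancel]
  -- Integrating the previous identity against h, the transposition sends γ onto h on one side and
  -- A~ onto h on the other.
  have e1 := integral_mul_convolution_swap hγ hm h
  have e2 := integral_mul_convolution_swap hb.comp_neg (integrable_coherentCoeff y x) h
  simp only [neg_sub, hsym, hconv, hgauss] at e1 e2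
  rw [dual_toeplitz, ← e2, ← e1, ← integral_const_mul]
  simp only [mul_left_comm]

/-- Symbols `f ∈ D₀` whose weak convolution with `A` is an operator in `D₁`. -/
def weakConvSpace (D₀ : Submodule ℂ (CSpace n →ᵇ ℂ))
    (D₁ : Submodule ℂ (FockSpace n p t →L[ℂ] FockSpace n p t))
    {A : FockSpace n p t →L[ℂ] FockSpace n p t} (hA : IsConvolvable A) :
    Submodule ℂ (CSpace n →ᵇ ℂ) where
  carrier := {f | f ∈ D₀ ∧ ∃ C ∈ D₁, ∀ (y : StrongDual ℂ (FockSpace n p t)) (x : FockSpace n p t),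
    y (C x) = ∫ z, f z * y (alpha z A x)}
  add_mem' := by
    rintro f g ⟨hf, C, hC, h⟩ ⟨hg, D, hD, h'⟩
    refine ⟨D₀.add_mem hf hg, C + D, D₁.add_mem hC hD, fun y x => ?_⟩
    have hi := integrable_of_isConvolvable hA y x
    rw [_root_.add_apply, map_add, h, h',
      ← integral_add (integrable_bcf_mul hi f) (integrable_bcf_mul hi g)]
    simp only [BoundedContinuousFunction.add_apply, add_mul]
  zero_mem' := ⟨D₀.zero_mem, 0, D₁.zero_mem, fun y x => by simp⟩
  smul_mem' := by
    rintro c f ⟨hf, C, hC, h⟩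
    refine ⟨D₀.smul_mem c hf, c • C, D₁.smul_mem c hC, fun y x => ?_⟩
    rw [_root_.smul_apply, map_smul, h, smul_eq_mul, ← integral_const_mul]
    simp only [BoundedContinuousFunction.smul_apply, smul_eq_mul, mul_assoc]

/-- The joint bound gives ‖f ∗ A‖ ≤ M ‖f‖, so convergent symbols produce a Cauchy sequence of
operators. -/
theorem isClosed_weakConvSpace {D₀ : Submodule ℂ (CSpace n →ᵇ ℂ)}
    {D₁ : Submodule ℂ (FockSpace n p t →L[ℂ] FockSpace n p t)}
    (hD₀ : IsClosed (D₀ : Set (CSpace n →ᵇ ℂ)))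
    (hD₁ : IsClosed (D₁ : Set (FockSpace n p t →L[ℂ] FockSpace n p t)))
    {A : FockSpace n p t →L[ℂ] FockSpace n p t} (hA : IsConvolvable A) :
    IsClosed (weakConvSpace D₀ D₁ hA : Set (CSpace n →ᵇ ℂ)) := by
  obtain ⟨M, hM0, hM⟩ := exists_isConvolvable_bound hA
  have hbound : ∀ (f : CSpace n →ᵇ ℂ) (y : StrongDual ℂ (FockSpace n p t)) (x : FockSpace n p t),
      ‖∫ z, f z * y (alpha z A x)‖ ≤ ‖f‖ * (M * (‖y‖ * ‖x‖)) := by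
    intro f y x
    have hi := integrable_of_isConvolvable hA y x
    refine (norm_integral_le_of_norm_le (hi.norm.const_mul ‖f‖) (Eventually.of_forall fun z => ?_)).trans ?_
    · rw [norm_mul]
      gcongr
      exact f.norm_coe_le_norm z
    · rw [integral_const_mul]
      gcongr
      exact hM y x
  have hsub : ∀ (f g : CSpace n →ᵇ ℂ) (y : StrongDual ℂ (FockSpace n p t)) (x : FockSpace n p t),
      (∫ z, f z * y (alpha z A x)) - ∫ z, g z * y (alpha z A x) =
        ∫ z, (f - g) z * y (alpha z A x) := by
    intro f g y x
    have hi := integrable_of_isConvolvable hA y x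
    rw [← integral_sub (integrable_bcf_mul hi f) (integrable_bcf_mul hi g)]
    simp only [BoundedContinuousFunction.sub_apply, sub_mul]
  refine IsSeqClosed.isClosed fun f g hf hg => ?_
  choose hf₀ C hC hCf using hf
  have hlip : ∀ k l, ‖C k - C l‖ ≤ M * ‖f k - f l‖ := by
    intro k l
    refine ContinuousLinearMap.opNorm_le_bound _ (by positivity) fun x => ?_
    refine NormedSpace.norm_le_dual_bound ℂ _ (by positivity) fun y => ?_
    rw [_root_.sub_apply, map_sub, hCf, hCf, hsub]
    exact (hbound _ y x).trans_eq (by ring)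
  have hcauchy : CauchySeq C := by
    refine Metric.cauchySeq_iff.2 fun ε hε => ?_
    -- M + 1 in place of M, which may be zero.
    obtain ⟨N, hN⟩ := Metric.cauchySeq_iff.1 hg.cauchySeq (ε / (M + 1)) (by positivity)
    refine ⟨N, fun k hk l hl => ?_⟩
    have h1 := hN k hk l hl
    rw [dist_eq_norm] at h1 ⊢
    refine (hlip k l).trans_lt ?_
    calc M * ‖f k - f l‖ ≤ (M + 1) * ‖f k - f l‖ := by gcongr; linarith
      _ < (M + 1) * (ε / (M + 1)) := by gcongr
      _ = ε := by field_simp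
  obtain ⟨D, hD⟩ := cauchySeq_tendsto_of_complete hcauchy
  refine ⟨hD₀.mem_of_tendsto hg (Eventually.of_forall hf₀), D,
    hD₁.mem_of_tendsto hD (Eventually.of_forall hC), fun y x => ?_⟩
  have h1 : Tendsto (fun k => y (C k x)) atTop (𝓝 (y (D x))) :=
    (y.continuous.tendsto _).comp (((ContinuousLinearMap.apply ℂ _ x).continuous.tendsto D).comp hD)
  refine tendsto_nhds_unique h1 (tendsto_iff_norm_sub_tendsto_zero.2 ?_)
  refine squeeze_zero (fun _ => norm_nonneg _) (g := fun k => ‖f k - g‖ * (M * (‖y‖ * ‖x‖)))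
    (fun k => ?_) ?_
  · rw [hCf, hsub]
    exact hbound _ y x
  · have := (tendsto_iff_norm_sub_tendsto_zero.1 hg).mul_const (M * (‖y‖ * ‖x‖))
    simpa using this

/-- Rank one test operators suffice: the joint L¹ bound permits summing over any nuclear
representation of B. -/
theorem isFunConv_of_weak {f : CSpace n →ᵇ ℂ} {A C : FockSpace n p t →L[ℂ] FockSpace n p t}
    (hA : IsConvolvable A) (h : ∀ (y : StrongDual ℂ (FockSpace n p t)) (x : FockSpace n p t),
      y (C x) = ∫ z, f z * y (alpha z A x)) : IsFunConv f A C := by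
  rintro B ⟨r, hr⟩
  obtain ⟨M, hM0, hM⟩ := exists_isConvolvable_bound hA
  have hi := fun j => integrable_of_isConvolvable hA (r.1 j) (r.2 j)
  have h1 := hasSum_integral_of_hasSum (F := fun j z => f z * r.1 j (alpha z A (r.2 j)))
    (G := fun z => f z * opConv B (parityConj A) z) (fun j => integrable_bcf_mul (hi j) f) ?_
    (fun z => by rw [hr.opConv_parityConj]; exact (hr.hasSum_pairing _).mul_left (f z))
  · rw [hr.nuclearTrace_comp_left]
    exact (hr.hasSum_pairing C).unique (hasSum_of_eq h1.2 fun j => h _ _)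
  · refine Summable.of_nonneg_of_le (fun _ => integral_nonneg fun _ => norm_nonneg _) (fun j => ?_)
      ((hr.1.mul_left M).mul_left ‖f‖)
    refine le_trans ?_ (mul_le_mul_of_nonneg_left (hM (r.1 j) (r.2 j)) (norm_nonneg f))
    rw [← integral_const_mul]
    refine integral_mono (integrable_bcf_mul (hi j) f).norm ((hi j).norm.const_mul _) fun z => ?_
    simp only [norm_mul]
    gcongr
    exact f.norm_coe_le_norm z

/-! ### The correspondence -/

theorem isPair_toeplitzLin {D₀ : Submodule ℂ (CSpace n →ᵇ ℂ)}
    (hD : IsClosedInvariantSymbolSpace D₀) :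
    IsPair D₀ (toeplitzLin p t (D₀ : Set (CSpace n →ᵇ ℂ))) := by
  refine ⟨?_, fun A hA hA' f hf => ?_⟩
  · rintro A ⟨r, h⟩ B hB
    exact ⟨h.opConvCLM B, h.opConvCLM_mem hD hB, h.opConvCLM_apply B⟩
  -- The Tauberian step inside the closed space of good symbols: each translate of γ ∗ f is γ ∗ h
  -- with h ∈ D₀, and its convolution with A is the Toeplitz operator of A~ ∗ h ∈ D₀.
  · have h := mem_of_translate_berezin_mem (p := p) (t := t)
      (isClosed_weakConvSpace hD.2.1 (isClosed_toeplitzLin (p := p) (t := t) D₀) hA') (hD.1 hf)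
      fun z => by
        rw [translate_berezin_toeplitz]
        have hz := hD.2.2 z f hf
        exact ⟨berezinBCF_toeplitz_mem hD hz, _,
          toeplitz_mem_toeplitzLin (hD.convSymbol_mem hA.integrable_berezin hz),
          dual_toeplitz_convSymbol hA hA' (hD.1 hz)⟩
    obtain ⟨_, C, hC, hw⟩ := h
    exact ⟨C, hC, isFunConv_of_weak hA' hw⟩

/-- Test the pair with A = 1 ⊗ δ₀: the duality relation for rank one B is the coherent state formula
for T_f, up to the constant. -/
theorem IsPair.toeplitz_mem {D₀ : Submodule ℂ (CSpace n →ᵇ ℂ)}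
    {D₁ : Submodule ℂ (FockSpace n p t →L[ℂ] FockSpace n p t)} (h : IsPair D₀ D₁)
    {f : CSpace n →ᵇ ℂ} (hf : f ∈ D₀) : toeplitz p t f ∈ D₁ := by
  obtain ⟨C, hC, hfC⟩ := h.2 _ isNuclear_vacuum isConvolvable_vacuum f hf
  have h1 : toeplitz p t f = normConst n t • C := by
    ext1 x
    refine sub_eq_zero.1 (SeparatingDual.eq_zero_of_forall_dual_eq_zero (R := ℂ) fun y => ?_)
    have h2 := hfC _ ⟨_, isNuclearRep_smulRight y x⟩
    rw [(isNuclearRep_smulRight y x).nuclearTrace_comp_left, pairing_smulRight] at h2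
    simp only [(isNuclearRep_smulRight y x).opConv_parityConj, pairing_smulRight, alpha_vacuum,
      map_smul, smul_eq_mul, mul_comm (weighted t x _)] at h2
    rw [map_sub, dual_toeplitz, _root_.smul_apply, map_smul, h2, smul_eq_mul]
    exact sub_self _
  rw [h1]
  exact D₁.smul_mem _ hC

theorem IsPair.berezinBCF_mem {D₀ : Submodule ℂ (CSpace n →ᵇ ℂ)}
    {D₁ : Submodule ℂ (FockSpace n p t →L[ℂ] FockSpace n p t)} (h : IsPair D₀ D₁)
    {C : FockSpace n p t →L[ℂ] FockSpace n p t} (hC : C ∈ D₁) : berezinBCF C ∈ D₀ := by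
  obtain ⟨g, hg, hgz⟩ := h.1 _ isNuclear_vacuum C hC
  convert hg using 1
  ext z
  rw [hgz, opConv_vacuum, berezinBCF_apply]

/-- If `D₀` and `E₀` both form a pair with `D₁`, then `D₀ ≤ E₀`. -/
theorem IsPair.symbolSpace_le {D₀ E₀ : Submodule ℂ (CSpace n →ᵇ ℂ)}
    {D₁ : Submodule ℂ (FockSpace n p t →L[ℂ] FockSpace n p t)} (hD : D₀ ≤ BUC n)
    (h : IsPair D₀ D₁) (hE : IsClosedInvariantSymbolSpace E₀) (h' : IsPair E₀ D₁) : D₀ ≤ E₀ :=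
  fun _ hf => mem_of_translate_berezin_mem (p := p) (t := t) hE.2.1 (hD hf) fun z =>
    hE.2.2 z _ (h'.berezinBCF_mem (h.toeplitz_mem hf))

theorem uniquelyCorrespond_toeplitzLin {D₀ : Submodule ℂ (CSpace n →ᵇ ℂ)}
    (hD : IsClosedInvariantSymbolSpace D₀) :
    UniquelyCorrespond D₀ (toeplitzLin p t (D₀ : Set (CSpace n →ᵇ ℂ))) where
  symbolSpace := hD
  operatorSpace := isClosedInvariantOperatorSpace_toeplitzLin hD
  isPair := isPair_toeplitzLin hD
  unique_operatorSpace E₁ hE h := by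
    have hT := isClosedInvariantOperatorSpace_toeplitzLin (p := p) (t := t) hD
    refine le_antisymm (fun C hC => ?_) (toeplitzLin_le hE.2.1 fun f hf => h.toeplitz_mem hf)
    -- Here C~ ∈ D₀, so γ ∗ C = T_{C~} lies in the Toeplitz space together with its translates, and
    -- the Tauberian step returns C.
    exact mem_of_alpha_toeplitz_berezin_mem hT.2.1 (hE.1 hC) fun z =>
      hT.2.2 z _ (toeplitz_mem_toeplitzLin (h.berezinBCF_mem hC))
  unique_symbolSpace E₀ hE h :=
    le_antisymm (h.symbolSpace_le hE.1 hD (isPair_toeplitzLin hD))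
      ((isPair_toeplitzLin hD).symbolSpace_le hD.1 hE h)

end

end

end Fock

theorem mainTheorem8 (n : ℕ) (p t : ℝ) [Fact (1 < p)] [Fact (0 < t)]
    (D₀ : Submodule ℂ (BoundedContinuousFunction (Fock.CSpace n) ℂ))
    (hBUC : D₀ ≤ Fock.BUC n)
    (hclosed : IsClosed (D₀ : Set (BoundedContinuousFunction (Fock.CSpace n) ℂ)))
    (hinv : ∀ z : Fock.CSpace n, ∀ f ∈ D₀, Fock.translate z f ∈ D₀) :
    Fock.UniquelyCorrespond D₀
      (Fock.toeplitzLin p t (D₀ : Set (BoundedContinuousFunction (Fock.CSpace n) ℂ))) :=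
  Fock.uniquelyCorrespond_toeplitzLin ⟨hBUC, hclosed, hinv⟩
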